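/- **Tie sequences.** A *tie move* is a pair of a region in $\{L,R,C\}$ (left, right, center) and a direction, $i$ (in) or $o$ (out). A *tie sequence* (Fink–Mao) is a finite list of tie moves, followed by one tuck $T$, such that: it begins with $L_i$ or $L_o$; no region occurs twice in succession; the directions alternate; it ends in $L_oR_iC_o$ or $R_oL_iC_o$; it has at most $9$ moves (not counting $T$). **Tie knots.** The passive strand runs from the end $b$ of the tie up a vertical straight strand to a point (the node), then around the neck loop, starting on the left and coming back on the right, to a point $a$ next to the node. So three arms leave the node: the straight strand (downwards), the left and the right half of the neck loop; $L$ is the region between the left half and the straight strand, $C$ lies inside the neck loop, $R$ lies between the right half and the straight strand. The active strand starts at $a$, crosses the straight strand at the node from the side of $R$ into $L$ (first move), and then, for each further move, crosses the arm between its present region and the region of the move, farther from the node than all earlier crossings on that arm. An in-move crosses over the passive strand, an out-move crosses under it. The tuck adds three crossings $t_1,t_2,t_3$: let $D\in\{L,R\}$ be the region of the third-to-last move. From $C$ the active strand crosses over the neck loop into $D$, outside all earlier crossings ($t_1$); then it passes over ($t_2$) and after that under ($t_3$) the piece of the active strand that lies in $D$ between the third-to-last and the second-to-last move, entering the loop formed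 by this piece at $t_2$ and leaving it at $t_3$ (along this piece, $t_2$ comes before $t_3$). Finally it is joined to the passive strand at $b$. This is a knot diagram with $k+3$ crossings for a sequence of $k$ moves; the knot is the *tie knot* of the sequence. **Knot types.** A knot is represented by a knot diagram on the sphere (recorded by its signed Gauss code). Two diagrams have the same *knot type* if they are related by a finite sequence of planar isotopies and Reidemeister moves, change of orientation, and mirror image; by Reidemeister's theorem this is equivalence of tame knots in $\mathbb R^3$ up to ambient isotopy and reflection. Names such as $7_5$ refer to the standard (Alexander–Briggs/Rolfsen) table, where a knot and its mirror image share a name; $0_1$ is the unknot and $3_1$ the trefoil. The twist knot $T_n$ ($n\ge1$) is the alternating knot made of $n$ crossings of two strands twisted together and a clasp with two crossings; the $(2,p)$ torus knot ($p$ odd) is the closure of the 2-braid with $p$ crossings. **Theorem.** There are exactly $85$ tie sequences. The knot types of their tie knots are as follows. Each sequence is listed by its regions (the last move is $C_o$ and the directions alternate, which determines the directions), followed by its Fink–Mao number in parentheses: - $0_{1}$: LRC (1), LCRLC (4), LCLRC (5), LRCLRC (7), LRCRLC (8), LRLCRLC (12), LRLCLRC (14), LRLRCLRC (24), LRLRCRLC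 (26), LRLRLCRLC (46), LRLRLCLRC (50) - $3_{1}$: LRLC (2), LCRCLRC (18), LCRCRLC (19), LCLCRLC (20), LCLCLRC (21), LCRLCRLC (31), LCLRCLRC (32), LCRLCLRC (33), LCLRCRLC (35), LCRLRCLRC (57), LCRLRCRLC (60), LCLRLCRLC (68), LCLRLCLRC (71) - $4_{1}$: LRLRC (3), LRCLCRLC (34), LRCRCLRC (36), LRCLCLRC (37), LRCRCRLC (39), LRCLRCLRC (54), LRCRLCRLC (55), LRCLRCRLC (56), LRCRLCLRC (59) - $5_{1}$: LCLRLC (10), LCLCRCLRC (79), LCLCRCRLC (82), LCLCLCRLC (84), LCLCLCLRC (85) - $5_{2}$: LRLRLC (6), LCRLRC (9), LRLCRCLRC (61), LRLCRCRLC (63), LRLCLCRLC (72), LRLCLCLRC (74), LCRCLCRLC (78), LCRCRCLRC (80), LCRCLCLRC (81), LCRCRCRLC (83) - $6_{1}$: LRLRLRC (11), LRCRLRC (15) - $6_{2}$: LRCLRLC (13), LCLRLRC (17) - $6_{3}$: LCRLRLC (16) - $7_{1}$: LCLCLRLC (42) - $7_{2}$: LRLRLRLC (22), LCRCRLRC (41)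 - $7_{3}$: LRLCLRLC (29), LCLCRLRC (40) - $7_{4}$: LRLCRLRC (23) - $7_{5}$: LCLRLRLC (30), LCRCLRLC (38) - $7_{6}$: LRCRLRLC (27), LCRLRLRC (28) - $7_{7}$: LRCLRLRC (25) - $8_{1}$: LRLRLRLRC (43), LRCRCRLRC (75) - $8_{2}$: LRCLCLRLC (73), LCLCLRLRC (77) - $8_{3}$: LRLRCRLRC (48) - $8_{4}$: LRLRCLRLC (44), LCLRCRLRC (65) - $8_{6}$: LCLRLRLRC (53), LRCRCLRLC (64) - $8_{7}$: LCRLCLRLC (70), LCLCRLRLC (76) - $8_{8}$: LCRLRLRLC (52), LCRCRLRLC (67) - $8_{9}$: LCLRCLRLC (69) - $8_{11}$: LRLCLRLRC (49), LRCLCRLRC (62) - $8_{12}$: LRCRLRLRC (51) - $8_{13}$: LRLCRLRLC (45), LCRLCRLRC (58) - $8_{14}$: LRCLRLRLC (47), LCRCLRLRC (66) The $27$ types in this list are pairwise distinct, so exactly $27$ knot types occur, and all of them have crossing number at most $8$. By the number of moves, the types that occur are: $3$ moves: $0_1$; $4$: $3_1$; $5$: $0_1,4_1$; $6$: $0_1,5_1,5_2$;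 $7$: $0_1,3_1,6_1,6_2,6_3$; $8$: $0_1,3_1,4_1,7_1,\dots,7_7$; $9$: $0_1,3_1,4_1,5_1,5_2,8_1,8_2,8_3,8_4,8_6,8_7,8_8,8_9,8_{11},8_{12},8_{13},8_{14}$. The number of tie sequences of each type, split as (number of sequences)$\times$(number of moves), is: $0_1$: $11=1\times3,\,2\times5,\,2\times6,\,2\times7,\,2\times8,\,2\times9$; $3_1$: $13=1\times4,\,4\times7,\,4\times8,\,4\times9$; $4_1$: $9=1\times5,\,4\times8,\,4\times9$; $5_1$: $5=1\times6,\,4\times9$; $5_2$: $10=2\times6,\,8\times9$. The types $6_1,6_2$ ($7$ moves), $7_2,7_3,7_5,7_6$ ($8$ moves), $8_1,8_2,8_4,8_6,8_7,8_8,8_{11},8_{13},8_{14}$ ($9$ moves) come from $2$ sequences each, and $6_3$ ($7$ moves), $7_1,7_4,7_7$ ($8$ moves), $8_3,8_9,8_{12}$ ($9$ moves) from one sequence each. In particular, among the $85$ tie knots there are $11$ unknots, $13$ trefoils, $25$ twist knots other than unknot and trefoil, $6$ $(2,p)$ torus knots other than unknot and trefoil, and $30$ knots that are neither twist knots nor $(2,p)$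 torus knots; these $30$ represent $18$ knot types. -/

import Mathlib

namespace TieKnots

/-! ### Knot diagrams and knot types -/

/-- One passage of a travelling point through a crossing of an oriented knot diagram:
the label of the crossing, whether the point passes over or under, and whether the crossing is
positive.  A crossing is positive when its over-strand has to be turned counterclockwise
(by less than a half-turn) to point in the direction of its under-strand. -/
structure Pass where
  crossing : ℕ
  isOver : Bool
  isPos : Bool
deriving DecidableEq

/-- The other passage through the same crossing. -/
def Pass.opp (p : Pass) : Pass := ⟨p.crossing, !p.isOver, p.isPos⟩

/-- A signed Gauss code: the passages through crossings in the order in which they are met when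
the knot is traversed once.  The empty code is the diagram without crossings (a round circle). -/
abbrev Code := List Pass

/-- Every crossing that occurs is passed exactly once over and exactly once under, and its two
passages carry the same sign. -/
def IsGaussCode (w : Code) : Prop :=
  (w.map fun p => (p.crossing, p.isOver)).Nodup ∧ ∀ p ∈ w, p.opp ∈ w

instance (w : Code) : Decidable (IsGaussCode w) := by
  unfold IsGaussCode; infer_instance

/-- The `i`-th passage of a code. -/
def passAt (w : Code) (i : ℕ) : Pass := w.getD i ⟨0, true, true⟩

/-- Tracing the faces of the surface carrying the diagram.  The state `(i, f)` is a walker who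
runs along an edge of the diagram and arrives at its `i`-th passage, in the direction of the
orientation if `f = true` and against it if `f = false`.  At the crossing the walker takes the
turn to the left, and walks along the new edge up to the next passage.  (The other strand crosses
the oriented strand of passage `i` from right to left iff `isOver = isPos` there.) -/
def turnLeft (w : Code) (x : ℕ × Bool) : ℕ × Bool :=
  let p := passAt w x.1
  let j := w.idxOf p.opp
  let f := (p.isOver == p.isPos) == x.2
  (if f then (j + 1) % w.length else (j + w.length - 1) % w.length, f)

/-- All states of the walker: the two sides of each edge. -/
def edgeSides (w : Code) : List (ℕ × Bool) :=
  (List.range w.length).flatMap fun i => [(i, false), (i, true)]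

/-- The states that the walker runs through when starting at `x`: the boundary of the face to the
left of `x`. -/
def faceOf (w : Code) (x : ℕ × Bool) : List (ℕ × Bool) :=
  List.iterate (turnLeft w) x (2 * w.length)

/-- The number of faces of the diagram: each face is counted once, at the first of its
edge sides. -/
def faceCount (w : Code) : ℕ :=
  ((edgeSides w).filter fun x =>
    (faceOf w x).all fun y => decide (2 * x.1 + x.2.toNat ≤ 2 * y.1 + y.2.toNat)).length

/-- The number of crossings of a diagram. -/
def crossingCount (w : Code) : ℕ := w.length / 2

/-- A knot diagram on the sphere, given by its signed Gauss code.  The code determines an oriented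
closed surface carrying the diagram with all faces discs; with `n > 0` crossings there are `2 n`
edges, so the surface is a sphere iff there are `n + 2` faces (Euler's formula). -/
def IsKnotDiagram (w : Code) : Prop :=
  IsGaussCode w ∧ (w = [] ∨ faceCount w = crossingCount w + 2)

instance (w : Code) : Decidable (IsKnotDiagram w) := by
  unfold IsKnotDiagram; infer_instance

/-- Two passages in the given order, or in the other order. -/
def two (inOrder : Bool) (p q : Pass) : Code := if inOrder then [p, q] else [q, p]

/-- The moves between diagrams that preserve the unoriented knot up to ambient isotopy and
reflection of space: change of base point, of orientation and of the names of the crossings,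
reflection, and the three Reidemeister moves. -/
inductive Move : Code → Code → Prop
  /-- Change of base point. -/
  | rotate (u v : Code) : Move (u ++ v) (v ++ u)
  /-- Reversal of the orientation (signs of crossings do not change). -/
  | reverse (w : Code) : Move w w.reverse
  /-- Renaming of the crossings. -/
  | relabel (w : Code) (f : ℕ → ℕ)
      (hf : ∀ p ∈ w, ∀ q ∈ w, f p.crossing = f q.crossing → p.crossing = q.crossing) :
      Move w (w.map fun p => ⟨f p.crossing, p.isOver, p.isPos⟩)
  /-- Mirror image: all crossings are switched. -/
  | mirror (w : Code) : Move w (w.map fun p => ⟨p.crossing, !p.isOver, !p.isPos⟩)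
  /-- First Reidemeister move: a curl is put into an edge. -/
  | r1 (w : Code) (p : Pass) : Move w ([p, p.opp] ++ w)
  /-- Second Reidemeister move: a piece of an edge is pushed across a piece of an edge, which makes
  two crossings `a`, `b` of opposite signs.  The two pieces run in the same direction
  (`inOrder = true`) or in opposite directions. -/
  | r2 (u v : Code) (a b : ℕ) (isOver isPos inOrder : Bool) :
      Move (u ++ v)
        ([⟨a, isOver, isPos⟩, ⟨b, isOver, !isPos⟩] ++ u ++
          two inOrder ⟨a, !isOver, isPos⟩ ⟨b, !isOver, !isPos⟩ ++ v)
  /-- Third Reidemeister move: three strands, called top, middle and bottom, cross each other in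
  the corners of a triangular face, in `a` (top and middle), `b` (top and bottom) and `c` (middle
  and bottom); the move reverses the order of the two crossings on each of the three strands.
  Here `α` says that the top strand meets `a` before `b`, `β` that the middle strand meets `a`
  before `c`, and `γ` that the bottom strand meets `b` before `c`.  For three lines in
  the plane the signs of `b` and `c` agree iff `α = β`, and the signs of `a` and `c` agree iff
  `α = γ`.  (By `rotate` and `reverse` it may be assumed that the three strands are met in
  the order top, middle, bottom, starting with the top one.) -/
  | r3 (u v t : Code) (a b c : ℕ) (sa sb sc α β γ : Bool)
      (hb : sb = sc ↔ α = β) (ha : sa = sc ↔ α = γ) :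
      Move
        (two α ⟨a, true, sa⟩ ⟨b, true, sb⟩ ++ u ++ two β ⟨a, false, sa⟩ ⟨c, true, sc⟩ ++ v ++
          two γ ⟨b, false, sb⟩ ⟨c, false, sc⟩ ++ t)
        (two (!α) ⟨a, true, sa⟩ ⟨b, true, sb⟩ ++ u ++ two (!β) ⟨a, false, sa⟩ ⟨c, true, sc⟩ ++ v ++
          two (!γ) ⟨b, false, sb⟩ ⟨c, false, sc⟩ ++ t)

/-- A move between two diagrams on the sphere.  For a second Reidemeister move, the two pieces of
edges lie on the boundary of the same face, since otherwise the result would not be a diagram on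
the sphere. -/
def Step (v w : Code) : Prop := IsKnotDiagram v ∧ IsKnotDiagram w ∧ Move v w

/-- Knot types, as in knot tables: a knot and its mirror image have the same type.  `Quot` divides
by the equivalence relation that the steps generate. -/
def KnotType : Type := Quot Step

/-- The knot type of a diagram. -/
def knotType (w : Code) : KnotType := Quot.mk Step w

/-- The crossing number: the least number of crossings of a diagram of the given type. -/
noncomputable def crossingNumber (T : KnotType) : ℕ :=
  sInf {n | ∃ w, IsKnotDiagram w ∧ knotType w = T ∧ crossingCount w = n}

/-! ### Standard knots -/

/-- The alternating diagram that meets the crossings with the given labels, first over, then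
under, and so on; `sign c` says whether crossing `c` is positive. -/
def alternating (labels : List ℕ) (sign : ℕ → Bool) : Code :=
  labels.mapIdx fun i c => ⟨c, i % 2 == 0, sign c⟩

/-- The alternating diagram with Dowker-Thistlethwaite code `d`.  The passages are numbered
`1, 2, 3, …`; the passage with the odd number `2 i - 1` goes through the same crossing as
the passage whose number is the `i`-th entry of `d`, and this is crossing `i`.  The list `neg` holds
the negative crossings (up to reflection they are determined by `d`). -/
def dowker (d : List ℕ) (neg : List ℕ) : Code :=
  alternating
    ((List.range (2 * d.length)).map fun i =>
      if i % 2 = 0 then i / 2 + 1 else d.idxOf (i + 1) + 1)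
    fun c => !neg.contains c

/-- The `(2, p)` torus knot, for odd `p`, as the closed `2`-braid with `p` positive crossings. -/
def torusCode (p : ℕ) : Code :=
  alternating (List.range p ++ List.range p) fun _ => true

/-- The twist knot `T_n`: two strands are twisted together with `n` crossings `0, …, n - 1`, and
their ends are joined in a clasp with the two further crossings `n` and `n + 1`, so that the
diagram alternates.  For odd `n` the two strands of the clasp run in the same direction and all
crossings have the same sign; for even `n` they run in opposite directions, and the signs of
the clasp and of the twists differ. -/
def twistCode (n : ℕ) : Code :=
  alternating
    (List.range n ++ (if n % 2 = 0 then [n, n + 1] else [n + 1, n]) ++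
      (List.range n).reverse ++ [n + 1, n])
    fun c => decide (n % 2 = 1) || decide (c < n)

/-- The types of the `(2, p)` torus knots. -/
def IsTwoBraidTorusType (T : KnotType) : Prop := ∃ p, p % 2 = 1 ∧ knotType (torusCode p) = T

/-- The types of the twist knots. -/
def IsTwistType (T : KnotType) : Prop := ∃ n, 1 ≤ n ∧ knotType (twistCode n) = T

/-- The names, in the standard (Alexander-Briggs, Rolfsen) knot table, of the knots that are
needed. -/
inductive TableKnot
  | k0_1 | k3_1 | k4_1 | k5_1 | k5_2 | k6_1 | k6_2 | k6_3 | k7_1 | k7_2 | k7_3 | k7_4 | k7_5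
  | k7_6 | k7_7 | k8_1 | k8_2 | k8_3 | k8_4 | k8_6 | k8_7 | k8_8 | k8_9 | k8_11 | k8_12 |
  k8_13 | k8_14
deriving DecidableEq

namespace TableKnot

/-- The diagrams of the knot table, from their Dowker-Thistlethwaite codes. -/
def code : TableKnot → Code
  | k0_1 => dowker [] []
  | k3_1 => dowker [4, 6, 2] []
  | k4_1 => dowker [4, 6, 8, 2] [2, 4]
  | k5_1 => dowker [6, 8, 10, 2, 4] []
  | k5_2 => dowker [4, 8, 10, 2, 6] []
  | k6_1 => dowker [4, 8, 12, 10, 2, 6] [2, 5]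
  | k6_2 => dowker [4, 8, 10, 12, 2, 6] [2, 5]
  | k6_3 => dowker [4, 8, 10, 2, 12, 6] [3, 5, 6]
  | k7_1 => dowker [8, 10, 12, 14, 2, 4, 6] []
  | k7_2 => dowker [4, 10, 14, 12, 2, 8, 6] []
  | k7_3 => dowker [6, 10, 12, 14, 2, 4, 8] []
  | k7_4 => dowker [6, 10, 12, 14, 4, 2, 8] []
  | k7_5 => dowker [4, 10, 12, 14, 2, 8, 6] []
  | k7_6 => dowker [4, 8, 12, 2, 14, 6, 10] [5, 7]
  | k7_7 => dowker [4, 8, 10, 12, 2, 14, 6] [2, 4, 5, 7]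
  | k8_1 => dowker [4, 10, 16, 14, 12, 2, 8, 6] [2, 6]
  | k8_2 => dowker [4, 10, 12, 14, 16, 2, 6, 8] [2, 6]
  | k8_3 => dowker [6, 12, 10, 16, 14, 4, 2, 8] [2, 3, 6, 7]
  | k8_4 => dowker [6, 10, 12, 16, 14, 4, 2, 8] [2, 3, 6, 7]
  | k8_6 => dowker [4, 10, 14, 16, 12, 2, 8, 6] [2, 6]
  | k8_7 => dowker [4, 10, 12, 14, 2, 16, 6, 8] [3, 4, 6, 7, 8]
  | k8_8 => dowker [4, 8, 12, 2, 16, 14, 6, 10] [3, 5, 6, 7, 8]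
  | k8_9 => dowker [6, 10, 12, 14, 16, 4, 2, 8] [2, 3, 6, 7]
  | k8_11 => dowker [4, 10, 12, 14, 16, 2, 8, 6] [2, 6]
  | k8_12 => dowker [4, 8, 14, 10, 2, 16, 6, 12] [2, 5, 6, 8]
  | k8_13 => dowker [4, 10, 12, 14, 2, 16, 8, 6] [3, 4, 6, 7, 8]
  | k8_14 => dowker [4, 8, 10, 14, 2, 16, 6, 12] [2, 5]

/-- The type of a knot of the table. -/
def type (K : TableKnot) : KnotType := knotType K.code

end TableKnot

/-! ### Tie sequences -/

/-- The regions left, right and center. -/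
inductive Region
  | L | R | C
deriving DecidableEq

/-- A tie move: the active strand crosses into `region`, over the passive strand if `inward` (an
in-move) and under it otherwise (an out-move). -/
structure TieMove where
  region : Region
  inward : Bool
deriving DecidableEq

abbrev Li : TieMove := ⟨.L, true⟩
abbrev Lo : TieMove := ⟨.L, false⟩
abbrev Ri : TieMove := ⟨.R, true⟩
abbrev Ro : TieMove := ⟨.R, false⟩
abbrev Ci : TieMove := ⟨.C, true⟩
abbrev Co : TieMove := ⟨.C, false⟩

/-- The tie sequences of Fink and Mao.  The final tuck is not written: every sequence is followed
by exactly one tuck. -/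
structure IsTieSequence (s : List TieMove) : Prop where
  start_left : s.head? = some Li ∨ s.head? = some Lo
  no_region_repeated : s.IsChain fun x y => x.region ≠ y.region
  directions_alternate : s.IsChain fun x y => x.inward ≠ y.inward
  flat_facade : [Lo, Ri, Co] <:+ s ∨ [Ro, Li, Co] <:+ s
  at_most_nine : s.length ≤ 9

/-! ### The diagram of a tie knot

The first move crosses the passive strand in a point, the node, from which three arms of the passive
strand start: the bottom arm (the straight strand) runs down to the end `b` of the tie; the left arm
and the right arm, which ends at the start `a` of the active strand just before the node, are the two
halves of the neck loop.  The regions are `L` between the left and the bottom arm, `C`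
between the left and the right arm, and `R` between the right and the bottom arm.  Seen from the node,
the regions `L`, `C`, `R` follow each other clockwise.  The active strand spirals outwards: on each arm,
later crossings are farther from the node.  The knot is oriented along the active strand from `a` to
`b`, then up the bottom arm to the node, outwards along the left arm, and back along the right arm. -/

/-- The arms of the passive strand. -/
inductive Arm
  | bottom | left | right
deriving DecidableEq

/-- The arm between two different regions. -/
def arm : Region → Region → Arm
  | .L, .C => .left
  | .C, .L => .left
  | .C, .R => .right
  | .R, .C => .right
  | _, _ => .bottom

/-- Whether the change from one region to the other is clockwise around the node. -/
def clockwise : Region → Region → Bool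
  | .L, .C => true
  | .C, .R => true
  | .R, .L => true
  | _, _ => false

/-- The crossing, with label `i`, in which the active strand goes from the region `X` into the region
of the move `m`: the arm on which it lies and the passage of the active strand.  The passive strand is
oriented away from the node on the left arm and towards the node on the others; a
clockwise over-crossing of a strand that points away from the node is positive. -/
def moveCrossing (i : ℕ) (X : Region) (m : TieMove) : Arm × Pass :=
  (arm X m.region,
    ⟨i, m.inward, (clockwise X m.region == decide (arm X m.region = .left)) == m.inward⟩)

/-- The crossings of a list of moves with the passive strand.  The active strand comes down
the right arm and crosses, with its first move, from the side of the region `R` to `L`. -/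
def moveCrossings (s : List TieMove) : List (Arm × Pass) :=
  ((Region.R :: s.map TieMove.region).zip s).mapIdx fun i x => moveCrossing i x.1 x.2

/-- The region of the third move from the end: the loop through which the end is tucked lies there,
between the third and the second move from the end. -/
def loopRegion (s : List TieMove) : Region := (s.getD (s.length - 3) Lo).region

/-- The diagram of the tie knot of a tie sequence with `k` moves, which have the labels
`0, …, k - 1`.  The tuck makes three crossings: with label `k`, the active strand goes from `C` into
the region of the loop, over the neck loop; with label `k + 1`, it crosses over the loop, into
its inside; with label `k + 2`, it crosses under the loop, and out of it.  On the loop, the latter two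
crossings are met in this order, right after the third move from the end.  The inside of the loop is
on the right-hand side of the loop if the loop lies in `R`, and on the left-hand side if it lies
in `L`; this decides about the signs of the two crossings.  Then the two ends are joined at `b`, and the
passive strand is followed back to `a`. -/
def tieCode (s : List TieMove) : Code :=
  let k := s.length
  let D := loopRegion s
  let xs := moveCrossings (s ++ [⟨D, true⟩])
  let t₂ : Pass := ⟨k + 1, true, decide (D = .R)⟩
  let t₃ : Pass := ⟨k + 2, false, decide (D = .R)⟩
  let active := xs.map Prod.snd
  let passive : Arm → Code := fun A => (xs.filter fun x => x.1 = A).map fun x => x.2.opp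
  active.take (k - 2) ++ [t₂.opp, t₃.opp] ++ active.drop (k - 2) ++ [t₂, t₃] ++
    (passive .bottom).reverse ++ passive .left ++ (passive .right).reverse

/-- The knot type of the tie knot of a tie sequence. -/
def tieType (s : List TieMove) : KnotType := knotType (tieCode s)

/-! ### The lists to be established -/

open TableKnot

/-- The list of the tie sequences (in the numbering `1, …, 85` of Fink and Mao) with
the types of their tie knots. -/
def tieTable : List (List TieMove × TableKnot) :=
  [([Lo, Ri, Co], k0_1),
   ([Li, Ro, Li, Co], k3_1),
   ([Lo, Ri, Lo, Ri, Co], k4_1),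
   ([Lo, Ci, Ro, Li, Co], k0_1),
   ([Lo, Ci, Lo, Ri, Co], k0_1),
   ([Li, Ro, Li, Ro, Li, Co], k5_2),
   ([Li, Ro, Ci, Lo, Ri, Co], k0_1),
   ([Li, Ro, Ci, Ro, Li, Co], k0_1),
   ([Li, Co, Ri, Lo, Ri, Co], k5_2),
   ([Li, Co, Li, Ro, Li, Co], k5_1),
   ([Lo, Ri, Lo, Ri, Lo, Ri, Co], k6_1),
   ([Lo, Ri, Lo, Ci, Ro, Li, Co], k0_1),
   ([Lo, Ri, Co, Li, Ro, Li, Co], k6_2),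
   ([Lo, Ri, Lo, Ci, Lo, Ri, Co], k0_1),
   ([Lo, Ri, Co, Ri, Lo, Ri, Co], k6_1),
   ([Lo, Ci, Ro, Li, Ro, Li, Co], k6_3),
   ([Lo, Ci, Lo, Ri, Lo, Ri, Co], k6_2),
   ([Lo, Ci, Ro, Ci, Lo, Ri, Co], k3_1),
   ([Lo, Ci, Ro, Ci, Ro, Li, Co], k3_1),
   ([Lo, Ci, Lo, Ci, Ro, Li, Co], k3_1),
   ([Lo, Ci, Lo, Ci, Lo, Ri, Co], k3_1),
   ([Li, Ro, Li, Ro, Li, Ro, Li, Co], k7_2),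
   ([Li, Ro, Li, Co, Ri, Lo, Ri, Co], k7_4),
   ([Li, Ro, Li, Ro, Ci, Lo, Ri, Co], k0_1),
   ([Li, Ro, Ci, Lo, Ri, Lo, Ri, Co], k7_7),
   ([Li, Ro, Li, Ro, Ci, Ro, Li, Co], k0_1),
   ([Li, Ro, Ci, Ro, Li, Ro, Li, Co], k7_6),
   ([Li, Co, Ri, Lo, Ri, Lo, Ri, Co], k7_6),
   ([Li, Ro, Li, Co, Li, Ro, Li, Co], k7_3),
   ([Li, Co, Li, Ro, Li, Ro, Li, Co], k7_5),
   ([Li, Co, Ri, Lo, Ci, Ro, Li, Co], k3_1),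
   ([Li, Co, Li, Ro, Ci, Lo, Ri, Co], k3_1),
   ([Li, Co, Ri, Lo, Ci, Lo, Ri, Co], k3_1),
   ([Li, Ro, Ci, Lo, Ci, Ro, Li, Co], k4_1),
   ([Li, Co, Li, Ro, Ci, Ro, Li, Co], k3_1),
   ([Li, Ro, Ci, Ro, Ci, Lo, Ri, Co], k4_1),
   ([Li, Ro, Ci, Lo, Ci, Lo, Ri, Co], k4_1),
   ([Li, Co, Ri, Co, Li, Ro, Li, Co], k7_5),
   ([Li, Ro, Ci, Ro, Ci, Ro, Li, Co], k4_1),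
   ([Li, Co, Li, Co, Ri, Lo, Ri, Co], k7_3),
   ([Li, Co, Ri, Co, Ri, Lo, Ri, Co], k7_2),
   ([Li, Co, Li, Co, Li, Ro, Li, Co], k7_1),
   ([Lo, Ri, Lo, Ri, Lo, Ri, Lo, Ri, Co], k8_1),
   ([Lo, Ri, Lo, Ri, Co, Li, Ro, Li, Co], k8_4),
   ([Lo, Ri, Lo, Ci, Ro, Li, Ro, Li, Co], k8_13),
   ([Lo, Ri, Lo, Ri, Lo, Ci, Ro, Li, Co], k0_1),
   ([Lo, Ri, Co, Li, Ro, Li, Ro, Li, Co], k8_14),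
   ([Lo, Ri, Lo, Ri, Co, Ri, Lo, Ri, Co], k8_3),
   ([Lo, Ri, Lo, Ci, Lo, Ri, Lo, Ri, Co], k8_11),
   ([Lo, Ri, Lo, Ri, Lo, Ci, Lo, Ri, Co], k0_1),
   ([Lo, Ri, Co, Ri, Lo, Ri, Lo, Ri, Co], k8_12),
   ([Lo, Ci, Ro, Li, Ro, Li, Ro, Li, Co], k8_8),
   ([Lo, Ci, Lo, Ri, Lo, Ri, Lo, Ri, Co], k8_6),
   ([Lo, Ri, Co, Li, Ro, Ci, Lo, Ri, Co], k4_1),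
   ([Lo, Ri, Co, Ri, Lo, Ci, Ro, Li, Co], k4_1),
   ([Lo, Ri, Co, Li, Ro, Ci, Ro, Li, Co], k4_1),
   ([Lo, Ci, Ro, Li, Ro, Ci, Lo, Ri, Co], k3_1),
   ([Lo, Ci, Ro, Li, Co, Ri, Lo, Ri, Co], k8_13),
   ([Lo, Ri, Co, Ri, Lo, Ci, Lo, Ri, Co], k4_1),
   ([Lo, Ci, Ro, Li, Ro, Ci, Ro, Li, Co], k3_1),
   ([Lo, Ri, Lo, Ci, Ro, Ci, Lo, Ri, Co], k5_2),
   ([Lo, Ri, Co, Li, Co, Ri, Lo, Ri, Co], k8_11),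
   ([Lo, Ri, Lo, Ci, Ro, Ci, Ro, Li, Co], k5_2),
   ([Lo, Ri, Co, Ri, Co, Li, Ro, Li, Co], k8_6),
   ([Lo, Ci, Lo, Ri, Co, Ri, Lo, Ri, Co], k8_4),
   ([Lo, Ci, Ro, Ci, Lo, Ri, Lo, Ri, Co], k8_14),
   ([Lo, Ci, Ro, Ci, Ro, Li, Ro, Li, Co], k8_8),
   ([Lo, Ci, Lo, Ri, Lo, Ci, Ro, Li, Co], k3_1),
   ([Lo, Ci, Lo, Ri, Co, Li, Ro, Li, Co], k8_9),
   ([Lo, Ci, Ro, Li, Co, Li, Ro, Li, Co], k8_7),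
   ([Lo, Ci, Lo, Ri, Lo, Ci, Lo, Ri, Co], k3_1),
   ([Lo, Ri, Lo, Ci, Lo, Ci, Ro, Li, Co], k5_2),
   ([Lo, Ri, Co, Li, Co, Li, Ro, Li, Co], k8_2),
   ([Lo, Ri, Lo, Ci, Lo, Ci, Lo, Ri, Co], k5_2),
   ([Lo, Ri, Co, Ri, Co, Ri, Lo, Ri, Co], k8_1),
   ([Lo, Ci, Lo, Ci, Ro, Li, Ro, Li, Co], k8_7),
   ([Lo, Ci, Lo, Ci, Lo, Ri, Lo, Ri, Co], k8_2),
   ([Lo, Ci, Ro, Ci, Lo, Ci, Ro, Li, Co], k5_2),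
   ([Lo, Ci, Lo, Ci, Ro, Ci, Lo, Ri, Co], k5_1),
   ([Lo, Ci, Ro, Ci, Ro, Ci, Lo, Ri, Co], k5_2),
   ([Lo, Ci, Ro, Ci, Lo, Ci, Lo, Ri, Co], k5_2),
   ([Lo, Ci, Lo, Ci, Ro, Ci, Ro, Li, Co], k5_1),
   ([Lo, Ci, Ro, Ci, Ro, Ci, Ro, Li, Co], k5_2),
   ([Lo, Ci, Lo, Ci, Lo, Ci, Ro, Li, Co], k5_1),
   ([Lo, Ci, Lo, Ci, Lo, Ci, Lo, Ri, Co], k5_1)]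

/-- The knot types that occur for a given number of tie moves. -/
def typesWithMoves : ℕ → List TableKnot
  | 3 => [k0_1]
  | 4 => [k3_1]
  | 5 => [k0_1, k4_1]
  | 6 => [k0_1, k5_1, k5_2]
  | 7 => [k0_1, k3_1, k6_1, k6_2, k6_3]
  | 8 => [k0_1, k3_1, k4_1, k7_1, k7_2, k7_3, k7_4, k7_5, k7_6, k7_7]
  | 9 => [k0_1, k3_1, k4_1, k5_1, k5_2, k8_1, k8_2, k8_3, k8_4, k8_6, k8_7, k8_8, k8_9, k8_11, k8_12, k8_13, k8_14]
  | _ => []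

/-- For each knot type, pairs of a number of tie moves and the number of tie sequences with this
number of moves that give the type. -/
def countsByMoves : TableKnot → List (ℕ × ℕ)
  | k0_1 => [(3, 1), (5, 2), (6, 2), (7, 2), (8, 2), (9, 2)]
  | k3_1 => [(4, 1), (7, 4), (8, 4), (9, 4)]
  | k4_1 => [(5, 1), (8, 4), (9, 4)]
  | k5_1 => [(6, 1), (9, 4)]
  | k5_2 => [(6, 2), (9, 8)]
  | k6_1 => [(7, 2)]
  | k6_2 => [(7, 2)]
  | k6_3 => [(7, 1)]
  | k7_1 => [(8, 1)]
  | k7_2 => [(8, 2)]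
  | k7_3 => [(8, 2)]
  | k7_4 => [(8, 1)]
  | k7_5 => [(8, 2)]
  | k7_6 => [(8, 2)]
  | k7_7 => [(8, 1)]
  | k8_1 => [(9, 2)]
  | k8_2 => [(9, 2)]
  | k8_3 => [(9, 1)]
  | k8_4 => [(9, 2)]
  | k8_6 => [(9, 2)]
  | k8_7 => [(9, 2)]
  | k8_8 => [(9, 2)]
  | k8_9 => [(9, 1)]
  | k8_11 => [(9, 2)]
  | k8_12 => [(9, 1)]
  | k8_13 => [(9, 2)]
  | k8_14 => [(9, 2)]

/-- For each knot type, the number of tie sequences that give it. -/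
def totalCount : TableKnot → ℕ
  | k0_1 => 11
  | k3_1 => 13
  | k4_1 => 9
  | k5_1 => 5
  | k5_2 => 10
  | k6_1 => 2
  | k6_2 => 2
  | k6_3 => 1
  | k7_1 => 1
  | k7_2 => 2
  | k7_3 => 2
  | k7_4 => 1
  | k7_5 => 2
  | k7_6 => 2
  | k7_7 => 1
  | k8_1 => 2
  | k8_2 => 2
  | k8_3 => 1
  | k8_4 => 2
  | k8_6 => 2
  | k8_7 => 2
  | k8_8 => 2
  | k8_9 => 1
  | k8_11 => 2
  | k8_12 => 1
  | k8_13 => 2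
  | k8_14 => 2

end TieKnots

/-!
The tie sequences are enumerated: starting with the first move there are at most two ways to go on at
each step, and the lists that end as required are those of `tieTable` (`isTieSequence_iff_mem`).

That each tie knot has the type given in the table is shown by explicit Reidemeister moves from its
diagram to the diagram in the knot table.  The moves are recorded in `tieReductions`, and
`knotType_of_leadsTo` makes sure that they are moves and that all diagrams on the way lie on the
sphere; for the latter, `isKnotDiagram_of_fastPlanar` gives a test that can be evaluated quickly.

The 27 types are distinguished by the Jones polynomial.  It is defined as a state sum with values in a
commutative ring in which `N = -(s + s⁻¹)` is the image of a natural number: let the edges of a diagram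
carry labels from a set with `N` elements.  A smoothing of a crossing is a product of two Kronecker
deltas in the labels of the four edges, and summing over the labels gives the factor `N` for each closed
curve of a state, as in Kauffman's bracket.  Moreover each delta is a sum of elementary matrices, so
that a crossing becomes a sum over states in which each of its two passages has a matrix of its own, and
the state sum is a sum of traces of the products of these matrices along the code (`jones`).  In this
form planarity plays no role, and the Reidemeister moves become identities of tensors with at
most three crossings (`crossingTensor_curl`, `crossingTensor_bigon`, `triangle_flip`).  Reflection exchanges
`s` and `s⁻¹`, so a symmetric function of the two values is an invariant of knot types
(`jonesPair_eq_of_knotType_eq`).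

With `s = 3` in the field with 757 elements, and `N = 249`, this invariant takes 27 different values on
the table.  The values are computed by smoothing one crossing after the other (`stateSum_traceProd`).  For
the infinite families of twist knots and `(2, p)` torus knots the same recursion gives closed
forms (`jones_twistCode`, `jones_torusCode`).  Since `3` has order 9, they are periodic in the number
of crossings, and a finite comparison shows that no other knot of the table is a twist knot or a `(2, p)`
torus knot (`isTwistType_iff`, `isTwoBraidTorusType_iff`).  The remaining statements are counts in the
table.
-/

namespace TieKnots

/-! ### A fast test for diagrams on the sphere -/

/-- A passage as a natural number, for fast comparison. -/
def Pass.toNat (p : Pass) : ℕ := 4 * p.crossing + 2 * p.isOver.toNat + p.isPos.toNat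

theorem Pass.toNat_injective : Function.Injective Pass.toNat := by
  rintro ⟨a, b, c⟩ ⟨a', b', c'⟩ h
  cases b <;> cases b' <;> cases c <;> cases c' <;> simp [Pass.toNat] at h ⊢ <;> omega

theorem idxOf_map_of_injective {α β : Type*} [DecidableEq α] [DecidableEq β] {f : α → β}
    (hf : Function.Injective f) (a : α) (l : List α) : (l.map f).idxOf (f a) = l.idxOf a := by
  induction l with
  | nil => simp
  | cons b l ih =>
    by_cases h : b = a
    · subst h; simp
    · rw [List.map_cons, List.idxOf_cons_ne _ (fun h' => h (hf h')), List.idxOf_cons_ne _ h, ih]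

/-! The functions from here to `fastPlanar` are meant for evaluation by the kernel: they use recursors
and the operations on natural numbers that the kernel computes natively. -/

/-- The list of the codes of the passages. -/
def natCodes (w : Code) : List ℕ :=
  List.rec [] (fun p _ r => Nat.add (Nat.mul 4 p.crossing)
    (cond p.isOver (cond p.isPos 3 2) (cond p.isPos 1 0)) :: r) w

/-- Whether `a` is an entry of `l`. -/
def memNat (a : ℕ) (l : List ℕ) : Bool :=
  List.rec false (fun b _ r => cond (Nat.beq b a) true r) l

/-- Whether the halves of the entries of `l`, rounded down, are distinct. -/
def nodupHalves (l : List ℕ) : Bool :=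
  List.rec true (fun b l r =>
    cond (memNat b l) false (cond (memNat (cond (Nat.beq (Nat.mod b 2) 0) (Nat.succ b) (Nat.pred b)) l)
      false r)) l

/-- The index of the first occurrence of `a` in `l`. -/
def indexNat (a : ℕ) (l : List ℕ) : ℕ :=
  List.rec 0 (fun b _ r => cond (Nat.beq b a) 0 (Nat.succ r)) l

/-- The code of the passage opposite to the one with code `n`. -/
def oppNat (n : ℕ) : ℕ := cond (Nat.beq (Nat.mod (Nat.div n 2) 2) 0) (Nat.add n 2) (Nat.sub n 2)

/-- The number with the digits `a`, `b` in base `256`, followed by the digits of `r`. -/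
def consDigits (a b r : ℕ) : ℕ := Nat.add (Nat.add a (Nat.mul 256 b)) (Nat.mul 65536 r)

/-- The table of `turnLeft`, as the digits of a number in base `256`, for a code of length `L`
with the list `m` of passages; `l` is the rest of the list for which the table is to be made.  If the
opposite passage has index `j`, the two edge sides that end at a passage are mapped to two edge
sides with indices `j - 1` and `j + 1` modulo `L`. -/
def turnNumber (L : ℕ) (m l : List ℕ) : ℕ :=
  List.rec 0 (fun n _ r =>
    let j := indexNat (oppNat n) m
    let a := Nat.mul 2 (Nat.mod (Nat.sub (Nat.add j L) 1) L)
    let b := Nat.succ (Nat.mul 2 (Nat.mod (Nat.succ j) L))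
    cond (Nat.beq (Nat.mod (Nat.div n 2) 2) (Nat.mod n 2)) (consDigits a b r) (consDigits b a r)) l

/-- The digit of `T` with index `y`, in base `256`. -/
def digit (T y : ℕ) : ℕ := Nat.mod (Nat.shiftRight T (Nat.mul 8 y)) 256

/-- Whether `x` is the least point of its orbit under the map with table `T`; the walk along
the orbit has reached a given point and goes on for at most `n` steps. -/
def isLeast (T x n : ℕ) : ℕ → Bool :=
  Nat.rec (fun _ => true) (fun _ ih y => cond (Nat.ble y x) (Nat.beq y x) (ih (digit T y))) n

/-- The number of `x < n` that are the least points of their orbits, if the orbits have at most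
`L` points. -/
def leastCount (T L n : ℕ) : ℕ :=
  Nat.rec 0 (fun x r => cond (isLeast T x L (digit T x)) (Nat.succ r) r) n

/-- A fast sufficient test for `IsKnotDiagram`. -/
def fastPlanar (w : Code) : Bool :=
  let l := natCodes w
  let L := l.length
  cond (nodupHalves l) (cond (l.all fun n => memNat (oppNat n) l)
    (cond (Nat.ble L 128) (cond (Nat.beq L 0) true
      (Nat.beq (leastCount (turnNumber L l l) (Nat.pred (Nat.mul 2 L)) (Nat.mul 2 L))
        (Nat.add (Nat.div L 2) 2))) false) false) false

/-- An edge side as a number. -/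
def sideNat (x : ℕ × Bool) : ℕ := 2 * x.1 + x.2.toNat

theorem sideNat_injective : Function.Injective sideNat := by
  rintro ⟨a, b⟩ ⟨a', b'⟩ h
  cases b <;> cases b' <;> simp [sideNat] at h ⊢ <;> omega

theorem beq_eq_false {a b : ℕ} (h : a ≠ b) : Nat.beq a b = false := by
  rw [← Bool.not_eq_true, Nat.beq_eq]; exact h

theorem natCodes_eq (w : Code) : natCodes w = w.map Pass.toNat := by
  induction w with
  | nil => rfl
  | cons p w ih =>
    rw [List.map_cons, ← ih]
    obtain ⟨c, o, s⟩ := p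
    cases o <;> cases s <;> rfl

theorem memNat_eq_true {a : ℕ} {l : List ℕ} : memNat a l = true ↔ a ∈ l := by
  induction l with
  | nil => simp [memNat]
  | cons b l ih =>
    rw [List.mem_cons, ← ih]
    change cond (Nat.beq b a) true (memNat a l) = true ↔ _
    by_cases h : b = a
    · simp [h]
    · rw [beq_eq_false h]; simp [Ne.symm h]

theorem indexNat_eq (a : ℕ) (l : List ℕ) : indexNat a l = l.idxOf a := by
  induction l with
  | nil => rfl
  | cons b l ih =>
    change cond (Nat.beq b a) 0 (Nat.succ (indexNat a l)) = _
    by_cases h : b = a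
    · simp [h]
    · rw [beq_eq_false h, List.idxOf_cons_ne _ h, ih]; rfl

theorem nodup_of_nodupHalves {l : List ℕ} (h : nodupHalves l = true) : (l.map (· / 2)).Nodup := by
  induction l with
  | nil => simp
  | cons b l ih =>
    change cond (memNat b l) false (cond (memNat
      (cond (Nat.beq (b % 2) 0) (Nat.succ b) (Nat.pred b)) l) false (nodupHalves l)) = true at h
    cases h1 : memNat b l <;> rw [h1] at h
    · cases h2 : memNat (cond (Nat.beq (b % 2) 0) (Nat.succ b) (Nat.pred b)) l <;> rw [h2] at h
      · refine List.nodup_cons.2 ⟨fun hm => ?_, ih h⟩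
        obtain ⟨c, hc, hcb⟩ := List.mem_map.1 hm
        have hcb : c / 2 = b / 2 := hcb
        rw [← Bool.not_eq_true, memNat_eq_true] at h1 h2
        rcases Nat.mod_two_eq_zero_or_one b with hb | hb
        · rw [hb] at h2
          have : c = b ∨ c = b + 1 := by omega
          rcases this with rfl | rfl
          · exact h1 hc
          · exact h2 hc
        · rw [hb] at h2
          have : c = b ∨ c = b - 1 := by omega
          rcases this with rfl | rfl
          · exact h1 hc
          · exact h2 hc
      · cases h
    · cases h

theorem digit_consDigits (a b r : ℕ) (ha : a < 256) (hb : b < 256) :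
    digit (consDigits a b r) 0 = a ∧ digit (consDigits a b r) 1 = b ∧
      ∀ y, digit (consDigits a b r) (y + 2) = digit r y := by
  have hd : ∀ T y, digit T y = T / 256 ^ y % 256 := by
    intro T y
    change (T >>> (8 * y)) % 256 = _
    rw [Nat.shiftRight_eq_div_pow, pow_mul]
    norm_num
  have hc : consDigits a b r = a + 256 * b + 65536 * r := rfl
  refine ⟨?_, ?_, fun y => ?_⟩
  · rw [hd, hc, pow_zero, Nat.div_one]; omega
  · rw [hd, hc, pow_one]; omega
  · rw [hd, hd, hc, add_comm y 2, pow_add, ← Nat.div_div_eq_div_mul,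
      show (a + 256 * b + 65536 * r) / 256 ^ 2 = r by norm_num; omega]

theorem Pass.toNat_div_mod (p : Pass) : p.toNat / 2 % 2 = p.isOver.toNat := by
  obtain ⟨c, o, s⟩ := p
  cases o <;> cases s <;> simp [Pass.toNat] <;> omega

theorem Pass.toNat_mod (p : Pass) : p.toNat % 2 = p.isPos.toNat := by
  obtain ⟨c, o, s⟩ := p
  cases o <;> cases s <;> simp [Pass.toNat] <;> omega

theorem Pass.toNat_opp (p : Pass) : p.opp.toNat = oppNat p.toNat := by
  change _ = cond (Nat.beq (p.toNat / 2 % 2) 0) (p.toNat + 2) (p.toNat - 2)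
  rw [Pass.toNat_div_mod]
  obtain ⟨c, o, s⟩ := p
  cases o <;> cases s <;> simp [Pass.opp, Pass.toNat] <;> rfl

theorem turnLeft_fst_lt (w : Code) (x : ℕ × Bool) (hw : 0 < w.length) :
    (turnLeft w x).1 < w.length := by
  unfold turnLeft
  dsimp only
  split <;> exact Nat.mod_lt _ hw

theorem digit_turnNumber_aux (w v : Code) (hw : 0 < w.length) (hw' : w.length ≤ 128) (i : ℕ)
    (b : Bool) (hi : i < v.length) :
    digit (turnNumber w.length (w.map Pass.toNat) (v.map Pass.toNat)) (sideNat (i, b)) =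
      sideNat (let p := passAt v i
        let j := w.idxOf p.opp
        let f := (p.isOver == p.isPos) == b
        (if f then (j + 1) % w.length else (j + w.length - 1) % w.length, f)) := by
  induction v generalizing i with
  | nil => simp at hi
  | cons p v ih =>
    have hj : indexNat (oppNat p.toNat) (w.map Pass.toNat) = w.idxOf p.opp := by
      rw [indexNat_eq, ← Pass.toNat_opp, idxOf_map_of_injective Pass.toNat_injective]
    have h0 : turnNumber w.length (w.map Pass.toNat) ((p :: v).map Pass.toNat) =
        cond (Nat.beq (p.toNat / 2 % 2) (p.toNat % 2))
          (consDigits (2 * ((w.idxOf p.opp + w.length - 1) % w.length))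
            (2 * ((w.idxOf p.opp + 1) % w.length) + 1)
            (turnNumber w.length (w.map Pass.toNat) (v.map Pass.toNat)))
          (consDigits (2 * ((w.idxOf p.opp + 1) % w.length) + 1)
            (2 * ((w.idxOf p.opp + w.length - 1) % w.length))
            (turnNumber w.length (w.map Pass.toNat) (v.map Pass.toNat))) := by
      rw [← hj]; rfl
    rw [h0, Pass.toNat_div_mod, Pass.toNat_mod]
    have h1 := Nat.mod_lt (w.idxOf p.opp + w.length - 1) hw
    have h2 := Nat.mod_lt (w.idxOf p.opp + 1) hw
    obtain ⟨d1, d2, d3⟩ := digit_consDigits (2 * ((w.idxOf p.opp + w.length - 1) % w.length))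
      (2 * ((w.idxOf p.opp + 1) % w.length) + 1)
      (turnNumber w.length (w.map Pass.toNat) (v.map Pass.toNat)) (by omega) (by omega)
    obtain ⟨e1, e2, e3⟩ := digit_consDigits (2 * ((w.idxOf p.opp + 1) % w.length) + 1)
      (2 * ((w.idxOf p.opp + w.length - 1) % w.length))
      (turnNumber w.length (w.map Pass.toNat) (v.map Pass.toNat)) (by omega) (by omega)
    cases i with
    | zero =>
      obtain ⟨c, o, s⟩ := p
      cases o <;> cases s <;> cases b
      · exact d1
      · exact d2
      · exact e1
      · exact e2
      · exact e1
      · exact e2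
      · exact d1
      · exact d2
    | succ i =>
      rw [show sideNat (i + 1, b) = sideNat (i, b) + 2 by simp [sideNat]; ring]
      refine Eq.trans ?_ (ih i (by simpa using hi))
      cases Nat.beq p.isOver.toNat p.isPos.toNat
      · exact e3 _
      · exact d3 _

theorem digit_turnNumber (w : Code) (hw : w.length ≤ 128) (x : ℕ × Bool) (hx : x.1 < w.length) :
    digit (turnNumber w.length (w.map Pass.toNat) (w.map Pass.toNat)) (sideNat x) =
      sideNat (turnLeft w x) :=
  digit_turnNumber_aux w w (by omega) hw x.1 x.2 hx

theorem isLeast_iff (w : Code) (hw : 0 < w.length) (T : ℕ)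
    (hT : ∀ x : ℕ × Bool, x.1 < w.length → digit T (sideNat x) = sideNat (turnLeft w x))
    (x : ℕ × Bool) (k m : ℕ)
    (hm : ∀ j ≤ m, sideNat x ≤ sideNat ((turnLeft w)^[j] x)) :
    isLeast T (sideNat x) k (sideNat ((turnLeft w)^[m + 1] x)) = true ↔
      ∀ j ≤ m + k, sideNat x ≤ sideNat ((turnLeft w)^[j] x) := by
  induction k generalizing m with
  | zero => simpa [isLeast] using hm
  | succ k ih =>
    change cond (Nat.ble (sideNat ((turnLeft w)^[m + 1] x)) (sideNat x))
      (Nat.beq (sideNat ((turnLeft w)^[m + 1] x)) (sideNat x))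
      (isLeast T (sideNat x) k (digit T (sideNat ((turnLeft w)^[m + 1] x)))) = true ↔ _
    by_cases h1 : sideNat ((turnLeft w)^[m + 1] x) < sideNat x
    · rw [Nat.ble_eq_true_of_le h1.le, beq_eq_false h1.ne]
      simp only [cond_true, Bool.false_eq_true, false_iff, not_forall, not_le]
      exact ⟨m + 1, by omega, h1⟩
    have hm' : ∀ j ≤ m + 1, sideNat x ≤ sideNat ((turnLeft w)^[j] x) := by
      intro j hj
      rcases Nat.le_succ_iff.1 hj with h | h
      · exact hm j h
      · rw [h]; exact not_lt.1 h1
    by_cases h2 : sideNat ((turnLeft w)^[m + 1] x) = sideNat x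
    · rw [Nat.ble_eq_true_of_le h2.le, h2, Nat.beq_refl]
      refine ⟨fun _ j _ => ?_, fun _ => rfl⟩
      -- the orbit has closed up, so later points repeat earlier ones
      have hp : (turnLeft w)^[m + 1] x = x := sideNat_injective h2
      have : (turnLeft w)^[j] x = (turnLeft w)^[j % (m + 1)] x :=
        (Function.IsPeriodicPt.iterate_mod_apply (f := turnLeft w) hp j).symm
      rw [this]
      exact hm _ (Nat.lt_succ_iff.1 (Nat.mod_lt _ (Nat.succ_pos m)))
    · have hlt : ((turnLeft w)^[m + 1] x).1 < w.length := by
        rw [Function.iterate_succ_apply']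
        exact turnLeft_fst_lt w _ hw
      rw [show Nat.ble (sideNat ((turnLeft w)^[m + 1] x)) (sideNat x) = false by
        rw [← Bool.not_eq_true, Nat.ble_eq]; omega, cond_false, hT _ hlt,
        ← Function.iterate_succ_apply' (turnLeft w), ih (m + 1) hm',
        show m + 1 + k = m + (k + 1) by ring]

theorem map_sideNat_edgeSides (w : Code) :
    (edgeSides w).map sideNat = List.range (2 * w.length) := by
  rw [edgeSides]
  generalize w.length = n
  induction n with
  | zero => simp
  | succ n ih =>
    rw [List.range_succ, List.flatMap_append, List.map_append, ih,
      show 2 * (n + 1) = 2 * n + 1 + 1 by ring, List.range_succ, List.range_succ]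
    simp [sideNat]

theorem leastCount_eq (T L n : ℕ) :
    leastCount T L n = (List.range n).countP fun x => isLeast T x L (digit T x) := by
  induction n with
  | zero => rfl
  | succ n ih =>
    rw [List.range_succ, List.countP_append, ← ih]
    change cond (isLeast T n L (digit T n)) (leastCount T L n + 1) (leastCount T L n) = _
    cases h : isLeast T n L (digit T n) <;> simp [h]

theorem isKnotDiagram_of_fastPlanar {w : Code} (h : fastPlanar w = true) : IsKnotDiagram w := by
  have h : ((nodupHalves (natCodes w) = true ∧
      ((natCodes w).all fun n => memNat (oppNat n) (natCodes w)) = true) ∧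
      (natCodes w).length ≤ 128) ∧ ((natCodes w).length = 0 ∨
        leastCount (turnNumber (natCodes w).length (natCodes w) (natCodes w))
          (2 * (natCodes w).length - 1) (2 * (natCodes w).length) =
            (natCodes w).length / 2 + 2) := by
    revert h
    unfold fastPlanar
    dsimp only
    cases nodupHalves (natCodes w)
    · simp
    cases (natCodes w).all fun n => memNat (oppNat n) (natCodes w)
    · simp
    cases hL : Nat.ble (natCodes w).length 128
    · simp
    cases h0 : Nat.beq (natCodes w).length 0
    · intro h
      exact ⟨⟨⟨rfl, rfl⟩, Nat.le_of_ble_eq_true hL⟩, Or.inr (Nat.eq_of_beq_eq_true h)⟩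
    · intro h
      exact ⟨⟨⟨rfl, rfl⟩, Nat.le_of_ble_eq_true hL⟩, Or.inl (Nat.eq_of_beq_eq_true h0)⟩
  rw [natCodes_eq, List.length_map] at h
  obtain ⟨⟨⟨h1, h2⟩, h3⟩, h4⟩ := h
  have h1 := nodup_of_nodupHalves h1
  refine ⟨⟨?_, ?_⟩, ?_⟩
  · rw [List.map_map] at h1
    refine List.Nodup.of_map (fun y : ℕ × Bool => 2 * y.1 + y.2.toNat) ?_
    rw [List.map_map]
    convert h1 using 2
    funext p
    obtain ⟨c, o, s⟩ := p
    cases o <;> cases s <;> simp [Pass.toNat] <;> omega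
  · intro p hp
    rw [List.all_eq_true] at h2
    have := h2 p.toNat (List.mem_map_of_mem hp)
    rw [memNat_eq_true, ← Pass.toNat_opp, List.mem_map_of_injective Pass.toNat_injective]
      at this
    exact this
  · rcases h4 with h4 | h4
    · exact Or.inl (List.length_eq_zero_iff.1 h4)
    by_cases hw : w.length = 0
    · exact Or.inl (List.length_eq_zero_iff.1 hw)
    refine Or.inr ?_
    have hw : 0 < w.length := Nat.pos_of_ne_zero hw
    set T := turnNumber w.length (w.map Pass.toNat) (w.map Pass.toNat)
    have hT : ∀ x : ℕ × Bool, x.1 < w.length →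
        digit T (sideNat x) = sideNat (turnLeft w x) := digit_turnNumber w h3
    rw [crossingCount, ← h4, leastCount_eq, ← map_sideNat_edgeSides, List.countP_map, faceCount,
      ← List.countP_eq_length_filter]
    refine List.countP_congr fun x hx => ?_
    have hx1 : x.1 < w.length := by
      simp only [edgeSides, List.mem_flatMap, List.mem_range] at hx
      obtain ⟨i, hi, hx⟩ := hx
      simp at hx
      rcases hx with rfl | rfl <;> exact hi
    have := isLeast_iff w hw T hT x (2 * w.length - 1) 0 (by simp)
    simp only [Function.comp_apply]
    rw [hT x hx1]
    rw [Function.iterate_one] at this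
    rw [this, List.all_eq_true]
    constructor
    · intro h j hj
      have : (turnLeft w)^[j] x ∈ faceOf w x := by
        rw [faceOf, List.mem_iff_getElem]
        exact ⟨j, by rw [List.length_iterate]; omega, by simp⟩
      simpa [sideNat] using h _ this
    · intro h y hy
      rw [faceOf, List.mem_iff_getElem] at hy
      obtain ⟨j, hj, rfl⟩ := hy
      rw [List.length_iterate] at hj
      simpa [sideNat] using h j (by omega)

/-! ### Verified sequences of moves -/

/-- An instruction for changing a diagram.  The number `i` says by how many passages the base point is
moved before the change, so that the change takes place at the beginning of the code. -/
inductive Instr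
  /-- Change of base point. -/
  | rot (i : ℕ)
  /-- Reversal of the orientation. -/
  | rev
  /-- Mirror image. -/
  | mir
  /-- Removal of a curl. -/
  | r1 (i : ℕ)
  /-- Insertion of a curl. -/
  | curl (i : ℕ) (isOver isPos : Bool)
  /-- Removal of a bigon. -/
  | r2 (i : ℕ)
  /-- Third Reidemeister move; the numbers of passages between the top and the middle strand, and
  between the middle and the bottom strand, are `j` and `k`. -/
  | r3 (i j k : ℕ)

/-- Removal of the curl at the beginning of a code. -/
def removeCurl : Code → Option Code
  | p :: q :: w => if q = p.opp then some w else none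
  | _ => none

/-- Removal of a bigon one of whose edges is the first edge of the code. -/
def removeBigon : Code → Option Code
  | p :: q :: w =>
    let u := w.takeWhile fun r => !(r == p.opp || r == q.opp)
    match w.drop u.length with
    | x :: y :: v =>
      if q = ⟨q.crossing, p.isOver, !p.isPos⟩ ∧
          [x, y] = two (x == p.opp) p.opp q.opp ∧ w = u ++ (x :: y :: v) then
        some (u ++ v)
      else none
    | _ => none
  | _ => none

/-- The third Reidemeister move at a triangle whose top strand is at the beginning of the code. -/
def slide (j k : ℕ) (w : Code) : Option Code :=
  match w.take 2, (w.drop (2 + j)).take 2, (w.drop (4 + j + k)).take 2 with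
  | [p, q], [x, y], [z, _] =>
    let α := p.crossing == x.crossing || p.crossing == y.crossing
    let A := if α then p else q
    let B := if α then q else p
    let β := x.crossing == A.crossing
    let C := if β then y else x
    let γ := z.crossing == B.crossing
    let a := A.crossing
    let b := B.crossing
    let c := C.crossing
    let sa := A.isPos
    let sb := B.isPos
    let sc := C.isPos
    let u := (w.drop 2).take j
    let v := (w.drop (4 + j)).take k
    let t := w.drop (6 + j + k)
    if (sb = sc ↔ α = β) ∧ (sa = sc ↔ α = γ) ∧
        w = two α ⟨a, true, sa⟩ ⟨b, true, sb⟩ ++ u ++ two β ⟨a, false, sa⟩ ⟨c, true, sc⟩ ++ v ++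
          two γ ⟨b, false, sb⟩ ⟨c, false, sc⟩ ++ t then
      some (two (!α) ⟨a, true, sa⟩ ⟨b, true, sb⟩ ++ u ++
        two (!β) ⟨a, false, sa⟩ ⟨c, true, sc⟩ ++ v ++ two (!γ) ⟨b, false, sb⟩ ⟨c, false, sc⟩ ++ t)
    else none
  | _, _, _ => none

/-- The base point that the instruction asks for. -/
def Instr.offset : Instr → ℕ
  | rot i => i
  | rev => 0
  | mir => 0
  | r1 i => i
  | curl i _ _ => i
  | r2 i => i
  | r3 i _ _ => i

/-- The change that an instruction makes once the base point has been moved. -/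
def Instr.apply : Instr → Code → Option Code
  | rot _, w => some w
  | rev, w => some w.reverse
  | mir, w => some (w.map fun p => ⟨p.crossing, !p.isOver, !p.isPos⟩)
  | r1 _, w => removeCurl w
  | curl _ o s, w =>
    let p : Pass := ⟨(w.map Pass.crossing).foldr max 0 + 1, o, s⟩
    some ([p, p.opp] ++ w)
  | r2 _, w => removeBigon w
  | r3 _ j k, w => slide j k w

theorem knotType_eq_of_move {v w : Code} (hv : IsKnotDiagram v) (hw : IsKnotDiagram w)
    (h : Move v w) : knotType v = knotType w :=
  Quot.sound ⟨hv, hw, h⟩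

theorem move_of_removeCurl {w w' : Code} (h : removeCurl w = some w') : Move w' w := by
  unfold removeCurl at h
  split at h
  · rw [Option.ite_none_right_eq_some] at h
    obtain ⟨rfl, h⟩ := h
    cases h
    exact Move.r1 _ _
  · cases h

theorem move_of_removeBigon {w w' : Code} (h : removeBigon w = some w') : Move w' w := by
  unfold removeBigon at h
  split at h
  · rename_i p q w
    dsimp only at h
    generalize w.takeWhile _ = u at h
    split at h
    · rename_i x y v _
      rw [Option.ite_none_right_eq_some] at h
      obtain ⟨⟨hq, hxy, hw⟩, h⟩ := h
      cases h
      have := Move.r2 u v p.crossing q.crossing p.isOver p.isPos (x == p.opp)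
      have hq' : q.opp = ⟨q.crossing, !p.isOver, !p.isPos⟩ := by rw [hq]; rfl
      rw [hw, show p :: q :: (u ++ x :: y :: v) = [p, q] ++ u ++ [x, y] ++ v by simp, hxy, hq']
      rwa [← hq] at this
    · cases h
  · cases h

theorem move_of_slide {j k : ℕ} {w w' : Code} (h : slide j k w = some w') : Move w w' := by
  unfold slide at h
  split at h
  · dsimp only at h
    rw [Option.ite_none_right_eq_some] at h
    obtain ⟨⟨hb, ha, hw⟩, h⟩ := h
    rw [← Option.some.inj h]
    conv_lhs => rw [hw]
    exact Move.r3 _ _ _ _ _ _ _ _ _ _ _ _ hb ha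
  · cases h

theorem Instr.knotType_apply {i : Instr} {v w : Code} (hv : IsKnotDiagram v)
    (hw : IsKnotDiagram w) (h : i.apply v = some w) : knotType v = knotType w := by
  cases i with
  | rot => cases h; rfl
  | rev => cases h; exact knotType_eq_of_move hv hw (Move.reverse v)
  | mir => cases h; exact knotType_eq_of_move hv hw (Move.mirror v)
  | r1 => exact (knotType_eq_of_move hw hv (move_of_removeCurl h)).symm
  | curl => cases h; exact knotType_eq_of_move hv hw (Move.r1 _ _)
  | r2 => exact (knotType_eq_of_move hw hv (move_of_removeBigon h)).symm
  | r3 => exact knotType_eq_of_move hv hw (move_of_slide h)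

/-- The crossings renamed to `0, 1, 2, …`, in the order in which they are left for good. -/
def normalize (w : Code) : Code :=
  let l := (w.map Pass.crossing).dedup
  w.map fun p => ⟨l.idxOf p.crossing, p.isOver, p.isPos⟩

theorem move_normalize (w : Code) : Move w (normalize w) := by
  refine Move.relabel w (fun c => (w.map Pass.crossing).dedup.idxOf c) fun p hp q hq h => ?_
  exact (List.idxOf_inj (List.mem_dedup.2 (List.mem_map_of_mem hp))).1 h

/-- Whether the instructions lead from the diagram `w` to the diagram `v`, up to the names of the
crossings, through diagrams on the sphere. -/
def leadsTo (v : Code) : List Instr → Code → Bool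
  | [], w => fastPlanar w && (fastPlanar (normalize w) && decide (normalize w = normalize v))
  | i :: l, w => fastPlanar w &&
    match i.apply (w.rotate i.offset) with
    | some w' => fastPlanar (w.rotate i.offset) && leadsTo v l w'
    | none => false

theorem isKnotDiagram_of_leadsTo {v w : Code} {l : List Instr} (h : leadsTo v l w = true) :
    IsKnotDiagram w := by
  cases l <;> rw [leadsTo, Bool.and_eq_true] at h <;> exact isKnotDiagram_of_fastPlanar h.1

theorem knotType_rotate {w : Code} {n : ℕ} (hw : IsKnotDiagram w)
    (hw' : IsKnotDiagram (w.rotate n)) : knotType w = knotType (w.rotate n) := by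
  refine knotType_eq_of_move hw hw' ?_
  rw [List.rotate_eq_drop_append_take_mod]
  conv_lhs => rw [← List.take_append_drop (n % w.length) w]
  exact Move.rotate _ _

theorem knotType_of_leadsTo {v w : Code} {l : List Instr} (hv : IsKnotDiagram v)
    (h : leadsTo v l w = true) : knotType w = knotType v := by
  induction l generalizing w with
  | nil =>
    simp only [leadsTo, Bool.and_eq_true, decide_eq_true_eq] at h
    obtain ⟨h1, h2, h3⟩ := h
    have h1 := isKnotDiagram_of_fastPlanar h1
    have h2 := isKnotDiagram_of_fastPlanar h2
    rw [knotType_eq_of_move h1 h2 (move_normalize w), h3]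
    exact (knotType_eq_of_move hv (h3 ▸ h2) (move_normalize v)).symm
  | cons i l ih =>
    have hw := isKnotDiagram_of_leadsTo h
    rw [leadsTo] at h
    split at h
    · rename_i w' hw'
      simp only [Bool.and_eq_true] at h
      obtain ⟨_, h2, h3⟩ := h
      have h2 := isKnotDiagram_of_fastPlanar h2
      rw [knotType_rotate hw h2, Instr.knotType_apply h2 (isKnotDiagram_of_leadsTo h3) hw', ih h3]
    · simp at h

/-! ### The reductions of the diagrams of the tie knots -/

/-- For each entry of `tieTable`, instructions that lead from the diagram of the tie knot to the
diagram in the knot table. -/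
def tieReductions : List (List Instr) :=
  [[.r2 2, .r2 2, .r1 1, .r1 0],
   [.r2 3, .r2 2, .mir],
   [.r2 4, .r2 2, .rot 1],
   [.r2 4, .r3 1 2 4, .r1 11, .r2 4, .r2 1, .r1 0],
   [.r2 4, .r3 2 3 2, .r2 4, .r1 4, .r2 1, .r1 0],
   [.r2 5, .r2 2, .mir, .rot 2],
   [.r2 5, .r3 1 3 5, .r1 13, .r2 3, .r2 0, .r1 1, .r1 0],
   [.r2 5, .r3 1 3 4, .r2 4, .r1 5, .r2 3, .r1 1, .r1 0],
   [.r2 5, .r2 2, .mir, .rot 4],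
   [.r2 5, .r2 2, .mir],
   [.r2 6, .r2 2, .rot 3],
   [.r2 6, .r3 1 4 6, .r1 15, .r2 6, .r2 3, .r1 2, .r1 1, .r1 0],
   [.r2 6, .r2 2, .rev, .mir, .rot 3],
   [.r2 6, .r3 1 5 5, .r1 15, .r2 5, .r2 4, .r1 2, .r1 1, .r1 0],
   [.r2 6, .r2 2, .rev, .mir, .rot 3],
   [.r2 6, .r2 2, .curl 2 true true, .rev, .r3 13 5 3, .r3 8 3 5, .r1 13, .mir, .rot 7],
   [.r2 6, .r2 2, .rot 9],
   [.r2 6, .r3 1 3 7, .r2 4, .r1 7, .r2 3],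
   [.r2 6, .r3 1 2 8, .r2 5, .r1 6, .r2 3],
   [.r2 6, .r3 1 4 6, .r2 7, .r2 6, .r1 6, .rot 1],
   [.r2 6, .r3 2 5 4, .r2 6, .r2 4, .r1 0, .rot 1],
   [.r2 7, .r2 2, .mir, .rot 4],
   [.r2 7, .r2 2, .mir, .rot 6],
   [.r2 7, .r3 1 5 7, .r1 17, .r2 5, .r2 0, .r1 3, .r1 2, .r1 1, .r1 0],
   [.r2 7, .r2 2, .curl 2 true true, .rev, .r3 15 6 4, .rev, .r3 7 6 4, .r1 15, .rot 6],
   [.r2 7, .r3 1 5 6, .r2 6, .r1 7, .r2 5, .r1 3, .r1 2, .r1 1, .r1 0],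
   [.r2 7, .r2 2, .curl 4 true false, .rev, .r3 15 3 7, .r3 6 7 3, .r1 15, .mir, .rot 7],
   [.r2 7, .r2 2, .curl 3 false false, .r3 1 3 7, .r3 6 7 3, .r1 15, .mir, .rot 7],
   [.r2 7, .r2 2, .mir, .rot 2],
   [.r2 7, .r2 2, .curl 6 true false, .rev, .r3 15 5 5, .r3 8 5 5, .r1 15, .mir, .rot 5],
   [.r2 7, .r3 1 4 8, .r1 17, .r2 6, .r2 5, .r1 7, .mir],
   [.r2 7, .r3 1 5 7, .r1 17, .r2 5, .r2 0, .r1 3, .mir],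
   [.r2 7, .r3 1 5 7, .r1 17, .r2 5, .r2 6, .r1 7, .mir],
   [.r2 7, .r3 1 5 6, .r2 6, .r1 7, .r2 4, .mir, .rot 2],
   [.r2 7, .r3 1 5 6, .r2 6, .r1 7, .r2 5, .r1 3, .mir],
   [.r2 7, .r3 1 3 9, .r2 4, .r1 9, .r2 3, .mir, .rot 3],
   [.r2 7, .r3 1 5 7, .r2 6, .r1 7, .r2 4, .mir, .rot 2],
   [.r2 7, .r2 2, .curl 1 false false, .r3 1 5 5, .r3 8 5 5, .r1 15, .mir, .rot 5],
   [.r2 7, .r3 1 3 8, .r2 4, .r1 9, .r2 3, .mir, .rot 3],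
   [.r2 7, .r2 2, .mir, .rot 6],
   [.r2 7, .r2 2, .mir, .rot 6],
   [.r2 7, .r2 2, .mir],
   [.r2 8, .r2 2, .rot 5],
   [.r2 8, .r2 2, .rot 11],
   [.r2 8, .r2 2, .curl 6 true false, .rev, .r3 17 5 7, .r3 8 7 5, .r1 17, .mir, .rot 7],
   [.r2 8, .r3 1 6 8, .r1 19, .r2 8, .r2 5, .r1 4, .r1 3, .r1 2, .r1 1, .r1 0],
   [.r2 8, .r2 2, .curl 3 false false, .r3 1 4 8, .rev, .r3 11 4 8, .r1 17, .rev, .mir, .rot 8],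
   [.r2 8, .r2 2, .rot 3],
   [.r2 8, .r2 2, .curl 9 false false, .r3 1 8 4, .rev, .r3 7 6 1, .r3 7 1 4, .rev, .r3 16 6 6, .r1 17, .rot 2],
   [.r2 8, .r3 1 7 7, .r1 19, .r2 7, .r2 6, .r1 4, .r1 3, .r1 2, .r1 1, .r1 0],
   [.r2 8, .r2 2, .curl 3 false false, .r3 1 4 8, .rev, .r3 11 4 8, .r1 17, .rev, .mir, .rot 8],
   [.r2 8, .r2 2, .curl 4 true true, .rev, .r3 17 9 3, .r3 12 3 9, .r1 17, .rev, .rot 9],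
   [.r2 8, .r2 2, .curl 7 false true, .r3 1 6 6, .rev, .r3 9 6 6, .r1 17, .rot 6],
   [.r2 8, .r3 1 5 9, .r1 19, .r2 5, .r2 0, .r1 5, .rot 1],
   [.r2 8, .r3 1 4 10, .r1 19, .r2 6, .r2 7, .r1 9, .rot 1],
   [.r2 8, .r3 1 5 8, .r2 6, .r1 9, .r2 5, .r1 5, .rot 1],
   [.r2 8, .r3 1 5 9, .r1 19, .r2 5, .r2 0, .r1 5, .r1 7],
   [.r2 8, .r2 2, .curl 2 true true, .rev, .r3 17 7 5, .r3 10 5 7, .r1 17, .rev, .rot 7],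
   [.r2 8, .r3 1 5 9, .r1 19, .r2 5, .r2 8, .r1 9, .rot 1],
   [.r2 8, .r3 1 5 8, .r2 6, .r1 9, .r2 5, .r1 5, .r1 7],
   [.r2 8, .r3 1 5 9, .r2 6, .r1 9, .r2 5, .rot 8],
   [.r2 8, .r3 1 5 9, .r1 19, .rev, .r3 16 1 6, .r3 13 4 1, .rev, .r3 9 6 6, .r1 17, .rev, .mir, .rot 2],
   [.r2 8, .r3 1 4 10, .r2 7, .r1 8, .r2 5, .rot 8],
   [.r2 8, .r2 2, .curl 1 false false, .r3 1 6 6, .rev, .r3 9 6 6, .r1 17, .rev, .mir, .rot 6],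
   [.r2 8, .r2 2, .rev, .mir, .rot 3],
   [.r2 8, .r2 2, .curl 5 false true, .r3 1 8 4, .rev, .r3 7 8 4, .r1 17, .rot 8],
   [.r2 8, .r2 2, .curl 4 true false, .rev, .r3 17 3 9, .r3 6 9 3, .r1 17, .mir, .rot 9],
   [.r2 8, .r3 1 6 8, .r1 19, .r2 8, .r2 5, .r1 9, .r1 7],
   [.r2 8, .r2 2, .rot 11],
   [.r2 8, .r2 2, .curl 2 true true, .rev, .r3 17 7 5, .r3 10 5 7, .r1 17, .rev, .rot 7],
   [.r2 8, .r3 1 7 7, .r1 19, .r2 7, .r2 6, .r1 9, .r1 7],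
   [.r2 8, .r3 1 6 8, .r2 9, .r1 6, .r2 6, .rot 7],
   [.r2 8, .r2 2, .rev, .mir, .rot 5],
   [.r2 8, .r3 1 7 7, .r2 8, .r1 7, .r2 6, .rot 7],
   [.r2 8, .r2 2, .rev, .mir, .rot 5],
   [.r2 8, .r2 2, .curl 6 true false, .rev, .r3 17 5 7, .r3 8 7 5, .r1 17, .mir, .rot 7],
   [.r2 8, .r2 2, .rot 13],
   [.r2 8, .r3 1 4 10, .r2 7, .r1 8, .r2 4, .rot 1],
   [.r2 8, .r3 1 5 9, .r2 6, .r1 9, .r2 5],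
   [.r2 8, .r3 1 3 11, .r2 4, .r1 11, .r2 3, .rot 2],
   [.r2 8, .r3 1 5 9, .r2 6, .r1 9, .r2 4, .rot 1],
   [.r2 8, .r3 1 4 10, .r2 7, .r1 8, .r2 5],
   [.r2 8, .r3 1 2 12, .r2 5, .r1 10, .r2 3, .rot 2],
   [.r2 8, .r3 1 6 8, .r2 9, .r2 8, .r1 10, .rot 1],
   [.r2 8, .r3 2 7 6, .r2 8, .r2 6, .r1 0, .rot 1]]

set_option maxRecDepth 100000 in
/-- Each tie knot is led to its diagram in the knot table by Reidemeister moves. -/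
theorem leadsTo_tieReductions :
    ((tieTable.zip tieReductions).all fun x => leadsTo x.1.2.code x.2 (tieCode x.1.1)) = true := by
  decide +kernel

theorem isKnotDiagram_code (K : TableKnot) : IsKnotDiagram K.code := by
  apply isKnotDiagram_of_fastPlanar
  cases K <;> decide +kernel

theorem exists_leadsTo {x : List TieMove × TableKnot} (hx : x ∈ tieTable) :
    ∃ l, leadsTo x.2.code l (tieCode x.1) = true := by
  obtain ⟨i, hi, rfl⟩ := List.getElem_of_mem hx
  have hl : tieTable.length = tieReductions.length := rfl
  have := List.all_eq_true.1 leadsTo_tieReductions (tieTable[i], tieReductions[i]'(hl ▸ hi))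
    (by
      rw [← List.getElem_zip (h := by rw [List.length_zip, ← hl]; simpa using hi)]
      exact List.getElem_mem _)
  exact ⟨_, this⟩

theorem isKnotDiagram_tieCode {x : List TieMove × TableKnot} (hx : x ∈ tieTable) :
    IsKnotDiagram (tieCode x.1) :=
  (exists_leadsTo hx).elim fun _ h => isKnotDiagram_of_leadsTo h

theorem tieType_eq {x : List TieMove × TableKnot} (hx : x ∈ tieTable) :
    tieType x.1 = x.2.type :=
  (exists_leadsTo hx).elim fun _ h => knotType_of_leadsTo (isKnotDiagram_code _) h

theorem knotType_twistCode_two : knotType (twistCode 2) = TableKnot.k4_1.type :=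
  knotType_of_leadsTo (l := [.mir, .rot 3]) (isKnotDiagram_code _) (by decide +kernel)

theorem knotType_twistCode_three : knotType (twistCode 3) = TableKnot.k5_2.type :=
  knotType_of_leadsTo (l := [.rot 2]) (isKnotDiagram_code _) (by decide +kernel)

theorem knotType_twistCode_four : knotType (twistCode 4) = TableKnot.k6_1.type :=
  knotType_of_leadsTo (l := [.rev, .rot 5]) (isKnotDiagram_code _) (by decide +kernel)

theorem knotType_twistCode_five : knotType (twistCode 5) = TableKnot.k7_2.type :=
  knotType_of_leadsTo (l := [.rot 4]) (isKnotDiagram_code _) (by decide +kernel)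

theorem knotType_twistCode_six : knotType (twistCode 6) = TableKnot.k8_1.type :=
  knotType_of_leadsTo (l := [.rev, .rot 7]) (isKnotDiagram_code _) (by decide +kernel)

theorem knotType_torusCode_five : knotType (torusCode 5) = TableKnot.k5_1.type :=
  knotType_of_leadsTo (l := []) (isKnotDiagram_code _) (by decide +kernel)

theorem knotType_torusCode_seven : knotType (torusCode 7) = TableKnot.k7_1.type :=
  knotType_of_leadsTo (l := []) (isKnotDiagram_code _) (by decide +kernel)

open Matrix

/-! ### The tensor of a crossing -/

section Tensor

variable {R X : Type*} [CommRing R] [DecidableEq X]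

/-- Kronecker's delta. -/
def delta (R : Type*) [CommRing R] (x y : X) : R := if x = y then 1 else 0

theorem delta_comm (x y : X) : delta R x y = delta R y x := by simp [delta, eq_comm]

theorem ite_eq_delta_mul (x y : X) (c : R) : (if x = y then c else 0) = delta R x y * c := by
  simp [delta]

/-- The coefficient of a smoothing of a crossing of the given sign: of the smoothing that respects
the orientation if `k = true`, of the other one if `k = false`.  Kauffman's variable is
a square root of `s = t⁻¹`, and the powers of it that correct for the writhe are included. -/
def coeff (s t : R) (isPos k : Bool) : R :=
  if isPos then if k then -t else -t ^ 2 else if k then -s else -s ^ 2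

theorem coeff_not (s t : R) (isPos k : Bool) : coeff s t (!isPos) k = coeff t s isPos k := by
  cases isPos <;> rfl

/-- The sum of the two smoothings of a crossing, with their coefficients, as a tensor.  One strand
arrives on an edge with label `x` and leaves on an edge with label `y`, the other one arrives on
an edge with label `z` and leaves on an edge with label `w`. -/
def crossingTensor (s t : R) (isPos : Bool) (x y z w : X) : R :=
  coeff s t isPos true * (delta R x w * delta R y z) +
    coeff s t isPos false * (delta R x z * delta R y w)

variable [Fintype X]

/-- The tensor of three strands that form a triangle.  The strands lead from `x₁` to `y₁`, from `x₂`
to `y₂` and from `x₃` to `y₃`; the inner edges have labels `m₁`, `m₂`, `m₃`; and `α`, `β`, `γ` say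
in which order the strands meet their two crossings. -/
def triangle (s t : R) (sa sb sc α β γ : Bool) (x₁ y₁ x₂ y₂ x₃ y₃ : X) : R :=
  ∑ m₁, ∑ m₂, ∑ m₃,
    crossingTensor s t sa (if α then x₁ else m₁) (if α then m₁ else y₁)
      (if β then x₂ else m₂) (if β then m₂ else y₂) *
    crossingTensor s t sb (if α then m₁ else x₁) (if α then y₁ else m₁)
      (if γ then x₃ else m₃) (if γ then m₃ else y₃) *
    crossingTensor s t sc (if β then m₂ else x₂) (if β then y₂ else m₂)
      (if γ then m₃ else x₃) (if γ then y₃ else m₃)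

set_option linter.unusedSimpArgs false in
set_option maxHeartbeats 1000000 in
theorem triangle_flip_of_pos (s t : R) (h : s * t = 1) (hN : (Fintype.card X : R) = -(s + t))
    (β γ : Bool) (x₁ y₁ x₂ y₂ x₃ y₃ : X) :
    triangle s t γ β true true β γ x₁ y₁ x₂ y₂ x₃ y₃ =
      triangle s t γ β true false (!β) (!γ) x₁ y₁ x₂ y₂ x₃ y₃ := by
  cases β <;> cases γ <;>
  (simp only [crossingTensor, delta, coeff, triangle, mul_add, add_mul, Finset.sum_add_distrib]
   simp
   simp only [ite_eq_delta_mul, delta_comm y₁ x₁, delta_comm x₂ x₁, delta_comm x₂ y₁,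
     delta_comm y₂ x₁, delta_comm y₂ y₁, delta_comm y₂ x₂, delta_comm x₃ x₁, delta_comm x₃ y₁,
     delta_comm x₃ x₂, delta_comm x₃ y₂, delta_comm y₃ x₁, delta_comm y₃ y₁, delta_comm y₃ x₂,
     delta_comm y₃ y₂, delta_comm y₃ x₃, hN]
   clear hN
   grind)

omit [Fintype X] in
theorem crossingTensor_not (s t : R) (isPos : Bool) (x y z w : X) :
    crossingTensor s t (!isPos) x y z w = crossingTensor t s isPos x y z w := by
  simp only [crossingTensor, coeff_not]

theorem triangle_not (s t : R) (sa sb sc α β γ : Bool) (x₁ y₁ x₂ y₂ x₃ y₃ : X) :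
    triangle s t (!sa) (!sb) (!sc) α β γ x₁ y₁ x₂ y₂ x₃ y₃ =
      triangle t s sa sb sc α β γ x₁ y₁ x₂ y₂ x₃ y₃ := by
  simp only [triangle, crossingTensor_not]

/-- The third Reidemeister move for the tensors of crossings. -/
theorem triangle_flip {s t : R} (h : s * t = 1) (hN : (Fintype.card X : R) = -(s + t))
    {sa sb sc α β γ : Bool} (hb : sb = sc ↔ α = β) (ha : sa = sc ↔ α = γ) (x₁ y₁ x₂ y₂ x₃ y₃ : X) :
    triangle s t sa sb sc α β γ x₁ y₁ x₂ y₂ x₃ y₃ =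
      triangle s t sa sb sc (!α) (!β) (!γ) x₁ y₁ x₂ y₂ x₃ y₃ := by
  -- after an exchange of `s` and `t` all signs change, so that `c` may be assumed positive
  wlog hc : sc = true generalizing s t sa sb sc
  · have h' : t * s = 1 := by rw [mul_comm, h]
    have := this (sa := !sa) (sb := !sb) (sc := !sc) h' (by rw [hN, add_comm]) (by simpa using hb)
      (by simpa using ha) (by simpa using hc)
    rwa [triangle_not, triangle_not] at this
  subst hc
  wlog hα : α = true generalizing α β γ
  · have := this (α := !α) (β := !β) (γ := !γ) (by simpa using hb) (by simpa using ha)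
      (by simpa using hα)
    simpa only [Bool.not_not] using this.symm
  subst hα
  have hb : sb = β := by cases sb <;> cases β <;> simp_all
  have ha : sa = γ := by cases sa <;> cases γ <;> simp_all
  subst hb ha
  exact triangle_flip_of_pos s t h hN _ _ x₁ y₁ x₂ y₂ x₃ y₃

end Tensor

/-! ### Sums over the states of crossings -/

section StateSum

variable {R X : Type*} [CommRing R]

/-- A state of a crossing: which smoothing is chosen, and the labels of its two arcs. -/
abbrev CrossingState (X : Type*) := Bool × X × X

/-- The matrix of an over-passage or an under-passage through a crossing in state `a`: the entry with
indices `x`, `y` says whether a strand may arrive on an edge with label `x` and leave on an edge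
with label `y`. -/
def passMatrix (R : Type*) [CommRing R] [DecidableEq X] (isOver : Bool) (a : CrossingState X) : Matrix X X R :=
  if isOver || !a.1 then single a.2.1 a.2.2 1 else single a.2.2 a.2.1 1

variable [Fintype X]

/-- The sum over the states of the crossing `c = (label, sign)`, weighted with the coefficients of
the smoothings. -/
def avg (s t : R) (c : ℕ × Bool) (F : (ℕ → CrossingState X) → R) : (ℕ → CrossingState X) → R :=
  fun q => ∑ a : CrossingState X, coeff s t c.2 a.1 * F (Function.update q c.1 a)

/-- The weighted sum over the states of a list of crossings. -/
def stateSum (s t : R) (l : List (ℕ × Bool)) (F : (ℕ → CrossingState X) → R) :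
    (ℕ → CrossingState X) → R :=
  l.foldl (fun F c => avg s t c F) F

theorem stateSum_nil (s t : R) (F : (ℕ → CrossingState X) → R) : stateSum s t [] F = F := rfl

theorem stateSum_cons (s t : R) (c : ℕ × Bool) (l : List (ℕ × Bool))
    (F : (ℕ → CrossingState X) → R) : stateSum s t (c :: l) F = stateSum s t l (avg s t c F) := rfl

theorem stateSum_append (s t : R) (l m : List (ℕ × Bool)) (F : (ℕ → CrossingState X) → R) :
    stateSum s t (l ++ m) F = stateSum s t m (stateSum s t l F) := by
  simp [stateSum]

theorem avg_comm (s t : R) {c d : ℕ × Bool} (h : c.1 ≠ d.1) (F : (ℕ → CrossingState X) → R) :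
    avg s t c (avg s t d F) = avg s t d (avg s t c F) := by
  funext q
  simp only [avg, Finset.mul_sum]
  rw [Finset.sum_comm]
  refine Finset.sum_congr rfl fun a _ => Finset.sum_congr rfl fun b _ => ?_
  rw [Function.update_comm h, mul_left_comm]

theorem stateSum_perm (s t : R) {l m : List (ℕ × Bool)} (h : l.Perm m)
    (hl : (l.map Prod.fst).Nodup) (F : (ℕ → CrossingState X) → R) :
    stateSum s t l F = stateSum s t m F := by
  refine h.foldl_eq' (fun c hc d hd F => ?_) F
  by_cases hcd : c.1 = d.1
  · rw [List.inj_on_of_nodup_map hl hc hd hcd]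
  · exact avg_comm s t (Ne.symm hcd) F

theorem stateSum_linear (s t : R) (l : List (ℕ × Bool)) (F G : (ℕ → CrossingState X) → R)
    (a b : R) (q : ℕ → CrossingState X) :
    stateSum s t l (fun q => a * F q + b * G q) q =
      a * stateSum s t l F q + b * stateSum s t l G q := by
  induction l generalizing F G with
  | nil => rfl
  | cons c l ih =>
    simp only [stateSum_cons, ← ih]
    congr 1
    funext q
    simp only [avg, Finset.mul_sum, ← Finset.sum_add_distrib]
    exact Finset.sum_congr rfl fun _ _ => by ring

/-- Only values of `F` at functions that agree with `q` outside the list of crossings matter. -/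
theorem stateSum_congr (s t : R) (l : List (ℕ × Bool)) (F G : (ℕ → CrossingState X) → R)
    (q : ℕ → CrossingState X)
    (h : ∀ q', (∀ i, i ∉ l.map Prod.fst → q' i = q i) → F q' = G q') :
    stateSum s t l F q = stateSum s t l G q := by
  induction l generalizing F G with
  | nil => exact h q fun _ _ => rfl
  | cons c l ih =>
    refine ih _ _ fun q' hq' => Finset.sum_congr rfl fun a _ => ?_
    rw [h _ fun i hi => ?_]
    rw [List.map_cons, List.mem_cons, not_or] at hi
    rw [Function.update_of_ne hi.1, hq' i hi.2]

/-- Renaming of crossings: `F` depends only on crossings in `S`, where the renaming is injective. -/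
theorem stateSum_relabel (s t : R) (f : ℕ → ℕ) (S : Set ℕ) (hf : Set.InjOn f S)
    (l : List (ℕ × Bool)) (hl : ∀ c ∈ l, c.1 ∈ S) (F : (ℕ → CrossingState X) → R)
    (hF : ∀ q q', (∀ i ∈ S, q i = q' i) → F q = F q') (q : ℕ → CrossingState X) :
    stateSum s t (l.map fun c => (f c.1, c.2)) (fun q => F (q ∘ f)) q =
      stateSum s t l F (q ∘ f) := by
  induction l generalizing F with
  | nil => rfl
  | cons c l ih =>
    have hc : c.1 ∈ S := hl c (by simp)
    rw [List.map_cons, stateSum_cons, stateSum_cons, ← ih (fun d hd => hl d (by simp [hd]))]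
    · congr 1
      funext q
      refine Finset.sum_congr rfl fun a _ => congrArg _ (hF _ _ fun i hi => ?_)
      by_cases h : i = c.1
      · subst h; simp
      · rw [Function.comp_apply, Function.update_of_ne h,
          Function.update_of_ne fun h' => h (hf hi hc h')]
        rfl
    · intro q q' h
      refine Finset.sum_congr rfl fun a _ => congrArg _ (hF _ _ fun i hi => ?_)
      by_cases h' : i = c.1
      · subst h'; simp
      · rw [Function.update_of_ne h', Function.update_of_ne h', h i hi]

/-- The states may be permuted if the smoothings are kept. -/
theorem stateSum_comp_equiv (s t : R) (e : CrossingState X ≃ CrossingState X)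
    (he : ∀ a, (e a).1 = a.1) (l : List (ℕ × Bool)) (F : (ℕ → CrossingState X) → R)
    (q : ℕ → CrossingState X) :
    stateSum s t l (fun q => F (e ∘ q)) q = stateSum s t l F (e ∘ q) := by
  induction l generalizing F with
  | nil => rfl
  | cons c l ih =>
    rw [stateSum_cons, stateSum_cons, ← ih]
    congr 1
    funext q
    refine Fintype.sum_equiv e _ _ fun a => ?_
    rw [he, ← Function.comp_update]

theorem stateSum_not (s t : R) (l : List (ℕ × Bool)) (F : (ℕ → CrossingState X) → R) :
    stateSum s t (l.map fun c => (c.1, !c.2)) F = stateSum t s l F := by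
  induction l generalizing F with
  | nil => rfl
  | cons c l ih =>
    rw [List.map_cons, stateSum_cons, stateSum_cons, ← ih]
    congr 1
    funext q
    simp only [avg, coeff_not]

/-- If the summand depends only on the crossings of the list, the sum is constant. -/
theorem stateSum_const (s t : R) (l : List (ℕ × Bool)) (F : (ℕ → CrossingState X) → R)
    (S : Set ℕ) (hF : ∀ q q', (∀ i ∈ S, q i = q' i) → F q = F q')
    (hS : ∀ i ∈ S, i ∈ l.map Prod.fst) (q q' : ℕ → CrossingState X) :
    stateSum s t l F q = stateSum s t l F q' := by
  induction l generalizing F S with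
  | nil => exact hF _ _ fun i hi => by simpa using hS i hi
  | cons c l ih =>
    refine ih _ (S \ {c.1}) (fun q q' h => ?_) fun i hi => ?_
    · refine Finset.sum_congr rfl fun a _ => congrArg _ (hF _ _ fun i hi => ?_)
      by_cases h' : i = c.1
      · subst h'; simp
      · rw [Function.update_of_ne h', Function.update_of_ne h', h i ⟨hi, h'⟩]
    · exact (List.mem_cons.1 (hS i hi.1)).resolve_left hi.2

variable [DecidableEq X]

/-- The product of the matrices of the passages of a code. -/
def codeMatrix (R : Type*) [CommRing R] (q : ℕ → CrossingState X) (w : Code) : Matrix X X R :=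
  (w.map fun p => passMatrix R p.isOver (q p.crossing)).prod

theorem codeMatrix_nil (q : ℕ → CrossingState X) : codeMatrix R q [] = 1 := rfl

theorem codeMatrix_cons (q : ℕ → CrossingState X) (p : Pass) (w : Code) :
    codeMatrix R q (p :: w) = passMatrix R p.isOver (q p.crossing) * codeMatrix R q w := by
  simp [codeMatrix]

theorem codeMatrix_append (q : ℕ → CrossingState X) (u v : Code) :
    codeMatrix R q (u ++ v) = codeMatrix R q u * codeMatrix R q v := by
  simp [codeMatrix]

theorem codeMatrix_congr {q q' : ℕ → CrossingState X} {w : Code}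
    (h : ∀ p ∈ w, q p.crossing = q' p.crossing) : codeMatrix R q w = codeMatrix R q' w := by
  unfold codeMatrix
  congr 1
  exact List.map_congr_left fun p hp => by rw [h p hp]

end StateSum

/-! ### The local relations in a product of matrices -/

section Local

variable {R X : Type*} [CommRing R] [Fintype X] [DecidableEq X]

/-- The states of a crossing sum up to its tensor: this is why the two passages through a crossing,
which are far apart in the code, can be given independent matrices. -/
theorem sum_passMatrix (s t : R) (o sg : Bool) (x y z w : X) :
    ∑ a : CrossingState X, coeff s t sg a.1 * (passMatrix R o a x y * passMatrix R (!o) a z w) =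
      crossingTensor s t sg x y z w := by
  have hs : ∀ a b c d : X, (single a b (1 : R)) c d = delta R a c * delta R b d := by
    intro a b c d
    simp only [single_apply, delta, ite_and, mul_ite, mul_one, mul_zero]
    split_ifs <;> rfl
  cases o <;>
  simp only [Fintype.sum_prod_type, Fintype.sum_bool, passMatrix, crossingTensor, ← Finset.mul_sum,
    Bool.not_true, Bool.not_false, Bool.or_true, Bool.or_false, Bool.false_or, if_true, if_false,
    Bool.false_eq_true, hs] <;>
  simp [delta, eq_comm]

omit [DecidableEq X] in
theorem sum_trace_eq {ι : Type*} [Fintype ι] (c : ι → R) (A B C : ι → Matrix X X R)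
    (U V T : Matrix X X R) :
    ∑ i, c i * trace (A i * U * B i * V * C i * T) =
      ∑ x₁, ∑ y₃, ∑ x₃, ∑ y₂, ∑ x₂, ∑ y₁,
        (∑ i, c i * (A i x₁ y₁ * B i x₂ y₂ * C i x₃ y₃)) * (U y₁ x₂ * V y₂ x₃ * T y₃ x₁) := by
  simp only [trace, diag_apply, mul_apply, Finset.sum_mul, Finset.mul_sum]
  rw [Finset.sum_comm]
  refine Finset.sum_congr rfl fun x₁ _ => ?_
  rw [Finset.sum_comm]
  refine Finset.sum_congr rfl fun y₃ _ => ?_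
  rw [Finset.sum_comm]
  refine Finset.sum_congr rfl fun x₃ _ => ?_
  rw [Finset.sum_comm]
  refine Finset.sum_congr rfl fun y₂ _ => ?_
  rw [Finset.sum_comm]
  refine Finset.sum_congr rfl fun x₂ _ => ?_
  rw [Finset.sum_comm]
  refine Finset.sum_congr rfl fun y₁ _ => Finset.sum_congr rfl fun i _ => ?_
  ring

omit [DecidableEq X] in
/-- A sum of traces depends only on the tensor that the matrices at three places form. -/
theorem sum_trace_congr {ι κ : Type*} [Fintype ι] [Fintype κ] (c : ι → R) (A B C : ι → Matrix X X R)
    (c' : κ → R) (A' B' C' : κ → Matrix X X R)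
    (h : ∀ x₁ y₁ x₂ y₂ x₃ y₃, ∑ i, c i * (A i x₁ y₁ * B i x₂ y₂ * C i x₃ y₃) =
      ∑ i, c' i * (A' i x₁ y₁ * B' i x₂ y₂ * C' i x₃ y₃)) (U V T : Matrix X X R) :
    ∑ i, c i * trace (A i * U * B i * V * C i * T) =
      ∑ i, c' i * trace (A' i * U * B' i * V * C' i * T) := by
  rw [sum_trace_eq, sum_trace_eq]
  simp only [h]

/-- The product of two matrices in the given order, or in the other order. -/
def mulTwo (inOrder : Bool) (A B : Matrix X X R) : Matrix X X R := if inOrder then A * B else B * A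

omit [DecidableEq X] in
theorem mulTwo_apply (b : Bool) (A B : Matrix X X R) (x y : X) :
    mulTwo b A B x y = ∑ m, A (if b then x else m) (if b then m else y) *
      B (if b then m else x) (if b then y else m) := by
  cases b
  · simp [mulTwo, mul_apply, mul_comm]
  · simp [mulTwo, mul_apply]

theorem crossingTensor_curl {s t : R} (h : s * t = 1) (hN : (Fintype.card X : R) = -(s + t))
    (sg : Bool) (x y : X) : ∑ m, crossingTensor s t sg x m m y = delta R x y := by
  simp only [crossingTensor, Finset.sum_add_distrib, ← Finset.mul_sum]
  have hd : ∑ m, delta R x m * delta R m y = delta R x y := by simp [delta]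
  have h1 : ∑ m : X, delta R m m = (Fintype.card X : R) := by simp [delta]
  rw [hd, h1, hN]
  cases sg <;> simp only [coeff, if_true, if_false, Bool.false_eq_true]
  · linear_combination delta R x y * h
  · linear_combination delta R x y * h

set_option linter.unusedSimpArgs false in
theorem crossingTensor_bigon {s t : R} (h : s * t = 1) (hN : (Fintype.card X : R) = -(s + t))
    (sg b : Bool) (x y z w : X) :
    ∑ m, ∑ n, crossingTensor s t sg x m (if b then z else n) (if b then n else w) *
      crossingTensor s t (!sg) m y (if b then n else z) (if b then w else n) =
        delta R x y * delta R z w := by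
  cases sg <;> cases b <;>
  (simp only [crossingTensor, delta, coeff, mul_add, add_mul, Finset.sum_add_distrib]
   simp
   simp only [ite_eq_delta_mul, delta_comm y x, delta_comm z x, delta_comm w x, delta_comm z y,
     delta_comm w y, delta_comm w z, hN]
   clear hN
   grind)

/-- The first Reidemeister move for products of matrices. -/
theorem sum_trace_curl {s t : R} (h : s * t = 1) (hN : (Fintype.card X : R) = -(s + t))
    (o sg : Bool) (V : Matrix X X R) :
    ∑ a : CrossingState X, coeff s t sg a.1 *
      trace (passMatrix R o a * passMatrix R (!o) a * V) = trace V := by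
  have := sum_trace_congr (ι := CrossingState X) (κ := Unit) (fun a => coeff s t sg a.1)
    (fun a => passMatrix R o a * passMatrix R (!o) a) (fun _ => 1) (fun _ => 1)
    (fun _ => 1) (fun _ => 1) (fun _ => 1) (fun _ => 1) (fun x y x₂ y₂ x₃ y₃ => by
      simp only [← mul_assoc, ← Finset.sum_mul]
      congr 2
      simp only [mul_apply, Finset.mul_sum]
      rw [Finset.sum_comm]
      simp only [sum_passMatrix, crossingTensor_curl h hN, one_apply, delta]
      simp) V 1 1
  simpa [mul_assoc] using this

theorem sum_prod_two {α β M : Type*} [Fintype α] [Fintype β] [Fintype M]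
    (F : α → M → M → R) (G : β → M → M → R) :
    ∑ p : α × β, ∑ m, ∑ n, F p.1 m n * G p.2 m n = ∑ m, ∑ n, (∑ a, F a m n) * ∑ b, G b m n := by
  rw [Finset.sum_comm]
  refine Finset.sum_congr rfl fun m _ => ?_
  rw [Finset.sum_comm]
  refine Finset.sum_congr rfl fun n _ => ?_
  rw [Fintype.sum_prod_type, Finset.sum_mul_sum]

theorem sum_prod_three {α β γ M : Type*} [Fintype α] [Fintype β] [Fintype γ] [Fintype M]
    (F : α → M → M → R) (G : β → M → M → R) (H : γ → M → M → R) :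
    ∑ p : α × β × γ, ∑ m, ∑ n, ∑ k, F p.1 m n * G p.2.1 m k * H p.2.2 n k =
      ∑ m, ∑ n, ∑ k, (∑ a, F a m n) * (∑ b, G b m k) * ∑ c, H c n k := by
  rw [Finset.sum_comm]
  refine Finset.sum_congr rfl fun m _ => ?_
  rw [Finset.sum_comm]
  refine Finset.sum_congr rfl fun n _ => ?_
  rw [Finset.sum_comm]
  refine Finset.sum_congr rfl fun k _ => ?_
  simp only [Fintype.sum_prod_type (α₁ := α), Fintype.sum_prod_type (α₁ := β),
    ← Finset.mul_sum, ← Finset.sum_mul]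

/-- The second Reidemeister move for products of matrices. -/
theorem sum_trace_bigon {s t : R} (h : s * t = 1) (hN : (Fintype.card X : R) = -(s + t))
    (o sg b : Bool) (U V : Matrix X X R) :
    ∑ p : CrossingState X × CrossingState X, (coeff s t sg p.1.1 * coeff s t (!sg) p.2.1) *
      trace (passMatrix R o p.1 * passMatrix R o p.2 * U *
        mulTwo b (passMatrix R (!o) p.1) (passMatrix R (!o) p.2) * V) = trace (U * V) := by
  have := sum_trace_congr (ι := CrossingState X × CrossingState X) (κ := Unit)
    (fun p => coeff s t sg p.1.1 * coeff s t (!sg) p.2.1)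
    (fun p => passMatrix R o p.1 * passMatrix R o p.2)
    (fun p => mulTwo b (passMatrix R (!o) p.1) (passMatrix R (!o) p.2)) (fun _ => 1) (fun _ => 1)
    (fun _ => 1) (fun _ => 1) (fun _ => 1) (fun x y z w x₃ y₃ => by
      simp only [← mul_assoc _ _ ((1 : Matrix X X R) x₃ y₃), ← Finset.sum_mul]
      congr 1
      have hd := crossingTensor_bigon h hN sg b x y z w
      simp only [← sum_passMatrix s t o] at hd
      rw [← sum_prod_two (fun (p : CrossingState X) m n => coeff s t sg p.1 *
        (passMatrix R o p x m * passMatrix R (!o) p (if b then z else n) (if b then n else w)))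
        (fun (p : CrossingState X) m n => coeff s t (!sg) p.1 *
        (passMatrix R o p m y * passMatrix R (!o) p (if b then n else z) (if b then w else n)))]
        at hd
      have h1 : (∑ _ : Unit, (1 : R)) * ((1 : Matrix X X R) x y * (1 : Matrix X X R) z w) =
          delta R x y * delta R z w := by simp [one_apply, delta]
      refine Eq.trans ?_ (hd.trans h1.symm)
      refine Finset.sum_congr rfl fun p _ => ?_
      rw [mul_apply, mulTwo_apply, Finset.sum_mul_sum, Finset.mul_sum]
      refine Finset.sum_congr rfl fun m _ => ?_
      rw [Finset.mul_sum]
      exact Finset.sum_congr rfl fun n _ => by ring) U V 1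
  simpa [mul_assoc] using this

theorem sum_triangle (s t : R) (sa sb sc α β γ : Bool) (x₁ y₁ x₂ y₂ x₃ y₃ : X) :
    ∑ p : CrossingState X × CrossingState X × CrossingState X,
      (coeff s t sa p.1.1 * coeff s t sb p.2.1.1 * coeff s t sc p.2.2.1) *
        (mulTwo α (passMatrix R true p.1) (passMatrix R true p.2.1) x₁ y₁ *
          mulTwo β (passMatrix R false p.1) (passMatrix R true p.2.2) x₂ y₂ *
          mulTwo γ (passMatrix R false p.2.1) (passMatrix R false p.2.2) x₃ y₃) =
      triangle s t sa sb sc α β γ x₁ y₁ x₂ y₂ x₃ y₃ := by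
  simp only [triangle, ← sum_passMatrix s t true, Bool.not_true]
  rw [← sum_prod_three (fun (p : CrossingState X) m n => coeff s t sa p.1 *
      (passMatrix R true p (if α then x₁ else m) (if α then m else y₁) *
        passMatrix R false p (if β then x₂ else n) (if β then n else y₂)))
    (fun (p : CrossingState X) m k => coeff s t sb p.1 *
      (passMatrix R true p (if α then m else x₁) (if α then y₁ else m) *
        passMatrix R false p (if γ then x₃ else k) (if γ then k else y₃)))
    (fun (p : CrossingState X) n k => coeff s t sc p.1 *
      (passMatrix R true p (if β then n else x₂) (if β then y₂ else n) *
        passMatrix R false p (if γ then k else x₃) (if γ then y₃ else k)))]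
  refine Finset.sum_congr rfl fun p _ => ?_
  rw [mulTwo_apply, mulTwo_apply, mulTwo_apply, mul_assoc (Finset.sum _ _), Finset.sum_mul,
    Finset.mul_sum]
  refine Finset.sum_congr rfl fun m _ => ?_
  rw [Finset.sum_mul, Finset.mul_sum, Finset.mul_sum]
  refine Finset.sum_congr rfl fun n _ => ?_
  rw [Finset.mul_sum, Finset.mul_sum, Finset.mul_sum]
  exact Finset.sum_congr rfl fun k _ => by ring

/-- The third Reidemeister move for products of matrices. -/
theorem sum_trace_triangle {s t : R} (h : s * t = 1) (hN : (Fintype.card X : R) = -(s + t))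
    {sa sb sc α β γ : Bool} (hb : sb = sc ↔ α = β) (ha : sa = sc ↔ α = γ) (U V T : Matrix X X R) :
    ∑ p : CrossingState X × CrossingState X × CrossingState X,
      (coeff s t sa p.1.1 * coeff s t sb p.2.1.1 * coeff s t sc p.2.2.1) *
        trace (mulTwo α (passMatrix R true p.1) (passMatrix R true p.2.1) * U *
          mulTwo β (passMatrix R false p.1) (passMatrix R true p.2.2) * V *
          mulTwo γ (passMatrix R false p.2.1) (passMatrix R false p.2.2) * T) =
    ∑ p : CrossingState X × CrossingState X × CrossingState X,
      (coeff s t sa p.1.1 * coeff s t sb p.2.1.1 * coeff s t sc p.2.2.1) *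
        trace (mulTwo (!α) (passMatrix R true p.1) (passMatrix R true p.2.1) * U *
          mulTwo (!β) (passMatrix R false p.1) (passMatrix R true p.2.2) * V *
          mulTwo (!γ) (passMatrix R false p.2.1) (passMatrix R false p.2.2) * T) := by
  refine sum_trace_congr (fun p : CrossingState X × CrossingState X × CrossingState X =>
    coeff s t sa p.1.1 * coeff s t sb p.2.1.1 * coeff s t sc p.2.2.1) _ _ _
    (fun p : CrossingState X × CrossingState X × CrossingState X =>
    coeff s t sa p.1.1 * coeff s t sb p.2.1.1 * coeff s t sc p.2.2.1) _ _ _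
    (fun x₁ y₁ x₂ y₂ x₃ y₃ => ?_) U V T
  rw [sum_triangle, sum_triangle, triangle_flip h hN hb ha]

end Local

/-! ### The Jones polynomial as a sum over states -/

section Jones

variable {R X : Type*} [CommRing R] [Fintype X] [DecidableEq X]

/-- The crossings of a code with their signs, in the order of the over-passages. -/
def signs (w : Code) : List (ℕ × Bool) :=
  (w.filter Pass.isOver).map fun p => (p.crossing, p.isPos)

theorem signs_append (u v : Code) : signs (u ++ v) = signs u ++ signs v := by simp [signs]

theorem signs_cons (p : Pass) (w : Code) :
    signs (p :: w) = if p.isOver then (p.crossing, p.isPos) :: signs w else signs w := by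
  unfold signs
  cases h : p.isOver <;> simp [h]

theorem fst_mem_signs_iff {w : Code} {c : ℕ} :
    c ∈ (signs w).map Prod.fst ↔ ∃ p ∈ w, p.isOver = true ∧ p.crossing = c := by
  simp [signs, List.mem_map, and_assoc]

theorem exists_mem_of_mem_signs {w : Code} {c : ℕ} (h : c ∈ (signs w).map Prod.fst) :
    ∃ p ∈ w, p.crossing = c := by
  obtain ⟨p, hp, _, h⟩ := fst_mem_signs_iff.1 h
  exact ⟨p, hp, h⟩

theorem crossing_mem_signs {w : Code} (hw : IsGaussCode w) {p : Pass} (hp : p ∈ w) :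
    p.crossing ∈ (signs w).map Prod.fst := by
  rw [fst_mem_signs_iff]
  cases h : p.isOver
  · exact ⟨p.opp, hw.2 p hp, by simp [Pass.opp, h], rfl⟩
  · exact ⟨p, hp, h, rfl⟩

theorem nodup_signs {w : Code} (hw : IsGaussCode w) : ((signs w).map Prod.fst).Nodup := by
  have h : (((w.filter Pass.isOver)).map fun p => (p.crossing, p.isOver)).Nodup :=
    hw.1.sublist (List.filter_sublist.map _)
  rw [signs, List.map_map]
  refine (List.nodup_map_iff_inj_on (hw.1.of_map.filter _)).2 fun p hp p' hp' hpp' => ?_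
  refine List.inj_on_of_nodup_map h hp hp' ?_
  have h1 := (List.mem_filter.1 hp).2
  have h2 := (List.mem_filter.1 hp').2
  simp only [Function.comp_apply] at hpp'
  rw [hpp', h1, h2]

/-- The Jones polynomial of a diagram, multiplied with the number of labels, at the value `s` of its
variable to the power `- 1 / 2`.  If the number of labels is `-(s + s⁻¹)`, as it will always be
assumed, a sum over the labels of arcs counts a closed loop with the value that Kauffman's bracket
gives it. -/
def jones [Inhabited X] (s t : R) (w : Code) : R :=
  stateSum s t (signs w) (fun q : ℕ → CrossingState X => trace (codeMatrix R q w)) default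

theorem trace_codeMatrix_congr {w : Code} {q q' : ℕ → CrossingState X} {S : Set ℕ}
    (hS : ∀ p ∈ w, p.crossing ∈ S) (h : ∀ i ∈ S, q i = q' i) :
    trace (codeMatrix R q w) = trace (codeMatrix R q' w) := by
  rw [codeMatrix_congr fun p hp => h _ (hS p hp)]

theorem stateSum_codeMatrix_const (s t : R) {w : Code} (hw : IsGaussCode w)
    (q q' : ℕ → CrossingState X) :
    stateSum s t (signs w) (fun q => trace (codeMatrix R q w)) q =
      stateSum s t (signs w) (fun q => trace (codeMatrix R q w)) q' :=
  stateSum_const s t _ _ {i | ∃ p ∈ w, p.crossing = i}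
    (fun _ _ h => trace_codeMatrix_congr (S := {i | ∃ p ∈ w, p.crossing = i})
      (fun p hp => ⟨p, hp, rfl⟩) h)
    (by rintro _ ⟨p, hp, rfl⟩; exact crossing_mem_signs hw hp) q q'

variable [Inhabited X]

theorem jones_rotate (s t : R) (u v : Code) (h : IsGaussCode (u ++ v)) :
    jones (X := X) s t (v ++ u) = jones (X := X) s t (u ++ v) := by
  unfold jones
  simp only [codeMatrix_append, trace_mul_comm (codeMatrix R _ v)]
  have hp : (signs (u ++ v)).Perm (signs (v ++ u)) := by
    rw [signs_append, signs_append]; exact List.perm_append_comm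
  rw [stateSum_perm s t hp (nodup_signs h)]

/-- The exchange of the two indices of a state. -/
def swapState (X : Type*) : CrossingState X ≃ CrossingState X :=
  (Equiv.refl Bool).prodCongr (Equiv.prodComm X X)

omit [Fintype X] [Inhabited X] in
theorem passMatrix_swapState (o : Bool) (a : CrossingState X) :
    passMatrix R o (swapState X a) = (passMatrix R o a)ᵀ := by
  obtain ⟨k, i, j⟩ := a
  cases o <;> cases k <;> simp [passMatrix, swapState]

omit [Inhabited X] in
theorem codeMatrix_reverse (q : ℕ → CrossingState X) (w : Code) :
    codeMatrix R q w.reverse = (codeMatrix R (swapState X ∘ q) w)ᵀ := by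
  rw [codeMatrix, codeMatrix, Matrix.transpose_list_prod, List.map_map, List.map_reverse]
  congr 2
  refine List.map_congr_left fun p _ => ?_
  simp only [Function.comp_apply, passMatrix_swapState, transpose_transpose]

theorem jones_reverse (s t : R) (w : Code) (h : IsGaussCode w) :
    jones (X := X) s t w.reverse = jones (X := X) s t w := by
  have hp : (signs w).Perm (signs w.reverse) := by
    rw [signs, signs, List.filter_reverse, List.map_reverse]
    exact (List.reverse_perm _).symm
  unfold jones
  simp only [codeMatrix_reverse, trace_transpose]
  rw [← stateSum_perm s t hp (nodup_signs h),
    stateSum_comp_equiv s t (swapState X) (fun _ => rfl) _ fun q => trace (codeMatrix R q w)]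
  exact stateSum_codeMatrix_const s t h _ _

theorem jones_relabel (s t : R) (w : Code) (h : IsGaussCode w) (f : ℕ → ℕ)
    (hf : ∀ p ∈ w, ∀ q ∈ w, f p.crossing = f q.crossing → p.crossing = q.crossing) :
    jones (X := X) s t (w.map fun p => ⟨f p.crossing, p.isOver, p.isPos⟩) =
      jones (X := X) s t w := by
  have hm : ∀ q : ℕ → CrossingState X,
      codeMatrix R q (w.map fun p => ⟨f p.crossing, p.isOver, p.isPos⟩) =
        codeMatrix R (q ∘ f) w := by
    intro q
    rw [codeMatrix, codeMatrix, List.map_map]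
    rfl
  have hs : signs (w.map fun p => ⟨f p.crossing, p.isOver, p.isPos⟩) =
      (signs w).map fun c => (f c.1, c.2) := by
    rw [signs, signs, List.filter_map, List.map_map, List.map_map]
    rfl
  unfold jones
  simp only [hm, hs]
  rw [stateSum_relabel s t f {i | ∃ p ∈ w, p.crossing = i} _ _ _
    fun q => trace (codeMatrix R q w)]
  · exact stateSum_codeMatrix_const s t h _ _
  · exact fun _ _ h => trace_codeMatrix_congr (S := {i | ∃ p ∈ w, p.crossing = i})
      (fun p hp => ⟨p, hp, rfl⟩) h
  · rintro _ ⟨p, hp, rfl⟩ _ ⟨p', hp', rfl⟩ h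
    exact hf p hp p' hp' h
  · exact fun c hc => exists_mem_of_mem_signs (List.mem_map_of_mem hc)

/-- The exchange of the over-passage and the under-passage, for the states of a crossing. -/
def turnState (X : Type*) : CrossingState X ≃ CrossingState X where
  toFun a := (a.1, if a.1 then a.2.swap else a.2)
  invFun a := (a.1, if a.1 then a.2.swap else a.2)
  left_inv := by rintro ⟨k, i, j⟩; cases k <;> rfl
  right_inv := by rintro ⟨k, i, j⟩; cases k <;> rfl

omit [Fintype X] [Inhabited X] in
theorem passMatrix_turnState (o : Bool) (a : CrossingState X) :
    passMatrix R (!o) a = passMatrix R o (turnState X a) := by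
  obtain ⟨k, i, j⟩ := a
  cases o <;> cases k <;> simp [passMatrix, turnState]

/-- The mirror image has the value at the inverse variable. -/
theorem jones_mirror (s t : R) (w : Code) (h : IsGaussCode w)
    (h' : IsGaussCode (w.map fun p => ⟨p.crossing, !p.isOver, !p.isPos⟩)) :
    jones (X := X) s t (w.map fun p => ⟨p.crossing, !p.isOver, !p.isPos⟩) =
      jones (X := X) t s w := by
  have hm : ∀ q : ℕ → CrossingState X,
      codeMatrix R q (w.map fun p => ⟨p.crossing, !p.isOver, !p.isPos⟩) =
        codeMatrix R (turnState X ∘ q) w := by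
    intro q
    rw [codeMatrix, codeMatrix, List.map_map]
    congr 1
    exact List.map_congr_left fun p _ => passMatrix_turnState _ _
  have hn : (((signs w).map fun c => (c.1, !c.2)).map Prod.fst).Nodup := by
    rw [List.map_map]; exact nodup_signs h
  have hp : ((signs w).map fun c => (c.1, !c.2)).Perm
      (signs (w.map fun p => ⟨p.crossing, !p.isOver, !p.isPos⟩)) := by
    refine (List.perm_ext_iff_of_nodup hn.of_map (nodup_signs h').of_map).2 ?_
    rintro ⟨c, b⟩
    simp only [signs, List.mem_map, List.mem_filter, Prod.mk.injEq]
    constructor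
    · rintro ⟨_, ⟨p, ⟨hp, ho⟩, rfl⟩, rfl, rfl⟩
      exact ⟨_, ⟨⟨p.opp, h.2 p hp, rfl⟩, by simp [Pass.opp, ho]⟩, rfl, rfl⟩
    · rintro ⟨_, ⟨⟨p, hp, rfl⟩, ho⟩, rfl, rfl⟩
      exact ⟨_, ⟨p.opp, ⟨h.2 p hp, ho⟩, rfl⟩, rfl, rfl⟩
  unfold jones
  simp only [hm]
  rw [← stateSum_perm s t hp hn, stateSum_not,
    stateSum_comp_equiv t s (turnState X) (fun _ => rfl) _ fun q => trace (codeMatrix R q w)]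
  exact stateSum_codeMatrix_const t s h _ _

omit [Inhabited X] in
theorem codeMatrix_update_of_notMem (q : ℕ → CrossingState X) {w : Code} {c : ℕ}
    (h : ∀ p ∈ w, p.crossing ≠ c) (a : CrossingState X) :
    codeMatrix R (Function.update q c a) w = codeMatrix R q w :=
  codeMatrix_congr fun p hp => Function.update_of_ne (h p hp) _ _

/-- A crossing that is passed twice in one part of a code does not occur in the rest. -/
theorem IsGaussCode.crossing_ne {w l m : Code} (hw : IsGaussCode w) (h : w.Perm (l ++ m))
    {p r : Pass} (hp : p ∈ l) (hp' : p.opp ∈ l) (hr : r ∈ m) : r.crossing ≠ p.crossing := by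
  have hn := (h.map fun p => (p.crossing, p.isOver)).nodup_iff.1 hw.1
  rw [List.map_append, List.nodup_append] at hn
  intro hc
  have h1 := hn.2.2 _ (List.mem_map_of_mem hp) _ (List.mem_map_of_mem hr)
  have h2 := hn.2.2 _ (List.mem_map_of_mem hp') _ (List.mem_map_of_mem hr)
  simp only [Pass.opp, hc, ne_eq, Prod.mk.injEq, true_and] at h1 h2
  cases h3 : p.isOver <;> cases h4 : r.isOver <;> simp [h3, h4] at h1 h2

theorem jones_curl {s t : R} (h : s * t = 1) (hN : (Fintype.card X : R) = -(s + t)) (w : Code)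
    (p : Pass) (hw : IsGaussCode ([p, p.opp] ++ w)) :
    jones (X := X) s t ([p, p.opp] ++ w) = jones (X := X) s t w := by
  have hs : signs ([p, p.opp] ++ w) = (p.crossing, p.isPos) :: signs w := by
    obtain ⟨c, o, b⟩ := p
    cases o <;> simp [signs, Pass.opp]
  have hn : ∀ r ∈ w, r.crossing ≠ p.crossing := by
    exact fun r hr => hw.crossing_ne (List.Perm.refl _) (by simp) (by simp) hr
  unfold jones
  rw [hs, stateSum_cons]
  congr 1
  funext q
  refine Eq.trans ?_ (sum_trace_curl h hN p.isOver p.isPos (codeMatrix R q w))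
  refine Finset.sum_congr rfl fun a _ => ?_
  dsimp only
  rw [codeMatrix_append, codeMatrix_cons, codeMatrix_cons, codeMatrix_nil, mul_one,
    codeMatrix_update_of_notMem q hn]
  simp [Pass.opp]

omit [Inhabited X] in
theorem codeMatrix_two (q : ℕ → CrossingState X) (b : Bool) (p p' : Pass) :
    codeMatrix R q (two b p p') = mulTwo b (passMatrix R p.isOver (q p.crossing))
      (passMatrix R p'.isOver (q p'.crossing)) := by
  cases b <;> simp [two, mulTwo, codeMatrix]

theorem jones_bigon {s t : R} (h : s * t = 1) (hN : (Fintype.card X : R) = -(s + t)) (u v : Code)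
    (a b : ℕ) (o sg io : Bool)
    (hw : IsGaussCode ([⟨a, o, sg⟩, ⟨b, o, !sg⟩] ++ u ++
      two io ⟨a, !o, sg⟩ ⟨b, !o, !sg⟩ ++ v)) :
    jones (X := X) s t ([⟨a, o, sg⟩, ⟨b, o, !sg⟩] ++ u ++
      two io ⟨a, !o, sg⟩ ⟨b, !o, !sg⟩ ++ v) = jones (X := X) s t (u ++ v) := by
  have hs : (signs ([⟨a, o, sg⟩, ⟨b, o, !sg⟩] ++ u ++ two io ⟨a, !o, sg⟩ ⟨b, !o, !sg⟩ ++ v)).Perm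
      ([(b, !sg), (a, sg)] ++ signs (u ++ v)) := by
    rw [List.perm_iff_count]
    intro c
    cases o <;> cases io <;>
      simp [two, signs, List.count_append, List.count_cons] <;> ring
  have hl := (hs.map Prod.fst).nodup_iff.1 (nodup_signs hw)
  have hab : a ≠ b := by
    rintro rfl
    simp at hl
  have hwu : ∀ c, c = a ∨ c = b → ∀ r ∈ u ++ v, r.crossing ≠ c := by
    have hp : ([⟨a, o, sg⟩, ⟨b, o, !sg⟩] ++ u ++ two io ⟨a, !o, sg⟩ ⟨b, !o, !sg⟩ ++ v : Code).Perm
        ([⟨a, o, sg⟩, ⟨b, o, !sg⟩] ++ two io ⟨a, !o, sg⟩ ⟨b, !o, !sg⟩ ++ (u ++ v)) := by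
      rw [List.perm_iff_count]
      intro c
      simp only [List.count_append]
      ring
    rintro c (rfl | rfl) r hr
    · exact hw.crossing_ne hp (p := ⟨c, o, sg⟩) (by simp) (by cases io <;> simp [Pass.opp, two]) hr
    · exact hw.crossing_ne hp (p := ⟨c, o, !sg⟩) (by simp) (by cases io <;> simp [Pass.opp, two]) hr
  unfold jones
  rw [stateSum_perm s t hs (nodup_signs hw), stateSum_append]
  congr 1
  funext q
  rw [stateSum_cons, stateSum_cons, stateSum_nil]
  have := sum_trace_bigon h hN o sg io (codeMatrix R q u) (codeMatrix R q v)
  rw [codeMatrix_append, ← this, Fintype.sum_prod_type]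
  refine Finset.sum_congr rfl fun x _ => ?_
  simp only [avg, Finset.mul_sum]
  refine Finset.sum_congr rfl fun y _ => ?_
  have hu : codeMatrix R (Function.update (Function.update q a x) b y) u = codeMatrix R q u := by
    rw [codeMatrix_update_of_notMem _ fun r hr => hwu b (Or.inr rfl) r (by simp [hr]),
      codeMatrix_update_of_notMem _ fun r hr => hwu a (Or.inl rfl) r (by simp [hr])]
  have hv : codeMatrix R (Function.update (Function.update q a x) b y) v = codeMatrix R q v := by
    rw [codeMatrix_update_of_notMem _ fun r hr => hwu b (Or.inr rfl) r (by simp [hr]),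
      codeMatrix_update_of_notMem _ fun r hr => hwu a (Or.inl rfl) r (by simp [hr])]
  rw [codeMatrix_append, codeMatrix_append, codeMatrix_append, hu, hv, codeMatrix_two,
    codeMatrix_cons, codeMatrix_cons, codeMatrix_nil, mul_one]
  simp only [Function.update_self, Function.update_of_ne hab]
  rw [mul_assoc (coeff s t sg x.1)]

/-- A code with three strands that form a triangle, and parts `u`, `v`, `r` between them. -/
def triangleCode (u v r : Code) (a b c : ℕ) (sa sb sc α β γ : Bool) : Code :=
  two α ⟨a, true, sa⟩ ⟨b, true, sb⟩ ++ u ++ two β ⟨a, false, sa⟩ ⟨c, true, sc⟩ ++ v ++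
    two γ ⟨b, false, sb⟩ ⟨c, false, sc⟩ ++ r

theorem jones_triangleCode (s t : R) {u v r : Code} {a b c : ℕ} {sa sb sc α β γ : Bool}
    (hw : IsGaussCode (triangleCode u v r a b c sa sb sc α β γ)) :
    jones (X := X) s t (triangleCode u v r a b c sa sb sc α β γ) =
      stateSum s t (signs (u ++ v ++ r)) (fun q : ℕ → CrossingState X =>
        ∑ p : CrossingState X × CrossingState X × CrossingState X,
          (coeff s t sa p.1.1 * coeff s t sb p.2.1.1 * coeff s t sc p.2.2.1) *
            trace (mulTwo α (passMatrix R true p.1) (passMatrix R true p.2.1) * codeMatrix R q u *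
              mulTwo β (passMatrix R false p.1) (passMatrix R true p.2.2) * codeMatrix R q v *
              mulTwo γ (passMatrix R false p.2.1) (passMatrix R false p.2.2) *
                codeMatrix R q r)) default := by
  have hs : (signs (triangleCode u v r a b c sa sb sc α β γ)).Perm
      ([(c, sc), (b, sb), (a, sa)] ++ signs (u ++ v ++ r)) := by
    rw [List.perm_iff_count]
    intro d
    cases α <;> cases β <;> cases γ <;>
      simp [triangleCode, two, signs, List.count_append, List.count_cons] <;> ring
  have hl := (hs.map Prod.fst).nodup_iff.1 (nodup_signs hw)
  have hn : c ≠ b ∧ c ≠ a ∧ b ≠ a := by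
    refine ⟨?_, ?_, ?_⟩ <;> (rintro rfl; simp at hl)
  obtain ⟨hcb, hca, hba⟩ := hn
  have hp : (triangleCode u v r a b c sa sb sc α β γ).Perm
      (two α ⟨a, true, sa⟩ ⟨b, true, sb⟩ ++ two β ⟨a, false, sa⟩ ⟨c, true, sc⟩ ++
        two γ ⟨b, false, sb⟩ ⟨c, false, sc⟩ ++ (u ++ v ++ r)) := by
    rw [List.perm_iff_count]
    intro d
    simp only [triangleCode, List.count_append]
    ring
  have hmem : ∀ (b : Bool) (p p' x : Pass), x ∈ two b p p' ↔ x = p ∨ x = p' := by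
    intro b p p' x
    cases b <;> simp [two, or_comm]
  have ha : ∀ x ∈ u ++ v ++ r, x.crossing ≠ a := fun x hx =>
    hw.crossing_ne hp (p := ⟨a, true, sa⟩) (by simp [hmem]) (by simp [hmem, Pass.opp]) hx
  have hb : ∀ x ∈ u ++ v ++ r, x.crossing ≠ b := fun x hx =>
    hw.crossing_ne hp (p := ⟨b, true, sb⟩) (by simp [hmem]) (by simp [hmem, Pass.opp]) hx
  have hc : ∀ x ∈ u ++ v ++ r, x.crossing ≠ c := fun x hx =>
    hw.crossing_ne hp (p := ⟨c, true, sc⟩) (by simp [hmem]) (by simp [hmem, Pass.opp]) hx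
  unfold jones
  rw [stateSum_perm s t hs (nodup_signs hw), stateSum_append]
  congr 1
  funext q
  rw [stateSum_cons, stateSum_cons, stateSum_cons, stateSum_nil, Fintype.sum_prod_type]
  refine Finset.sum_congr rfl fun x _ => ?_
  rw [Fintype.sum_prod_type]
  simp only [avg, Finset.mul_sum]
  refine Finset.sum_congr rfl fun y _ => Finset.sum_congr rfl fun z _ => ?_
  have hm : ∀ w : Code, (∀ x ∈ w, x ∈ u ++ v ++ r) → codeMatrix R (Function.update
      (Function.update (Function.update q a x) b y) c z) w = codeMatrix R q w := by
    intro w hw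
    rw [codeMatrix_update_of_notMem _ fun p hp => hc p (hw p hp),
      codeMatrix_update_of_notMem _ fun p hp => hb p (hw p hp),
      codeMatrix_update_of_notMem _ fun p hp => ha p (hw p hp)]
  rw [triangleCode, codeMatrix_append, codeMatrix_append, codeMatrix_append, codeMatrix_append,
    codeMatrix_append, hm u fun x hx => by simp [hx], hm v fun x hx => by simp [hx],
    hm r fun x hx => by simp [hx], codeMatrix_two, codeMatrix_two, codeMatrix_two]
  simp only [Function.update_self, Function.update_of_ne hcb.symm, Function.update_of_ne hca.symm,
    Function.update_of_ne hba.symm]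
  ring

/-- The invariant of knot types: a symmetric function of the values at a variable and at its
inverse, since these are exchanged when a diagram is reflected. -/
def jonesPair (X : Type*) [Fintype X] [DecidableEq X] [Inhabited X] (s t : R) (w : Code) : R :=
  (1 + jones (X := X) s t w) * (1 + jones (X := X) t s w)

theorem jonesPair_eq_of_step {s t : R} (h : s * t = 1) (hN : (Fintype.card X : R) = -(s + t))
    {v w : Code} (hs : Step v w) : jonesPair X s t v = jonesPair X s t w := by
  obtain ⟨⟨hv, _⟩, ⟨hw, _⟩, hm⟩ := hs
  have h' : t * s = 1 := by rw [mul_comm, h]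
  have hN' : (Fintype.card X : R) = -(t + s) := by rw [hN, add_comm]
  unfold jonesPair
  cases hm with
  | rotate u v => rw [jones_rotate s t u v hv, jones_rotate t s u v hv]
  | reverse => rw [jones_reverse s t v hv, jones_reverse t s v hv]
  | relabel _ f hf => rw [jones_relabel s t v hv f hf, jones_relabel t s v hv f hf]
  | mirror => rw [jones_mirror s t v hv hw, jones_mirror t s v hv hw, mul_comm]
  | r1 _ p => rw [jones_curl h hN v p hw, jones_curl h' hN' v p hw]
  | r2 u v a b o sg io =>
    rw [jones_bigon h hN u v a b o sg io hw, jones_bigon h' hN' u v a b o sg io hw]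
  | r3 u v r a b c sa sb sc α β γ hb ha =>
    change IsGaussCode (triangleCode u v r a b c sa sb sc α β γ) at hv
    change IsGaussCode (triangleCode u v r a b c sa sb sc (!α) (!β) (!γ)) at hw
    change (1 + jones s t (triangleCode u v r a b c sa sb sc α β γ)) *
        (1 + jones t s (triangleCode u v r a b c sa sb sc α β γ)) =
      (1 + jones s t (triangleCode u v r a b c sa sb sc (!α) (!β) (!γ))) *
        (1 + jones t s (triangleCode u v r a b c sa sb sc (!α) (!β) (!γ)))
    rw [jones_triangleCode s t hv, jones_triangleCode t s hv, jones_triangleCode s t hw,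
      jones_triangleCode t s hw]
    simp only [sum_trace_triangle h hN hb ha, sum_trace_triangle h' hN' hb ha]

/-- The invariant depends only on the knot type. -/
theorem jonesPair_eq_of_knotType_eq {s t : R} (h : s * t = 1)
    (hN : (Fintype.card X : R) = -(s + t)) {v w : Code} (hvw : knotType v = knotType w) :
    jonesPair X s t v = jonesPair X s t w :=
  congrArg (Quot.lift (jonesPair X s t) fun _ _ hs => jonesPair_eq_of_step h hN hs) hvw

end Jones

/-! ### Evaluation of a state sum by smoothing the crossings -/

section Words

variable {R X : Type*} [CommRing R] [Fintype X] [DecidableEq X]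

/-- A sequence of passages through crossings, each marked `false` if it is run through in the
direction of the orientation and `true` if it is run through against it. -/
abbrev Word := List (Pass × Bool)

/-- The word that is run through in the opposite direction. -/
def Word.rev (w : Word) : Word := (w.map fun x => (x.1, !x.2)).reverse

/-- The word of a code. -/
def Word.ofCode (w : Code) : Word := w.map fun p => (p, false)

/-- The matrix of a marked passage. -/
def letterMatrix (R : Type*) [CommRing R] (q : ℕ → CrossingState X) (x : Pass × Bool) :
    Matrix X X R :=
  if x.2 then (passMatrix R x.1.isOver (q x.1.crossing))ᵀ
  else passMatrix R x.1.isOver (q x.1.crossing)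

/-- The product of the matrices of the passages of a word. -/
def wordMatrix (R : Type*) [CommRing R] (q : ℕ → CrossingState X) (w : Word) : Matrix X X R :=
  (w.map (letterMatrix R q)).prod

/-- The product of the traces of some words. -/
def traceProd (R : Type*) [CommRing R] (ws : List Word) (q : ℕ → CrossingState X) : R :=
  (ws.map fun w => trace (wordMatrix R q w)).prod

theorem wordMatrix_nil (q : ℕ → CrossingState X) : wordMatrix R q [] = 1 := rfl

theorem wordMatrix_cons (q : ℕ → CrossingState X) (x : Pass × Bool) (w : Word) :
    wordMatrix R q (x :: w) = letterMatrix R q x * wordMatrix R q w := by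
  simp [wordMatrix]

theorem wordMatrix_append (q : ℕ → CrossingState X) (u v : Word) :
    wordMatrix R q (u ++ v) = wordMatrix R q u * wordMatrix R q v := by
  simp [wordMatrix]

theorem wordMatrix_rev (q : ℕ → CrossingState X) (w : Word) :
    wordMatrix R q w.rev = (wordMatrix R q w)ᵀ := by
  have h : ∀ x : Pass × Bool, letterMatrix R q (x.1, !x.2) = (letterMatrix R q x)ᵀ := by
    rintro ⟨p, b⟩; cases b <;> simp [letterMatrix]
  induction w with
  | nil => simp [Word.rev, wordMatrix]
  | cons x w ih =>
    have : Word.rev (x :: w) = Word.rev w ++ [(x.1, !x.2)] := by simp [Word.rev]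
    rw [this, wordMatrix_append, ih, wordMatrix_cons, wordMatrix_nil, Matrix.mul_one, h,
      wordMatrix_cons, transpose_mul]

theorem wordMatrix_ofCode (q : ℕ → CrossingState X) (w : Code) :
    wordMatrix R q (Word.ofCode w) = codeMatrix R q w := by
  simp [wordMatrix, Word.ofCode, codeMatrix, letterMatrix, Function.comp_def]

theorem traceProd_cons (w : Word) (ws : List Word) (q : ℕ → CrossingState X) :
    traceProd R (w :: ws) q = trace (wordMatrix R q w) * traceProd R ws q := by
  simp [traceProd]

theorem wordMatrix_update (q : ℕ → CrossingState X) {w : Word} {c : ℕ}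
    (h : ∀ x ∈ w, x.1.crossing ≠ c) (a : CrossingState X) :
    wordMatrix R (Function.update q c a) w = wordMatrix R q w := by
  unfold wordMatrix
  congr 1
  refine List.map_congr_left fun x hx => ?_
  simp only [letterMatrix, Function.update_of_ne (h x hx)]

theorem traceProd_update (q : ℕ → CrossingState X) {ws : List Word} {c : ℕ}
    (h : ∀ w ∈ ws, ∀ x ∈ w, x.1.crossing ≠ c) (a : CrossingState X) :
    traceProd R ws (Function.update q c a) = traceProd R ws q := by
  unfold traceProd
  congr 1
  exact List.map_congr_left fun w hw => by rw [wordMatrix_update q (h w hw)]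

/-- The two passages of a crossing in a sum over its states.  Whether the smoothing joins the two
passages crosswise or in parallel depends on the directions in which they are run through. -/
theorem sum_letterMatrix (s t : R) (sg : Bool) (q : ℕ → CrossingState X) {l m : Pass × Bool}
    (hc : m.1.crossing = l.1.crossing) (ho : m.1.isOver = !l.1.isOver) (x y z w : X) :
    ∑ a : CrossingState X, coeff s t sg a.1 *
        (letterMatrix R (Function.update q l.1.crossing a) l x y *
          letterMatrix R (Function.update q l.1.crossing a) m z w) =
      coeff s t sg (l.2 == m.2) * (delta R x w * delta R y z) +
        coeff s t sg (l.2 != m.2) * (delta R x z * delta R y w) := by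
  obtain ⟨p, f⟩ := l
  obtain ⟨p', f'⟩ := m
  simp only at hc ho
  simp only [letterMatrix, hc, ho, Function.update_self]
  have h := sum_passMatrix (X := X) s t p.isOver sg
  simp only [crossingTensor] at h
  cases f <;> cases f' <;>
    simp only [if_true, if_false, Bool.false_eq_true, transpose_apply, h, BEq.rfl, bne_self_eq_false,
      show (false == true) = false from rfl, show (true == false) = false from rfl,
      show (false != true) = true from rfl, show (true != false) = true from rfl] <;> ring

theorem sum_trace_mul (s t : R) (sg : Bool) (q : ℕ → CrossingState X) {l m : Pass × Bool}
    (hc : m.1.crossing = l.1.crossing) (ho : m.1.isOver = !l.1.isOver) (U V : Matrix X X R) :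
    ∑ a : CrossingState X, coeff s t sg a.1 *
        trace (letterMatrix R (Function.update q l.1.crossing a) l * U *
          letterMatrix R (Function.update q l.1.crossing a) m * V) =
      coeff s t sg (l.2 == m.2) * (trace U * trace V) +
        coeff s t sg (l.2 != m.2) * trace (U * Vᵀ) := by
  have h : ∀ A B : Matrix X X R, trace (A * U * B * V) =
      ∑ x, ∑ w, ∑ z, ∑ y, (A x y * B z w) * (U y z * V w x) := by
    intro A B
    simp only [trace, diag_apply, mul_apply, Finset.sum_mul]
    refine Finset.sum_congr rfl fun x _ => Finset.sum_congr rfl fun w _ =>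
      Finset.sum_congr rfl fun z _ => Finset.sum_congr rfl fun y _ => by ring
  simp only [h, Finset.mul_sum]
  rw [Finset.sum_comm]
  simp_rw [Finset.sum_comm (γ := CrossingState X), ← mul_assoc _ (_ * _) (_ * _), ← Finset.sum_mul,
    sum_letterMatrix s t sg q hc ho, add_mul, Finset.sum_add_distrib]
  congr 1
  · simp [delta, trace, Finset.sum_mul, Finset.mul_sum]
  · simp [delta, trace, mul_apply, Finset.mul_sum]
    rw [Finset.sum_comm]

theorem sum_trace_mul_trace (s t : R) (sg : Bool) (q : ℕ → CrossingState X) {l m : Pass × Bool}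
    (hc : m.1.crossing = l.1.crossing) (ho : m.1.isOver = !l.1.isOver) (U V : Matrix X X R) :
    ∑ a : CrossingState X, coeff s t sg a.1 *
        (trace (letterMatrix R (Function.update q l.1.crossing a) l * U) *
          trace (letterMatrix R (Function.update q l.1.crossing a) m * V)) =
      coeff s t sg (l.2 == m.2) * trace (U * V) +
        coeff s t sg (l.2 != m.2) * trace (U * Vᵀ) := by
  have h : ∀ A B : Matrix X X R, trace (A * U) * trace (B * V) =
      ∑ z, ∑ w, ∑ x, ∑ y, (A x y * B z w) * (U y x * V w z) := by
    intro A B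
    simp only [trace, diag_apply, mul_apply, Finset.sum_mul, Finset.mul_sum]
    refine Finset.sum_congr rfl fun z _ => Finset.sum_congr rfl fun w _ =>
      Finset.sum_congr rfl fun x _ => Finset.sum_congr rfl fun y _ => by ring
  simp only [h, Finset.mul_sum]
  rw [Finset.sum_comm]
  simp_rw [Finset.sum_comm (γ := CrossingState X), ← mul_assoc _ (_ * _) (_ * _), ← Finset.sum_mul,
    sum_letterMatrix s t sg q hc ho, add_mul, Finset.sum_add_distrib]
  congr 1
  · simp [delta, trace, mul_apply, Finset.mul_sum]
  · simp [delta, trace, mul_apply, Finset.mul_sum]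
    rw [Finset.sum_comm]

/-- Smoothing of a crossing whose two passages lie on the same curve. -/
theorem avg_trace (s t : R) (sg : Bool) (q : ℕ → CrossingState X) {l m : Pass × Bool}
    (hc : m.1.crossing = l.1.crossing) (ho : m.1.isOver = !l.1.isOver) {u v : Word}
    (hu : ∀ x ∈ u, x.1.crossing ≠ l.1.crossing) (hv : ∀ x ∈ v, x.1.crossing ≠ l.1.crossing) :
    avg s t (l.1.crossing, sg) (fun q => trace (wordMatrix R q (l :: (u ++ m :: v)))) q =
      coeff s t sg (l.2 == m.2) * (trace (wordMatrix R q u) * trace (wordMatrix R q v)) +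
        coeff s t sg (l.2 != m.2) * trace (wordMatrix R q (u ++ v.rev)) := by
  rw [wordMatrix_append, wordMatrix_rev, ← sum_trace_mul s t sg q hc ho]
  refine Finset.sum_congr rfl fun a _ => ?_
  dsimp only
  rw [wordMatrix_cons, wordMatrix_append, wordMatrix_cons, wordMatrix_update q hu,
    wordMatrix_update q hv]
  simp only [Matrix.mul_assoc]

/-- Smoothing of a crossing whose two passages lie on different curves. -/
theorem avg_trace_mul_trace (s t : R) (sg : Bool) (q : ℕ → CrossingState X) {l m : Pass × Bool}
    (hc : m.1.crossing = l.1.crossing) (ho : m.1.isOver = !l.1.isOver) {u v : Word}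
    (hu : ∀ x ∈ u, x.1.crossing ≠ l.1.crossing) (hv : ∀ x ∈ v, x.1.crossing ≠ l.1.crossing) :
    avg s t (l.1.crossing, sg)
        (fun q => trace (wordMatrix R q (l :: u)) * trace (wordMatrix R q (m :: v))) q =
      coeff s t sg (l.2 == m.2) * trace (wordMatrix R q (u ++ v)) +
        coeff s t sg (l.2 != m.2) * trace (wordMatrix R q (u ++ v.rev)) := by
  rw [wordMatrix_append, wordMatrix_append, wordMatrix_rev, ← sum_trace_mul_trace s t sg q hc ho]
  refine Finset.sum_congr rfl fun a _ => ?_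
  dsimp only
  rw [wordMatrix_cons, wordMatrix_cons, wordMatrix_update q hu, wordMatrix_update q hv]

/-- The first passage through the crossing `c` in a word, with the parts before and after it. -/
def Word.cut (c : ℕ) : Word → Option (Word × (Pass × Bool) × Word)
  | [] => none
  | x :: w => bif x.1.crossing.beq c then some ([], x, w)
    else match Word.cut c w with
      | none => none
      | some (u, y, v) => some (x :: u, y, v)

theorem Word.of_cut {c : ℕ} {w u v : Word} {y : Pass × Bool} (h : w.cut c = some (u, y, v)) :
    w = u ++ y :: v ∧ y.1.crossing = c := by
  induction w generalizing u with
  | nil => simp [cut] at h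
  | cons x w ih =>
    rw [cut] at h
    cases hx : x.1.crossing.beq c with
    | true =>
      simp only [hx, cond_true, Option.some.injEq, Prod.mk.injEq] at h
      obtain ⟨rfl, rfl, rfl⟩ := h
      exact ⟨rfl, Nat.eq_of_beq_eq_true hx⟩
    | false =>
      rw [hx, cond_false] at h
      split at h
      · simp at h
      · rename_i u' y' v' hcut
        simp only [Option.some.injEq, Prod.mk.injEq] at h
        obtain ⟨rfl, rfl, rfl⟩ := h
        obtain ⟨h1, h2⟩ := ih hcut
        exact ⟨by rw [h1, List.cons_append], h2⟩

/-- The first passage through the crossing `c` in some cyclic words, with the rest of its word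
and with the other words. -/
def Word.pull (c : ℕ) : List Word → Option ((Pass × Bool) × Word × List Word)
  | [] => none
  | w :: ws => match w.cut c with
    | some (u, x, v) => some (x, v ++ u, ws)
    | none => match Word.pull c ws with
      | none => none
      | some (x, u, vs) => some (x, u, w :: vs)

theorem Word.of_pull {c : ℕ} {ws vs : List Word} {u : Word} {x : Pass × Bool}
    (h : Word.pull c ws = some (x, u, vs)) :
    x.1.crossing = c ∧ ∀ q : ℕ → CrossingState X, traceProd R ws q = traceProd R ((x :: u) :: vs) q := by
  induction ws generalizing vs with
  | nil => simp [pull] at h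
  | cons w ws ih =>
    rw [pull] at h
    split at h
    · rename_i u' y v' hcut
      simp only [Option.some.injEq, Prod.mk.injEq] at h
      obtain ⟨rfl, rfl, rfl⟩ := h
      obtain ⟨rfl, h2⟩ := Word.of_cut hcut
      refine ⟨h2, fun q => ?_⟩
      rw [traceProd_cons, traceProd_cons, ← List.cons_append, wordMatrix_append, trace_mul_comm,
        ← wordMatrix_append]
    · split at h
      · simp at h
      · rename_i u' y v' hpull
        simp only [Option.some.injEq, Prod.mk.injEq] at h
        obtain ⟨rfl, rfl, rfl⟩ := h
        obtain ⟨h1, h2⟩ := ih hpull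
        refine ⟨h1, fun q => ?_⟩
        rw [traceProd_cons, h2, traceProd_cons, traceProd_cons, traceProd_cons, mul_left_comm]

/-- Whether the crossing `c` does not occur in some words. -/
def Word.free (c : ℕ) (ws : List Word) : Bool := ws.all fun w => w.all fun x => !x.1.crossing.beq c

theorem Word.of_free {c : ℕ} {ws : List Word} (h : Word.free c ws = true) :
    ∀ w ∈ ws, ∀ x ∈ w, x.1.crossing ≠ c := by
  intro w hw x hx hc
  have := List.all_eq_true.1 (List.all_eq_true.1 h w hw) x hx
  simp [hc] at this

/-- The two ways of smoothing the crossing `c` in some cyclic words: with coefficient `coeff true`, and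
with coefficient `coeff false`. -/
def Word.smooth (c : ℕ) (ws : List Word) : Option (List Word × List Word) :=
  match Word.pull c ws with
  | none => none
  | some (x, u, vs) =>
    match u.cut c with
    | some (u₁, y, u₂) =>
      bif (x.1.isOver ^^ y.1.isOver) && Word.free c (u₁ :: u₂ :: vs) then
        bif x.2 ^^ y.2 then some ((u₁ ++ u₂.rev) :: vs, u₁ :: u₂ :: vs)
        else some (u₁ :: u₂ :: vs, (u₁ ++ u₂.rev) :: vs)
      else none
    | none =>
      match Word.pull c vs with
      | none => none
      | some (y, v, vs') =>
        bif (x.1.isOver ^^ y.1.isOver) && Word.free c (u :: v :: vs') then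
          bif x.2 ^^ y.2 then some ((u ++ v.rev) :: vs', (u ++ v) :: vs')
          else some ((u ++ v) :: vs', (u ++ v.rev) :: vs')
        else none

theorem avg_traceProd (s t : R) (sg : Bool) {c : ℕ} {ws vs vs' : List Word}
    (h : Word.smooth c ws = some (vs, vs')) (q : ℕ → CrossingState X) :
    avg s t (c, sg) (traceProd R ws) q =
      coeff s t sg true * traceProd R vs q + coeff s t sg false * traceProd R vs' q := by
  rw [Word.smooth] at h
  split at h
  · simp at h
  rename_i x u us hpull
  obtain ⟨rfl, h1⟩ := Word.of_pull (R := R) (X := X) hpull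
  split at h
  · rename_i u₁ y u₂ hcut
    obtain ⟨rfl, h2⟩ := Word.of_cut hcut
    cases hb : (x.1.isOver ^^ y.1.isOver) && Word.free x.1.crossing (u₁ :: u₂ :: us) with
    | false => simp [hb] at h
    | true =>
      rw [Bool.and_eq_true] at hb
      have ho : y.1.isOver = !x.1.isOver := by
        revert hb; cases x.1.isOver <;> cases y.1.isOver <;> simp
      have hf := Word.of_free hb.2
      have e : avg s t (x.1.crossing, sg) (traceProd R ws) q =
          (coeff s t sg (x.2 == y.2) * (trace (wordMatrix R q u₁) * trace (wordMatrix R q u₂)) +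
            coeff s t sg (x.2 != y.2) * trace (wordMatrix R q u₁ * (wordMatrix R q u₂)ᵀ)) *
            traceProd R us q := by
        rw [← wordMatrix_rev, ← wordMatrix_append, ← avg_trace s t sg q h2 ho (hf u₁ (by simp))
          (hf u₂ (by simp)), avg, avg, Finset.sum_mul]
        refine Finset.sum_congr rfl fun a _ => ?_
        rw [h1, traceProd_cons, traceProd_update q fun w hw => hf w (by simp [hw]), mul_assoc]
      simp only [hb.1, hb.2, Bool.and_true, cond_true] at h
      rw [e]
      cases hx : x.2 <;> cases hy : y.2 <;>
        simp only [hx, hy, Bool.xor_self, Bool.xor_false, Bool.xor_true, Bool.not_false,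
          cond_true, cond_false, Option.some.injEq,
          Prod.mk.injEq] at h <;> obtain ⟨rfl, rfl⟩ := h <;>
        simp only [traceProd_cons, wordMatrix_append, wordMatrix_rev, BEq.rfl, bne_self_eq_false,
          show (false == true) = false from rfl, show (true == false) = false from rfl,
          show (false != true) = true from rfl, show (true != false) = true from rfl] <;> ring
  · split at h
    · simp at h
    rename_i y v us' hpull'
    obtain ⟨h2, h3⟩ := Word.of_pull (R := R) (X := X) hpull'
    cases hb : (x.1.isOver ^^ y.1.isOver) && Word.free x.1.crossing (u :: v :: us') with
    | false => simp [hb] at h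
    | true =>
      rw [Bool.and_eq_true] at hb
      have ho : y.1.isOver = !x.1.isOver := by
        revert hb; cases x.1.isOver <;> cases y.1.isOver <;> simp
      have hf := Word.of_free hb.2
      have e : avg s t (x.1.crossing, sg) (traceProd R ws) q =
          (coeff s t sg (x.2 == y.2) * trace (wordMatrix R q u * wordMatrix R q v) +
            coeff s t sg (x.2 != y.2) * trace (wordMatrix R q u * (wordMatrix R q v)ᵀ)) *
            traceProd R us' q := by
        rw [← wordMatrix_rev, ← wordMatrix_append, ← wordMatrix_append, ← avg_trace_mul_trace s t sg q
          h2 ho (hf u (by simp)) (hf v (by simp)), avg, avg, Finset.sum_mul]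
        refine Finset.sum_congr rfl fun a _ => ?_
        rw [h1, traceProd_cons, h3, traceProd_cons, traceProd_update q fun w hw => hf w (by simp [hw])]
        simp only [mul_assoc]
      simp only [hb.1, hb.2, Bool.and_true, cond_true] at h
      rw [e]
      cases hx : x.2 <;> cases hy : y.2 <;>
        simp only [hx, hy, Bool.xor_self, Bool.xor_false, Bool.xor_true, Bool.not_false,
          cond_true, cond_false, Option.some.injEq,
          Prod.mk.injEq] at h <;> obtain ⟨rfl, rfl⟩ := h <;>
        simp only [traceProd_cons, wordMatrix_append, wordMatrix_rev, BEq.rfl, bne_self_eq_false,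
          show (false == true) = false from rfl, show (true == false) = false from rfl,
          show (false != true) = true from rfl, show (true != false) = true from rfl] <;> ring

/-- The value of the state sum of some cyclic words, computed by smoothing all the crossings of a
list in turn, where `α` and `β` are the coefficients of the two smoothings of a crossing of given sign
and a closed curve without crossings counts `N`.  The numbers are natural numbers, which stand for
their residue classes in the ring. -/
def Word.eval (α β : Bool → ℕ) (N : ℕ) : List (ℕ × Bool) → List Word → Option ℕ
  | [], ws => bif ws.all List.isEmpty then some (N ^ ws.length) else none
  | c :: l, ws => match Word.smooth c.1 ws with
    | none => none
    | some (vs, vs') => match Word.eval α β N l vs, Word.eval α β N l vs' with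
      | some x, some y => some (α c.2 * x + β c.2 * y)
      | _, _ => none

theorem stateSum_traceProd {s t : R} {α β : Bool → ℕ} {N : ℕ}
    (hα : ∀ sg, coeff s t sg true = α sg) (hβ : ∀ sg, coeff s t sg false = β sg)
    (hN : (Fintype.card X : R) = N) (l : List (ℕ × Bool)) (ws : List Word) {x : ℕ}
    (h : Word.eval α β N l ws = some x) (q : ℕ → CrossingState X) :
    stateSum s t l (traceProd R ws) q = x := by
  induction l generalizing ws x with
  | nil =>
    rw [Word.eval] at h
    cases hb : ws.all List.isEmpty with
    | false => simp [hb] at h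
    | true =>
      simp only [hb, cond_true, Option.some.injEq] at h
      rw [stateSum_nil, ← h, Nat.cast_pow, ← hN]
      clear h
      induction ws with
      | nil => simp [traceProd]
      | cons w ws ih =>
        simp only [List.all_cons, Bool.and_eq_true, List.isEmpty_iff] at hb
        rw [traceProd_cons, ih hb.2, hb.1, wordMatrix_nil, trace_one, List.length_cons, pow_succ']
  | cons c l ih =>
    rw [Word.eval] at h
    split at h
    · simp at h
    rename_i vs vs' hs
    split at h
    · rename_i y z hy hz
      simp only [Option.some.injEq] at h
      rw [stateSum_cons, ← h, show avg s t c (traceProd R ws) = fun q : ℕ → CrossingState X =>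
        coeff s t c.2 true * traceProd R vs q + coeff s t c.2 false * traceProd R vs' q from
        funext fun q => avg_traceProd s t c.2 hs q, stateSum_linear, ih vs hy, ih vs' hz, hα, hβ]
      push_cast
      rfl
    · simp at h

theorem jones_eq_of_eval [Inhabited X] {s t : R} {α β : Bool → ℕ} {N : ℕ}
    (hα : ∀ sg, coeff s t sg true = α sg) (hβ : ∀ sg, coeff s t sg false = β sg)
    (hN : (Fintype.card X : R) = N) {w : Code} {x : ℕ}
    (h : Word.eval α β N (signs w) [Word.ofCode w] = some x) : jones (X := X) s t w = x := by
  rw [jones, ← stateSum_traceProd hα hβ hN _ _ h default]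
  congr 1
  funext q
  simp [traceProd, wordMatrix_ofCode]

end Words

/-! ### The state sums of twists and of two-strand braids -/

section Families

variable {R X : Type*} [CommRing R] [Fintype X] [DecidableEq X]

/-- The sum of `a * b ^ i` over `i < n`: if a crossing of a twist region has coefficient `a` for the
smoothing that cuts the region apart and `b` for the one that does not, this is the total
coefficient of the states that cut the region apart. -/
def twistCoeff (a b : R) : ℕ → R
  | 0 => 0
  | n + 1 => a + b * twistCoeff a b n

theorem twistCoeff_mul_add (a b N : R) (h : a * N + b = 1) (n : ℕ) :
    twistCoeff a b n * N + b ^ n = 1 := by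
  induction n with
  | zero => simp [twistCoeff]
  | succ n ih => rw [twistCoeff, pow_succ']; linear_combination h + b * ih

/-- The passages of one strand of a twist region through the crossings with given labels;
`o` tells where it is the upper strand. -/
def strand (o : ℕ → Bool) (sg : Bool) (l : List ℕ) : Code := l.map fun c => ⟨c, o c, sg⟩

theorem strand_cons (o : ℕ → Bool) (sg : Bool) (c : ℕ) (l : List ℕ) :
    strand o sg (c :: l) = ⟨c, o c, sg⟩ :: strand o sg l := rfl

theorem strand_append (o : ℕ → Bool) (sg : Bool) (l m : List ℕ) :
    strand o sg (l ++ m) = strand o sg l ++ strand o sg m := by simp [strand]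

theorem ne_of_mem_ofCode_strand {o : ℕ → Bool} {sg : Bool} {l : List ℕ} {c : ℕ} (h : c ∉ l) :
    ∀ x ∈ Word.ofCode (strand o sg l), x.1.crossing ≠ c := by
  intro x hx
  simp only [Word.ofCode, strand, List.map_map, List.mem_map, Function.comp_apply] at hx
  obtain ⟨d, hd, rfl⟩ := hx
  rintro rfl
  exact h hd

theorem Word.ofCode_append (u v : Code) :
    Word.ofCode (u ++ v) = Word.ofCode u ++ Word.ofCode v := by simp [Word.ofCode]

theorem Word.forall_mem_rev {w : Word} {P : ℕ → Prop} (h : ∀ x ∈ w, P x.1.crossing) :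
    ∀ x ∈ w.rev, P x.1.crossing := by
  intro x hx
  simp only [Word.rev, List.mem_reverse, List.mem_map] at hx
  obtain ⟨y, hy, rfl⟩ := hx
  exact h y hy

theorem trace_wordMatrix_append_comm (q : ℕ → CrossingState X) (u v : Word) :
    trace (wordMatrix R q (u ++ v)) = trace (wordMatrix R q (v ++ u)) := by
  rw [wordMatrix_append, wordMatrix_append, trace_mul_comm]

theorem trace_wordMatrix_rev (q : ℕ → CrossingState X) (u : Word) :
    trace (wordMatrix R q u.rev) = trace (wordMatrix R q u) := by
  rw [wordMatrix_rev, trace_transpose]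

/-- Sum over the states of a twist region through which the knot runs back in the reverse order, after
the part `x`: each crossing turns this part around, or it splits it off.  The list `l` starts with the
crossing next to `x`.  Once `x` has been split off, the rest of the twist region is a
sequence of curls, which do not matter. -/
theorem stateSum_twist (s t : R) (o : ℕ → Bool) (sg : Bool)
    (h : coeff s t sg true * (Fintype.card X : R) + coeff s t sg false = 1)
    (l : List ℕ) (hl : l.Nodup) (x y : Word) (hx : ∀ p ∈ x, p.1.crossing ∉ l)
    (hy : ∀ p ∈ y, p.1.crossing ∉ l) (q : ℕ → CrossingState X) :
    stateSum s t (l.map fun c => (c, sg)) (fun q => trace (wordMatrix R q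
        (Word.ofCode (strand o sg l.reverse) ++ (x ++
          (Word.ofCode (strand (fun c => !o c) sg l) ++ y))))) q =
      twistCoeff (coeff s t sg true) (coeff s t sg false) l.length *
          (trace (wordMatrix R q x) * trace (wordMatrix R q y)) +
        coeff s t sg false ^ l.length * trace (wordMatrix R q (Word.rev^[l.length] x ++ y)) := by
  induction l generalizing x with
  | nil =>
    simp [stateSum_nil, twistCoeff, strand, Word.ofCode]
  | cons c l ih =>
    obtain ⟨hc, hl⟩ := List.nodup_cons.1 hl
    have hx' : ∀ p ∈ x, p.1.crossing ∉ l := fun p hp h' => hx p hp (List.mem_cons_of_mem _ h')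
    have hy' : ∀ p ∈ y, p.1.crossing ∉ l := fun p hp h' => hy p hp (List.mem_cons_of_mem _ h')
    rw [List.map_cons, stateSum_cons]
    set V : Word := Word.ofCode (strand (fun c => !o c) sg l) ++
      (y ++ Word.ofCode (strand o sg l.reverse)) with hV
    have hVc : ∀ p ∈ V, p.1.crossing ≠ c := by
      intro p hp
      rw [hV, List.mem_append, List.mem_append] at hp
      rcases hp with hp | hp | hp
      · exact ne_of_mem_ofCode_strand hc p hp
      · exact fun h' => hy p hp (by simp [h'])
      · exact ne_of_mem_ofCode_strand (by simpa using hc) p hp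
    have hxc : ∀ p ∈ x, p.1.crossing ≠ c := fun p hp h' => hx p hp (by simp [h'])
    have key : ∀ q' : ℕ → CrossingState X, (∀ i, i ∉ (l.map fun c => (c, sg)).map Prod.fst → q' i = q i) →
        avg s t (c, sg) (fun q => trace (wordMatrix R q
          (Word.ofCode (strand o sg (c :: l).reverse) ++ (x ++
            (Word.ofCode (strand (fun c => !o c) sg (c :: l)) ++ y))))) q' =
        coeff s t sg true * trace (wordMatrix R q x) * trace (wordMatrix R q'
          (Word.ofCode (strand o sg l.reverse) ++ ([] ++
            (Word.ofCode (strand (fun c => !o c) sg l) ++ y)))) +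
        coeff s t sg false * trace (wordMatrix R q'
          (Word.ofCode (strand o sg l.reverse) ++ (x.rev ++
            (Word.ofCode (strand (fun c => !o c) sg l) ++ y)))) := by
      intro q' hq'
      have e := avg_trace s t sg q' (R := R) (l := (⟨c, o c, sg⟩, false))
        (m := (⟨c, !o c, sg⟩, false)) rfl rfl hxc hVc
      have e1 : trace (wordMatrix R q' x) = trace (wordMatrix R q x) := by
        unfold wordMatrix
        congr 2
        refine List.map_congr_left fun p hp => ?_
        rw [letterMatrix, letterMatrix, hq']
        simpa using hx' p hp
      have e3 : (fun q : ℕ → CrossingState X => trace (wordMatrix R q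
          (Word.ofCode (strand o sg (c :: l).reverse) ++ (x ++
            (Word.ofCode (strand (fun c => !o c) sg (c :: l)) ++ y))))) =
          fun q => trace (wordMatrix R q
            ((⟨c, o c, sg⟩, false) :: (x ++ (⟨c, !o c, sg⟩, false) :: V))) := by
        funext q'
        rw [List.reverse_cons, strand_append, strand_cons, Word.ofCode_append, List.append_assoc,
          trace_wordMatrix_append_comm, hV]
        simp [Word.ofCode, strand]
      rw [e3, e, e1, BEq.rfl, bne_self_eq_false, hV]
      simp only [wordMatrix_append, List.nil_append, wordMatrix_rev]
      have e4 : ∀ A P Y Q : Matrix X X R, trace (A * (P * (Y * Q))ᵀ) = trace (Q * (Aᵀ * (P * Y))) := by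
        intro A P Y Q
        rw [← trace_transpose, transpose_mul, transpose_transpose, trace_mul_comm Q]
        simp only [Matrix.mul_assoc]
        rw [trace_mul_comm Aᵀ]
        simp only [Matrix.mul_assoc]
      rw [e4, ← Matrix.mul_assoc _ (wordMatrix R q' y),
        trace_mul_comm _ (wordMatrix R q' (Word.ofCode (strand o sg l.reverse))), mul_assoc]
    rw [stateSum_congr s t _ _ _ q key, stateSum_linear, ih hl [] (by simp) hy',
      ih hl x.rev (Word.forall_mem_rev (P := (· ∉ l)) hx') hy']
    have hr : ∀ n, Word.rev^[n] ([] : Word) = [] := fun n => by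
      induction n with
      | zero => rfl
      | succ n ih => rw [Function.iterate_succ_apply, show Word.rev [] = [] from rfl, ih]
    have ha := twistCoeff_mul_add _ _ _ h l.length
    rw [hr, List.nil_append, trace_wordMatrix_rev, wordMatrix_nil, trace_one, List.length_cons,
      twistCoeff, pow_succ', Function.iterate_succ_apply]
    linear_combination coeff s t sg true * trace (wordMatrix R q x) * trace (wordMatrix R q y) * ha

/-- The recursion, in the number of crossings, for three sums over the states of a braid on two strands:
with the strands joined to one curve, with each strand closed up for itself, and with the strands
joined to one curve after one of them has been turned around.  Smoothing a crossing exchanges the first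
two closures or leads to the third one, in which all other crossings are curls. -/
def braidSums (a b N : R) (x : R × R × R) : R × R × R :=
  (a * x.2.1 + b * x.2.2, a * x.1 + b * x.2.2, (a + b * N) * x.2.2)

theorem stateSum_braid (s t : R) (o : ℕ → Bool) (sg : Bool) (l : List ℕ) (hl : l.Nodup)
    (q : ℕ → CrossingState X) :
    (stateSum s t (l.map fun c => (c, sg)) (fun q => trace (wordMatrix R q
        (Word.ofCode (strand o sg l) ++ Word.ofCode (strand (fun c => !o c) sg l)))) q,
      stateSum s t (l.map fun c => (c, sg)) (fun q => trace (wordMatrix R q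
        (Word.ofCode (strand o sg l))) * trace (wordMatrix R q
          (Word.ofCode (strand (fun c => !o c) sg l)))) q,
      stateSum s t (l.map fun c => (c, sg)) (fun q => trace (wordMatrix R q
        (Word.ofCode (strand o sg l) ++ Word.rev (Word.ofCode (strand (fun c => !o c) sg l))))) q) =
    (braidSums (coeff s t sg true) (coeff s t sg false) (Fintype.card X : R))^[l.length]
      ((Fintype.card X : R), (Fintype.card X : R) ^ 2, (Fintype.card X : R)) := by
  induction l with
  | nil => simp [stateSum_nil, strand, Word.ofCode, wordMatrix_nil, Word.rev, trace_one, pow_two]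
  | cons c l ih =>
    obtain ⟨hc, hl⟩ := List.nodup_cons.1 hl
    have h1 := ne_of_mem_ofCode_strand (o := o) (sg := sg) hc
    have h2 := ne_of_mem_ofCode_strand (o := fun c => !o c) (sg := sg) hc
    rw [List.length_cons, Function.iterate_succ_apply', ← ih hl, braidSums, List.map_cons,
      stateSum_cons, stateSum_cons, stateSum_cons]
    dsimp only
    rw [← stateSum_linear, ← stateSum_linear]
    refine Prod.ext ?_ (Prod.ext ?_ ?_)
    · dsimp only
      congr 1
      funext q'
      exact avg_trace s t sg q' (R := R) (l := (⟨c, o c, sg⟩, false))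
        (m := (⟨c, !o c, sg⟩, false)) rfl rfl h1 h2
    · dsimp only
      congr 1
      funext q'
      exact avg_trace_mul_trace s t sg q' (R := R) (l := (⟨c, o c, sg⟩, false))
        (m := (⟨c, !o c, sg⟩, false)) rfl rfl h1 h2
    · dsimp only
      have h := stateSum_linear s t (l.map fun c => (c, sg)) (fun q => trace (wordMatrix R q
        (Word.ofCode (strand o sg l) ++ Word.rev (Word.ofCode (strand (fun c => !o c) sg l)))))
        (fun _ => 0) (coeff s t sg true + coeff s t sg false * (Fintype.card X : R)) 0 q
      simp only [mul_zero, zero_mul, add_zero] at h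
      rw [← h]
      congr 1
      funext q'
      have h3 : ∀ p ∈ Word.ofCode (strand o sg l) ++
          Word.rev (Word.ofCode (strand (fun c => !o c) sg l)), p.1.crossing ≠ c := by
        intro p hp
        rcases List.mem_append.1 hp with hp | hp
        · exact h1 p hp
        · exact Word.forall_mem_rev (P := (· ≠ c)) h2 p hp
      have e := avg_trace s t sg q' (R := R) (l := (⟨c, o c, sg⟩, false))
        (m := (⟨c, !o c, sg⟩, true)) (v := []) rfl rfl h3 (by simp)
      rw [show Word.rev [] = [] from rfl, List.append_nil, wordMatrix_nil, trace_one] at e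
      rw [add_mul, add_comm (_ * _), mul_assoc, mul_comm (Fintype.card X : R), add_comm]
      refine Eq.trans ?_ (e.trans ?_)
      · congr 1
        funext q''
        congr 2
        simp [Word.ofCode, strand, Word.rev]
      · simp [add_comm]

end Families

/-! ### The Jones polynomials of twist knots and torus knots -/

section TwistAndTorus

variable {R X : Type*} [CommRing R] [Fintype X] [DecidableEq X]

theorem signs_strand_perm (o : ℕ → Bool) (sg : Bool) (l : List ℕ) :
    (signs (strand o sg l) ++ signs (strand (fun c => !o c) sg l)).Perm (l.map fun c => (c, sg)) := by
  induction l with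
  | nil => exact List.Perm.refl _
  | cons c l ih =>
    rw [strand_cons, strand_cons, signs_cons, signs_cons, List.map_cons]
    cases o c
    · simpa using List.perm_middle.trans (ih.cons _)
    · simpa using ih

/-- For odd `p`, the second passage through each crossing has the other parity. -/
theorem torusCode_of_odd {p : ℕ} (hp : p % 2 = 1) : torusCode p =
    strand (fun c => c % 2 == 0) true (List.range p) ++
      strand (fun c => !(c % 2 == 0)) true (List.range p) := by
  rw [torusCode, alternating, List.mapIdx_append]
  congr 1
  · refine List.ext_getElem (by simp [strand]) fun i h1 h2 => ?_
    simp [strand]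
  · refine List.ext_getElem (by simp [strand]) fun i h1 h2 => ?_
    simp [strand]
    grind

theorem jones_torusCode [Inhabited X] (s t : R) {p : ℕ} (hp : p % 2 = 1) :
    jones (X := X) s t (torusCode p) =
      ((braidSums (coeff s t true true) (coeff s t true false) (Fintype.card X : R))^[p]
        ((Fintype.card X : R), (Fintype.card X : R) ^ 2, (Fintype.card X : R))).1 := by
  have h := congrArg Prod.fst (stateSum_braid (X := X) s t (fun c => c % 2 == 0) true
    (List.range p) List.nodup_range default)
  rw [List.length_range] at h
  rw [← h, jones, torusCode_of_odd hp, signs_append,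
    stateSum_perm s t (signs_strand_perm _ _ _)]
  · simp only [← Word.ofCode_append, wordMatrix_ofCode]
  · refine ((signs_strand_perm _ _ _).map Prod.fst).nodup_iff.2 ?_
    simp [Function.comp_def, List.nodup_range]

/-- The crossings of a code are renumbered, starting with `n`. -/
def shift (n : ℕ) (w : Code) : Code := w.map fun p => ⟨p.crossing + n, p.isOver, p.isPos⟩

/-- The two passages through the clasp of a twist knot between the strands of the twist region, with the
numbers `0` and `1` for the crossings; the number of crossings of the twist region is even if
`e = true` and odd otherwise. -/
def claspTop (e : Bool) : Code :=
  bif e then [⟨0, true, false⟩, ⟨1, false, false⟩] else [⟨1, false, true⟩, ⟨0, true, true⟩]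

/-- The other two passages through the clasp of a twist knot. -/
def claspBottom (e : Bool) : Code := [⟨1, true, !e⟩, ⟨0, false, !e⟩]

theorem twistCode_eq (n : ℕ) : twistCode n =
    strand (fun c => c % 2 == 0) true (List.range n).reverse.reverse ++
      (shift n (claspTop (n % 2 == 0)) ++
        (strand (fun c => !(c % 2 == 0)) true (List.range n).reverse ++
          shift n (claspBottom (n % 2 == 0)))) := by
  rw [twistCode, alternating, List.append_assoc, List.append_assoc, List.mapIdx_append,
    List.mapIdx_append, List.mapIdx_append]
  congr 1
  · refine List.ext_getElem (by simp [strand]) fun i h1 h2 => ?_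
    simp [strand] at h1 ⊢
    exact Or.inr h1
  congr 1
  · rcases Nat.mod_two_eq_zero_or_one n with h | h
    · simp [h, claspTop, shift]
      grind
    · simp [h, claspTop, shift]
      grind
  congr 1
  · refine List.ext_getElem (by simp [strand]) fun i h1 h2 => ?_
    simp only [List.length_mapIdx, List.length_reverse, List.length_range] at h1
    have h3 : (i + 2 + n) % 2 = 0 ↔ ¬ (n - 1 - i) % 2 = 0 := by omega
    rcases Nat.mod_two_eq_zero_or_one n with h | h
    · simp [strand, h]
      grind
    · simp [strand, h]
      grind
  · rcases Nat.mod_two_eq_zero_or_one n with h | h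
    · simp [claspBottom, shift, h]
      grind
    · simp [claspBottom, shift, h]
      grind

theorem wordMatrix_shift (q : ℕ → CrossingState X) (n : ℕ) (w : Code) :
    wordMatrix R q (Word.ofCode (shift n w)) = wordMatrix R (q ∘ (· + n)) (Word.ofCode w) := by
  simp [wordMatrix, Word.ofCode, shift, letterMatrix, Function.comp_def]

theorem Word.iterate_rev (n : ℕ) (w : Word) :
    Word.rev^[n] w = bif n % 2 == 0 then w else w.rev := by
  have h : Function.Involutive Word.rev := fun w => by simp [Word.rev, Function.comp_def]
  rcases Nat.mod_two_eq_zero_or_one n with h' | h'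
  · rw [h.iterate_even (Nat.even_iff.2 h'), h']; rfl
  · rw [h.iterate_odd (Nat.odd_iff.2 h'), h']; rfl

/-- The curve through the clasp that remains when the crossings of the twist region have been smoothed so
that the two passages through the clasp stay connected; the first one has been turned around once
for each crossing. -/
def claspWord (e : Bool) : Word :=
  (bif e then Word.ofCode (claspTop e) else Word.rev (Word.ofCode (claspTop e))) ++
    Word.ofCode (claspBottom e)

theorem jones_twistCode [Inhabited X] {s t : R} (h : s * t = 1) (hN : (Fintype.card X : R) = -(s + t)) (n : ℕ) :
    jones (X := X) s t (twistCode n) =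
      twistCoeff (coeff s t true true) (coeff s t true false) n *
          stateSum s t [(0, !(n % 2 == 0)), (1, !(n % 2 == 0))] (traceProd R
            [Word.ofCode (claspTop (n % 2 == 0)), Word.ofCode (claspBottom (n % 2 == 0))])
            (default : ℕ → CrossingState X) +
        coeff s t true false ^ n *
          stateSum s t [(0, !(n % 2 == 0)), (1, !(n % 2 == 0))] (traceProd R
            [claspWord (n % 2 == 0)]) (default : ℕ → CrossingState X) := by
  -- all crossings of the twist region are positive, and a curl counts as `1`
  have hc : coeff s t true true * (Fintype.card X : R) + coeff s t true false = 1 := by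
    rw [hN]
    simp only [coeff, if_true, Bool.false_eq_true, if_false]
    linear_combination h
  set e := n % 2 == 0 with he
  have hp : (signs (twistCode n)).Perm ((List.range n).reverse.map (fun c => (c, true)) ++
      [(0, !e), (1, !e)].map fun c => (c.1 + n, c.2)) := by
    rw [twistCode_eq, ← he, List.reverse_reverse, signs_append, signs_append, signs_append]
    have h1 := signs_strand_perm (fun c => c % 2 == 0) true (List.range n)
    have h2 : signs (shift n (claspTop e)) ++ signs (shift n (claspBottom e)) =
        [(0, !e), (1, !e)].map fun c => (c.1 + n, c.2) := by
      cases e <;> rfl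
    have h3 : (signs (strand (fun c => !(c % 2 == 0)) true (List.range n).reverse)).Perm
        (signs (strand (fun c => !(c % 2 == 0)) true (List.range n))) :=
      ((List.reverse_perm _).map _).filter _ |>.map _
    rw [← h2]
    refine (List.Perm.append_left _ (List.Perm.append_left _ (h3.append_right _))).trans ?_
    refine List.Perm.trans ?_ (((h1.trans ((List.reverse_perm _).symm.map _))).append_right _)
    grind
  have hsum : ∀ ws : List Word, stateSum s t ([(0, !e), (1, !e)].map fun c => (c.1 + n, c.2))
      (fun q => traceProd R ws (q ∘ (· + n))) (default : ℕ → CrossingState X) =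
      stateSum s t [(0, !e), (1, !e)] (traceProd R ws) (default : ℕ → CrossingState X) := by
    intro ws
    exact stateSum_relabel s t (· + n) Set.univ (fun _ _ _ _ h => Nat.add_right_cancel h) _
      (fun _ _ => Set.mem_univ _) _ (fun q q' h => by rw [funext fun i => h i (Set.mem_univ i)])
      default
  rw [jones, stateSum_perm s t hp, stateSum_append]
  · rw [← hsum, ← hsum, ← stateSum_linear]
    congr 1
    funext q
    have ht := stateSum_twist s t (fun c => c % 2 == 0) true hc (List.range n).reverse
      (List.nodup_reverse.2 List.nodup_range) (Word.ofCode (shift n (claspTop e)))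
      (Word.ofCode (shift n (claspBottom e))) ?_ ?_ q
    · rw [List.length_reverse, List.length_range] at ht
      simp only [twistCode_eq, ← he, ← wordMatrix_ofCode, Word.ofCode_append]
      rw [ht, Word.iterate_rev, ← he]
      simp only [traceProd, claspWord, List.map_cons, List.map_nil, List.prod_cons, List.prod_nil,
        mul_one, wordMatrix_shift, wordMatrix_append]
      congr 4
      cases e
      · simp [wordMatrix_rev, wordMatrix_shift]
      · simp [wordMatrix_shift]
    · have : ∀ p ∈ claspTop e, p.crossing + n ∉ (List.range n).reverse := by simp
      simp only [Word.ofCode, shift, List.map_map, List.mem_map]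
      rintro _ ⟨p, hp, rfl⟩
      exact this p hp
    · have : ∀ p ∈ claspBottom e, p.crossing + n ∉ (List.range n).reverse := by simp
      simp only [Word.ofCode, shift, List.map_map, List.mem_map]
      rintro _ ⟨p, hp, rfl⟩
      exact this p hp
  · refine (hp.map Prod.fst).nodup_iff.2 ?_
    rw [List.map_append, List.nodup_append]
    simp [Function.comp_def, List.nodup_range]
    omega

end TwistAndTorus

/-! ### An invariant with values in a finite field -/

/-- A symmetric function of two values of the Jones polynomial: `3` and `505` are inverse to each other
modulo `757`, and `249` is `-(3 + 505)`.  The order of `3` and `505` is only `9`, which makes the values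
for twist knots and torus knots periodic with a small period, and yet these values distinguish all
knots of the table. -/
def invariant (w : Code) : ZMod 757 := jonesPair (Fin 249) 3 505 w

theorem natCast_card_fin : (Fintype.card (Fin 249) : ZMod 757) = -(3 + 505) := by
  rw [Fintype.card_fin]; decide +kernel

theorem invariant_eq_of_knotType_eq {v w : Code} (h : knotType v = knotType w) :
    invariant v = invariant w :=
  jonesPair_eq_of_knotType_eq (by decide +kernel) natCast_card_fin h

/-- The residue of `coeff 3 505 sg true` modulo `757`. -/
def alpha (sg : Bool) : ℕ := bif sg then 252 else 754

/-- The residue of `coeff 3 505 sg false` modulo `757`. -/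
def beta (sg : Bool) : ℕ := bif sg then 84 else 748

theorem coeff_eq_alpha (sg : Bool) : coeff (3 : ZMod 757) 505 sg true = alpha sg := by
  cases sg <;> decide +kernel

theorem coeff_eq_beta (sg : Bool) : coeff (3 : ZMod 757) 505 sg false = beta sg := by
  cases sg <;> decide +kernel

theorem coeff_eq_alpha_not (sg : Bool) : coeff (505 : ZMod 757) 3 sg true = alpha !sg := by
  cases sg <;> decide +kernel

theorem coeff_eq_beta_not (sg : Bool) : coeff (505 : ZMod 757) 3 sg false = beta !sg := by
  cases sg <;> decide +kernel

/-- The invariant of a diagram, computed by smoothing the crossings. -/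
def evalInvariant (w : Code) : Option ℕ :=
  match Word.eval alpha beta 249 (signs w) [Word.ofCode w],
    Word.eval (fun sg => alpha !sg) (fun sg => beta !sg) 249 (signs w) [Word.ofCode w] with
  | some x, some y => some ((1 + x) * (1 + y) % 757)
  | _, _ => none

theorem invariant_eq_of_eval {w : Code} {x : ℕ} (h : evalInvariant w = some x) :
    invariant w = x := by
  unfold evalInvariant at h
  split at h
  · rename_i y z hy hz
    simp only [Option.some.injEq] at h
    rw [invariant, jonesPair,
      jones_eq_of_eval coeff_eq_alpha coeff_eq_beta (by rw [Fintype.card_fin]) hy,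
      jones_eq_of_eval coeff_eq_alpha_not coeff_eq_beta_not (by rw [Fintype.card_fin]) hz, ← h,
      ZMod.natCast_mod]
    push_cast
    rfl
  · simp at h

namespace TableKnot

/-- The values of the invariant for the knots of the table, as residues modulo `757`. -/
def invariant : TableKnot → ℕ
  | k0_1 => 426
  | k3_1 => 33
  | k4_1 => 620
  | k5_1 => 429
  | k5_2 => 71
  | k6_1 => 252
  | k6_2 => 299
  | k6_3 => 248
  | k7_1 => 436
  | k7_2 => 664
  | k7_3 => 309
  | k7_4 => 698
  | k7_5 => 169
  | k7_6 => 397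
  | k7_7 => 527
  | k8_1 => 432
  | k8_2 => 118
  | k8_3 => 296
  | k8_4 => 581
  | k8_6 => 608
  | k8_7 => 434
  | k8_8 => 738
  | k8_9 => 394
  | k8_11 => 668
  | k8_12 => 267
  | k8_13 => 628
  | k8_14 => 402

/-- The list of all knots of the table. -/
def all : List TableKnot :=
  [k0_1, k3_1, k4_1, k5_1, k5_2, k6_1, k6_2, k6_3, k7_1, k7_2, k7_3, k7_4, k7_5, k7_6, k7_7, k8_1,
    k8_2, k8_3, k8_4, k8_6, k8_7, k8_8, k8_9, k8_11, k8_12, k8_13, k8_14]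

theorem mem_all (K : TableKnot) : K ∈ all := by cases K <;> decide

theorem evalInvariant_code (K : TableKnot) : evalInvariant K.code = some K.invariant := by
  have h : ∀ K ∈ all, evalInvariant K.code = some K.invariant := by decide +kernel
  exact h K (mem_all K)

theorem invariant_code (K : TableKnot) : TieKnots.invariant K.code = K.invariant :=
  invariant_eq_of_eval (evalInvariant_code K)

theorem type_injective : Function.Injective type := by
  intro K K' h
  have h1 := invariant_eq_of_knotType_eq h
  rw [invariant_code, invariant_code, ZMod.natCast_eq_natCast_iff'] at h1
  have h2 : (all.map fun K => K.invariant % 757).Nodup := by decide +kernel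
  exact List.inj_on_of_nodup_map h2 (mem_all K) (mem_all K') h1

end TableKnot

/-! ### Twist knots and torus knots in the table -/

theorem twistCoeff_add {R : Type*} [CommRing R] (a b : R) (m n : ℕ) :
    twistCoeff a b (m + n) = twistCoeff a b m + b ^ m * twistCoeff a b n := by
  induction m with
  | zero => simp [twistCoeff]
  | succ m ih => rw [Nat.add_right_comm, twistCoeff, ih, twistCoeff]; ring

/-- The state sums of the clasp of a twist knot in which the two passages through the clasp are
separated by the smoothing of the twist region, or stay connected. -/
def evalClasp (α β : Bool → ℕ) (e : Bool) : ℕ × ℕ :=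
  ((Word.eval α β 249 [(0, !e), (1, !e)]
      [Word.ofCode (claspTop e), Word.ofCode (claspBottom e)]).getD 0,
    (Word.eval α β 249 [(0, !e), (1, !e)] [claspWord e]).getD 0)

/-- The value of the Jones polynomial for the twist knot with `n` crossings in the twist region. -/
def twistValue (α β : Bool → ℕ) (n : ℕ) : ZMod 757 :=
  twistCoeff (α true : ZMod 757) (β true : ZMod 757) n * (evalClasp α β (n % 2 == 0)).1 +
    (β true : ZMod 757) ^ n * (evalClasp α β (n % 2 == 0)).2

theorem jones_twistCode_eq_twistValue {s t : ZMod 757} (h : s * t = 1)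
    (hN : (Fintype.card (Fin 249) : ZMod 757) = -(s + t)) {α β : Bool → ℕ}
    (hα : ∀ sg, coeff s t sg true = α sg) (hβ : ∀ sg, coeff s t sg false = β sg) (n : ℕ) :
    jones (X := Fin 249) s t (twistCode n) = twistValue α β n := by
  rw [jones_twistCode h hN, twistValue, hα, hβ]
  have h0 : ∀ {o : Option ℕ}, o.isSome = true → o = some (o.getD 0) := by
    rintro (_ | x) h
    · simp at h
    · rfl
  have h1 : ∀ e, Word.eval α β 249 [(0, !e), (1, !e)]
      [Word.ofCode (claspTop e), Word.ofCode (claspBottom e)] = some (evalClasp α β e).1 := by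
    intro e
    refine h0 ?_
    cases e <;> rfl
  have h2 : ∀ e, Word.eval α β 249 [(0, !e), (1, !e)] [claspWord e] = some (evalClasp α β e).2 := by
    intro e
    refine h0 ?_
    cases e <;> rfl
  rw [stateSum_traceProd hα hβ (by rw [Fintype.card_fin]) _ _ (h1 _),
    stateSum_traceProd hα hβ (by rw [Fintype.card_fin]) _ _ (h2 _)]

/-- The coefficients have order dividing `18`, so that the values for twist knots are periodic. -/
theorem twistValue_mod {α β : Bool → ℕ} (h1 : twistCoeff (α true : ZMod 757) (β true : ZMod 757) 18 = 0)
    (h2 : (β true : ZMod 757) ^ 18 = 1) (n : ℕ) : twistValue α β n = twistValue α β (n % 18) := by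
  have h : Function.Periodic (twistValue α β) 18 := by
    intro n
    have h3 : (n + 18) % 2 = n % 2 := by omega
    rw [twistValue, twistValue, h3, add_comm n, twistCoeff_add, pow_add, h1, h2]
    ring
  exact (h.map_mod_nat n).symm

/-- The invariant of a twist knot. -/
def twistInvariant (n : ℕ) : ZMod 757 :=
  (1 + twistValue alpha beta n) * (1 + twistValue (fun sg => alpha !sg) (fun sg => beta !sg) n)

theorem invariant_twistCode (n : ℕ) : invariant (twistCode n) = twistInvariant (n % 18) := by
  rw [invariant, jonesPair, jones_twistCode_eq_twistValue (by decide +kernel) natCast_card_fin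
    coeff_eq_alpha coeff_eq_beta, jones_twistCode_eq_twistValue (by decide +kernel)
    (by rw [natCast_card_fin, add_comm]) coeff_eq_alpha_not coeff_eq_beta_not, twistInvariant,
    twistValue_mod (by decide +kernel) (by decide +kernel),
    twistValue_mod (n := n) (by decide +kernel) (by decide +kernel)]

/-- The value of the Jones polynomial for the `(2, p)` torus knot. -/
def torusValue (a b : ZMod 757) (p : ℕ) : ZMod 757 :=
  ((braidSums a b 249)^[p] (249, 249 ^ 2, 249)).1

theorem torusValue_mod {a b : ZMod 757}
    (h : (braidSums a b 249)^[18] (249, 249 ^ 2, 249) = (249, 249 ^ 2, 249)) (p : ℕ) :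
    torusValue a b p = torusValue a b (p % 18) := by
  have h' : Function.IsPeriodicPt (braidSums a b 249) 18 (249, 249 ^ 2, 249) := h
  rw [torusValue, torusValue, h'.iterate_mod_apply]

/-- The invariant of a `(2, p)` torus knot. -/
def torusInvariant (p : ℕ) : ZMod 757 :=
  (1 + torusValue (alpha true) (beta true) p) * (1 + torusValue (alpha false) (beta false) p)

theorem invariant_torusCode {p : ℕ} (hp : p % 2 = 1) :
    invariant (torusCode p) = torusInvariant (p % 18) := by
  have hN : ((Fintype.card (Fin 249) : ℕ) : ZMod 757) = 249 := by rw [Fintype.card_fin]; rfl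
  rw [invariant, jonesPair, jones_torusCode _ _ hp, jones_torusCode _ _ hp, coeff_eq_alpha,
    coeff_eq_beta, coeff_eq_alpha_not, coeff_eq_beta_not, hN, torusInvariant,
    ← torusValue_mod (by decide +kernel), ← torusValue_mod (by decide +kernel)]
  rfl

namespace TableKnot

/-- Whether the knot is a twist knot, but neither the unknot nor the trefoil. -/
def isTwist (K : TableKnot) : Bool := [k4_1, k5_2, k6_1, k7_2, k8_1].contains K

/-- Whether the knot is a `(2, p)` torus knot, but neither the unknot nor the trefoil. -/
def isTorus (K : TableKnot) : Bool := [k5_1, k7_1].contains K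

theorem isTwistType_iff {K : TableKnot} (h0 : K ≠ k0_1) (h3 : K ≠ k3_1) :
    IsTwistType K.type ↔ K.isTwist = true := by
  constructor
  · rintro ⟨n, _, hn⟩
    by_contra hK
    have h1 := invariant_eq_of_knotType_eq hn
    rw [invariant_twistCode, invariant_code] at h1
    -- by periodicity, finitely many twist knots have to be compared with the table
    have h2 : ∀ K ∈ all, K = k0_1 ∨ K = k3_1 ∨ K.isTwist = true ∨
        ∀ r < 18, twistInvariant r ≠ K.invariant := by decide +kernel
    rcases h2 K (mem_all K) with h | h | h | h
    · exact h0 h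
    · exact h3 h
    · exact hK h
    · exact h _ (Nat.mod_lt _ (by norm_num)) h1
  · intro h
    simp only [isTwist, List.contains_eq_mem, List.mem_cons, List.not_mem_nil, or_false,
      decide_eq_true_eq] at h
    rcases h with rfl | rfl | rfl | rfl | rfl
    · exact ⟨2, by norm_num, knotType_twistCode_two⟩
    · exact ⟨3, by norm_num, knotType_twistCode_three⟩
    · exact ⟨4, by norm_num, knotType_twistCode_four⟩
    · exact ⟨5, by norm_num, knotType_twistCode_five⟩
    · exact ⟨6, by norm_num, knotType_twistCode_six⟩

theorem isTwoBraidTorusType_iff {K : TableKnot} (h0 : K ≠ k0_1) (h3 : K ≠ k3_1) :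
    IsTwoBraidTorusType K.type ↔ K.isTorus = true := by
  constructor
  · rintro ⟨p, hp, hn⟩
    by_contra hK
    have h1 := invariant_eq_of_knotType_eq hn
    rw [invariant_torusCode hp, invariant_code] at h1
    have h2 : ∀ K ∈ all, K = k0_1 ∨ K = k3_1 ∨ K.isTorus = true ∨
        ∀ r < 18, r % 2 = 1 → torusInvariant r ≠ K.invariant := by decide +kernel
    rcases h2 K (mem_all K) with h | h | h | h
    · exact h0 h
    · exact h3 h
    · exact hK h
    · exact h _ (Nat.mod_lt _ (by norm_num)) (by omega) h1
  · intro h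
    simp only [isTorus, List.contains_eq_mem, List.mem_cons, List.not_mem_nil, or_false,
      decide_eq_true_eq] at h
    rcases h with rfl | rfl
    · exact ⟨5, by norm_num, knotType_torusCode_five⟩
    · exact ⟨7, by norm_num, knotType_torusCode_seven⟩

end TableKnot

/-! ### The list of all tie sequences -/

/-- The six tie moves. -/
def allMoves : List TieMove := [Li, Lo, Ri, Ro, Ci, Co]

/-- The lists of at most `n` moves that may follow the move `m`, where regions are not repeated
and directions alternate. -/
def continuations : ℕ → TieMove → List (List TieMove)
  | 0, _ => [[]]
  | n + 1, m => [] :: (allMoves.filter fun m' => m.region ≠ m'.region ∧ m.inward ≠ m'.inward).flatMap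
      fun m' => (continuations n m').map (m' :: ·)

theorem mem_allMoves (m : TieMove) : m ∈ allMoves := by
  obtain ⟨_ | _ | _, _ | _⟩ := m <;> decide

theorem mem_continuations {n : ℕ} {m : TieMove} {s : List TieMove} (hn : s.length ≤ n)
    (h1 : (m :: s).IsChain fun x y => x.region ≠ y.region)
    (h2 : (m :: s).IsChain fun x y => x.inward ≠ y.inward) : s ∈ continuations n m := by
  induction n generalizing m s with
  | zero => simp [continuations, List.eq_nil_of_length_eq_zero (Nat.le_zero.1 hn)]
  | succ n ih =>
    rw [continuations]
    cases s with
    | nil => simp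
    | cons m' s =>
      rw [List.isChain_cons_cons] at h1 h2
      refine List.mem_cons_of_mem _ (List.mem_flatMap.2 ⟨m', ?_, ?_⟩)
      · exact List.mem_filter.2 ⟨mem_allMoves m', by simpa using ⟨h1.1, h2.1⟩⟩
      · exact List.mem_map_of_mem (ih (by simpa using hn) h1.2 h2.2)

theorem isTieSequence_iff_mem (s : List TieMove) :
    IsTieSequence s ↔ s ∈ tieTable.map Prod.fst := by
  constructor
  · intro h
    have key : ∀ m ∈ [Li, Lo], ∀ r ∈ continuations 8 m,
        [Lo, Ri, Co] <:+ m :: r ∨ [Ro, Li, Co] <:+ m :: r → m :: r ∈ tieTable.map Prod.fst := by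
      decide +kernel
    cases s with
    | nil => simpa using h.start_left
    | cons m r =>
      refine key m (by simpa using h.start_left) r
        (mem_continuations ?_ h.no_region_repeated h.directions_alternate) h.flat_facade
      exact Nat.le_of_succ_le_succ h.at_most_nine
  · intro h
    have key : ∀ s ∈ tieTable.map Prod.fst, (s.head? = some Li ∨ s.head? = some Lo) ∧
        (s.IsChain fun x y => x.region ≠ y.region) ∧ (s.IsChain fun x y => x.inward ≠ y.inward) ∧
        ([Lo, Ri, Co] <:+ s ∨ [Ro, Li, Co] <:+ s) ∧ s.length ≤ 9 := by
      decide +kernel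
    obtain ⟨h1, h2, h3, h4, h5⟩ := key s h
    exact ⟨h1, h2, h3, h4, h5⟩

theorem nodup_tieTable : (tieTable.map Prod.fst).Nodup := by decide +kernel

/-- A property of tie sequences that can be read off from the table is counted there. -/
theorem ncard_tieSequences {Q : List TieMove → Prop} (q : List TieMove × TableKnot → Bool)
    (h : ∀ x ∈ tieTable, Q x.1 ↔ q x = true) :
    {s | IsTieSequence s ∧ Q s}.ncard = tieTable.countP q := by
  have h1 : {s | IsTieSequence s ∧ Q s} = ((tieTable.filter q).map Prod.fst).toFinset := by
    ext s
    simp only [Set.mem_ofPred_eq, isTieSequence_iff_mem, List.coe_toFinset, List.mem_map,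
      List.mem_filter]
    constructor
    · rintro ⟨⟨x, hx, rfl⟩, hQ⟩
      exact ⟨x, ⟨hx, (h x hx).1 hQ⟩, rfl⟩
    · rintro ⟨x, ⟨hx, hq⟩, rfl⟩
      exact ⟨⟨x, hx, rfl⟩, (h x hx).2 hq⟩
  rw [h1, Set.ncard_coe_finset, List.toFinset_card_of_nodup
    (nodup_tieTable.sublist (List.filter_sublist.map _)), List.length_map, List.countP_eq_length_filter]

theorem exists_tieSequence_iff {Q : List TieMove → Prop} {T : KnotType} :
    (∃ s, IsTieSequence s ∧ Q s ∧ tieType s = T) ↔ ∃ x ∈ tieTable, Q x.1 ∧ x.2.type = T := by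
  constructor
  · rintro ⟨s, hs, hQ, rfl⟩
    obtain ⟨x, hx, rfl⟩ := List.mem_map.1 ((isTieSequence_iff_mem s).1 hs)
    exact ⟨x, hx, hQ, (tieType_eq hx).symm⟩
  · rintro ⟨x, hx, hQ, rfl⟩
    exact ⟨x.1, (isTieSequence_iff_mem _).2 (List.mem_map_of_mem hx), hQ, tieType_eq hx⟩

/-- Here the distinctness of the types in the table is needed: no other rows of the table may have the
same type. -/
theorem ncard_tieSequences_of_type (K : TableKnot) :
    {s | IsTieSequence s ∧ tieType s = K.type}.ncard = totalCount K := by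
  rw [ncard_tieSequences (fun x => decide (x.2 = K)) fun x hx => by
    rw [tieType_eq hx, TableKnot.type_injective.eq_iff, decide_eq_true_eq]]
  have h : ∀ K ∈ TableKnot.all, tieTable.countP (fun x => decide (x.2 = K)) = totalCount K := by
    decide +kernel
  exact h K (TableKnot.mem_all K)

theorem ncard_tieSequences_of_length_of_type (K : TableKnot) (k : ℕ) :
    {s | IsTieSequence s ∧ s.length = k ∧ tieType s = K.type}.ncard =
      ((countsByMoves K).lookup k).getD 0 := by
  rw [ncard_tieSequences (fun x => decide (x.1.length = k ∧ x.2 = K)) fun x hx => by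
    rw [tieType_eq hx, TableKnot.type_injective.eq_iff, decide_eq_true_eq]]
  by_cases hk : k < 10
  · have h : ∀ K ∈ TableKnot.all, ∀ k < 10, tieTable.countP
        (fun x => decide (x.1.length = k ∧ x.2 = K)) = ((countsByMoves K).lookup k).getD 0 := by
      decide +kernel
    exact h K (TableKnot.mem_all K) k hk
  · have h1 : ∀ x ∈ tieTable, x.1.length < 10 := by decide +kernel
    have h2 : ∀ K ∈ TableKnot.all, ∀ p ∈ countsByMoves K, p.1 < 10 := by decide +kernel
    have h3 : (countsByMoves K).lookup k = none := by
      rw [List.lookup_eq_none_iff]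
      intro p hp
      have := h2 K (TableKnot.mem_all K) p hp
      exact bne_iff_ne.2 (by omega)
    rw [h3, Option.getD_none, List.countP_eq_zero]
    intro x hx
    have := h1 x hx
    simp only [decide_eq_true_eq]
    omega

theorem types_eq_of_length (k : ℕ) :
    {T | ∃ s, IsTieSequence s ∧ s.length = k ∧ tieType s = T} =
      {T | ∃ K ∈ typesWithMoves k, K.type = T} := by
  ext T
  refine exists_tieSequence_iff.trans ⟨?_, ?_⟩
  · rintro ⟨x, hx, rfl, rfl⟩
    have h : ∀ x ∈ tieTable, x.2 ∈ typesWithMoves x.1.length := by decide +kernel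
    exact ⟨x.2, h x hx, rfl⟩
  · rintro ⟨K, hK, rfl⟩
    by_cases hk : k < 10
    · have h : ∀ k < 10, ∀ K ∈ typesWithMoves k, ∃ x ∈ tieTable, x.1.length = k ∧ x.2 = K := by
        decide +kernel
      obtain ⟨x, hx, hl, rfl⟩ := h k hk K hK
      exact ⟨x, hx, hl, rfl⟩
    · obtain ⟨j, rfl⟩ := Nat.exists_eq_add_of_le (not_lt.1 hk)
      rw [Nat.add_comm] at hK
      exact absurd hK List.not_mem_nil

theorem exists_mem_tieTable (K : TableKnot) : ∃ x ∈ tieTable, x.2 = K := by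
  have h : ∀ K ∈ TableKnot.all, ∃ x ∈ tieTable, x.2 = K := by decide +kernel
  exact h K (TableKnot.mem_all K)

theorem exists_tieSequence_of_type_iff {T : KnotType} :
    (∃ s, IsTieSequence s ∧ tieType s = T) ↔ ∃ K : TableKnot, K.type = T := by
  have h := exists_tieSequence_iff (Q := fun _ => True) (T := T)
  simp only [true_and] at h
  rw [h]
  constructor
  · rintro ⟨x, _, rfl⟩
    exact ⟨x.2, rfl⟩
  · rintro ⟨K, rfl⟩
    obtain ⟨x, hx, rfl⟩ := exists_mem_tieTable K
    exact ⟨x, hx, rfl⟩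

/-- A property of the types that occur is counted in the list of the knots of the table. -/
theorem ncard_types {Q : KnotType → Prop} (q : TableKnot → Bool)
    (h : ∀ K : TableKnot, Q K.type ↔ q K = true) :
    {T | Q T ∧ ∃ s, IsTieSequence s ∧ tieType s = T}.ncard = (TableKnot.all.filter q).length := by
  have h1 : {T | Q T ∧ ∃ s, IsTieSequence s ∧ tieType s = T} =
      TableKnot.type '' (TableKnot.all.filter q).toFinset := by
    ext T
    simp only [Set.mem_ofPred_eq, exists_tieSequence_of_type_iff, List.coe_toFinset, Set.mem_image,
      List.mem_filter]
    constructor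
    · rintro ⟨hQ, K, rfl⟩
      exact ⟨K, ⟨TableKnot.mem_all K, (h K).1 hQ⟩, rfl⟩
    · rintro ⟨K, ⟨_, hq⟩, rfl⟩
      exact ⟨(h K).2 hq, K, rfl⟩
  have h2 : TableKnot.all.Nodup := by decide +kernel
  rw [h1, Set.ncard_image_of_injective _ TableKnot.type_injective, Set.ncard_coe_finset,
    List.toFinset_card_of_nodup (h2.filter _)]

theorem crossingNumber_le {w : Code} (h : IsKnotDiagram w) :
    crossingNumber (knotType w) ≤ crossingCount w :=
  Nat.sInf_le ⟨w, h, rfl, rfl⟩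

/-- Whether the knot is neither the unknot nor the trefoil. -/
def TableKnot.isFurther (K : TableKnot) : Bool := !(K == .k0_1) && !(K == .k3_1)

theorem TableKnot.isFurther_iff {K : TableKnot} :
    K.type ≠ TableKnot.k0_1.type ∧ K.type ≠ TableKnot.k3_1.type ↔ K.isFurther = true := by
  rw [TableKnot.type_injective.ne_iff, TableKnot.type_injective.ne_iff]
  simp [TableKnot.isFurther]

theorem TableKnot.isTwistType_and_iff (K : TableKnot) :
    (IsTwistType K.type ∧ K.type ≠ TableKnot.k0_1.type ∧ K.type ≠ TableKnot.k3_1.type) ↔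
      (K.isTwist && K.isFurther) = true := by
  rw [Bool.and_eq_true, ← TableKnot.isFurther_iff]
  refine and_congr_left fun h => TableKnot.isTwistType_iff ?_ ?_
  · rintro rfl; exact h.1 rfl
  · rintro rfl; exact h.2 rfl

theorem TableKnot.isTwoBraidTorusType_and_iff (K : TableKnot) :
    (IsTwoBraidTorusType K.type ∧ K.type ≠ TableKnot.k0_1.type ∧ K.type ≠ TableKnot.k3_1.type) ↔
      (K.isTorus && K.isFurther) = true := by
  rw [Bool.and_eq_true, ← TableKnot.isFurther_iff]
  refine and_congr_left fun h => TableKnot.isTwoBraidTorusType_iff ?_ ?_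
  · rintro rfl; exact h.1 rfl
  · rintro rfl; exact h.2 rfl

theorem TableKnot.isOtherType_iff (K : TableKnot) :
    (¬ IsTwistType K.type ∧ ¬ IsTwoBraidTorusType K.type ∧ K.type ≠ TableKnot.k0_1.type ∧
      K.type ≠ TableKnot.k3_1.type) ↔ (!K.isTwist && !K.isTorus && K.isFurther) = true := by
  rw [Bool.and_eq_true, ← TableKnot.isFurther_iff, ← and_assoc]
  refine and_congr_left fun h => ?_
  have h0 : K ≠ .k0_1 := by rintro rfl; exact h.1 rfl
  have h3 : K ≠ .k3_1 := by rintro rfl; exact h.2 rfl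
  rw [TableKnot.isTwistType_iff h0 h3, TableKnot.isTwoBraidTorusType_iff h0 h3]
  simp

end TieKnots

open TieKnots in
theorem mainTheorem10 :
    -- there are 85 tie sequences, and the table lists each of them exactly once
    {s | IsTieSequence s}.ncard = 85 ∧
    (tieTable.map Prod.fst).Nodup ∧
    (∀ s, IsTieSequence s ↔ s ∈ tieTable.map Prod.fst) ∧
    -- the diagrams are diagrams of knots, and the table gives the knot types of the tie knots
    (∀ s, IsTieSequence s → IsKnotDiagram (tieCode s)) ∧
    (∀ K : TableKnot, IsKnotDiagram K.code) ∧
    (∀ x ∈ tieTable, tieType x.1 = x.2.type) ∧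
    -- the 27 types in the table are distinct and all occur
    Function.Injective TableKnot.type ∧
    {T | ∃ s, IsTieSequence s ∧ tieType s = T} = Set.range TableKnot.type ∧
    {T | ∃ s, IsTieSequence s ∧ tieType s = T}.ncard = 27 ∧
    -- the types that occur for each number of moves, and how often
    (∀ k, {T | ∃ s, IsTieSequence s ∧ s.length = k ∧ tieType s = T} =
      {T | ∃ K ∈ typesWithMoves k, K.type = T}) ∧
    (∀ (K : TableKnot) (k : ℕ),
      {s | IsTieSequence s ∧ s.length = k ∧ tieType s = K.type}.ncard =
        ((countsByMoves K).lookup k).getD 0) ∧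
    (∀ K : TableKnot, {s | IsTieSequence s ∧ tieType s = K.type}.ncard = totalCount K) ∧
    -- unknots, trefoils, further twist knots, further torus knots, others
    {s | IsTieSequence s ∧ tieType s = TableKnot.k0_1.type}.ncard = 11 ∧
    {s | IsTieSequence s ∧ tieType s = TableKnot.k3_1.type}.ncard = 13 ∧
    {s | IsTieSequence s ∧ IsTwistType (tieType s) ∧
      tieType s ≠ TableKnot.k0_1.type ∧ tieType s ≠ TableKnot.k3_1.type}.ncard = 25 ∧
    {s | IsTieSequence s ∧ IsTwoBraidTorusType (tieType s) ∧
      tieType s ≠ TableKnot.k0_1.type ∧ tieType s ≠ TableKnot.k3_1.type}.ncard = 6 ∧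
    {s | IsTieSequence s ∧ ¬ IsTwistType (tieType s) ∧ ¬ IsTwoBraidTorusType (tieType s) ∧
      tieType s ≠ TableKnot.k0_1.type ∧ tieType s ≠ TableKnot.k3_1.type}.ncard = 30 ∧
    {T | ¬ IsTwistType T ∧ ¬ IsTwoBraidTorusType T ∧ T ≠ TableKnot.k0_1.type ∧
      T ≠ TableKnot.k3_1.type ∧ ∃ s, IsTieSequence s ∧ tieType s = T}.ncard = 18 ∧
    -- all crossing numbers are at most 8
    (∀ s, IsTieSequence s → crossingNumber (tieType s) ≤ 8) := by
  refine ⟨?_, nodup_tieTable, isTieSequence_iff_mem, ?_, isKnotDiagram_code, fun x hx => tieType_eq hx,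
    TableKnot.type_injective, ?_, ?_, types_eq_of_length, ncard_tieSequences_of_length_of_type,
    ncard_tieSequences_of_type, ncard_tieSequences_of_type _, ncard_tieSequences_of_type _,
    ?_, ?_, ?_, ?_, ?_⟩
  · have h := ncard_tieSequences (Q := fun _ => True) (fun _ => true) (by simp)
    simp only [and_true] at h
    rw [h]
    decide +kernel
  · intro s hs
    obtain ⟨x, hx, rfl⟩ := List.mem_map.1 ((isTieSequence_iff_mem s).1 hs)
    exact isKnotDiagram_tieCode hx
  · ext T
    exact exists_tieSequence_of_type_iff
  · have h := ncard_types (Q := fun _ => True) (fun _ => true) (by simp)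
    simp only [true_and] at h
    rw [h]
    decide +kernel
  · rw [ncard_tieSequences (fun x => x.2.isTwist && x.2.isFurther) fun x hx => by
      rw [tieType_eq hx, TableKnot.isTwistType_and_iff]]
    decide +kernel
  · rw [ncard_tieSequences (fun x => x.2.isTorus && x.2.isFurther) fun x hx => by
      rw [tieType_eq hx, TableKnot.isTwoBraidTorusType_and_iff]]
    decide +kernel
  · rw [ncard_tieSequences (fun x => !x.2.isTwist && !x.2.isTorus && x.2.isFurther) fun x hx => by
      rw [tieType_eq hx, TableKnot.isOtherType_iff]]
    decide +kernel
  · have h := ncard_types (Q := fun T => ¬ IsTwistType T ∧ ¬ IsTwoBraidTorusType T ∧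
      T ≠ TableKnot.k0_1.type ∧ T ≠ TableKnot.k3_1.type) _ TableKnot.isOtherType_iff
    simp only [and_assoc] at h
    rw [h]
    decide +kernel
  · intro s hs
    obtain ⟨x, hx, rfl⟩ := List.mem_map.1 ((isTieSequence_iff_mem s).1 hs)
    have h : ∀ K ∈ TableKnot.all, crossingCount K.code ≤ 8 := by decide +kernel
    rw [tieType_eq hx]
    exact (crossingNumber_le (isKnotDiagram_code x.2)).trans (h _ (TableKnot.mem_all _))
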